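/- Let $\Omega=\mathbb R^2\times\,]0,1[$, $\nu>0$, $0\le\alpha\le1$, $1<\gamma\le2$, with $\gamma=2$ if $\alpha>0$. Set $P(\rho)=\rho^\gamma/\gamma$, let $h$ be defined by $h''(\rho)=P'(\rho)/\rho$, $h(1)=h'(1)=0$, and set $Du=\frac12(\nabla u+{}^t\nabla u)$, $e^3=(0,0,1)$. For $0<\varepsilon\le1$ consider in $\Omega$ the system $$\partial_t\rho+\mathrm{div}(\rho u)=0,$$ $$\partial_t(\rho u)+\mathrm{div}(\rho u\otimes u)+\frac1{\varepsilon^2}\nabla P(\rho)+\frac1\varepsilon e^3\times\rho u-\nu\,\mathrm{div}(\rho Du)-\frac1{\varepsilon^{2(1-\alpha)}}\rho\nabla\Delta\rho=0,$$ with the boundary conditions $u\cdot n=0$, $\nabla\rho\cdot n=0$, $(Du)n\times n=0$ on $\partial\Omega$ ($n$ the outward unit normal). Define $$E_\varepsilon[\rho,u](t)=\int_\Omega\Bigl(\frac1{\varepsilon^2}h(\rho)+\frac12\rho|u|^2+\frac1{2\varepsilon^{2(1-\alpha)}}|\nabla\rho|^2\Bigr)dx,\qquad F_\varepsilon[\rho](t)=\frac{\nu^2}2\int_\Omega\rho|\nabla\log\rho|^2dx=2\nu^2\int_\Omega|\nabla\sqrt\rho|^2dx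 .$$ A smooth solution on $[0,T[$ ($0<T\le\infty$) is a pair $(\rho,u)$ which is $C^\infty$ on $[0,T[\,\times\overline\Omega$ and satisfies the system with the boundary conditions, such that, uniformly for $t$ in compact subintervals of $[0,T[$, $\rho$ is bounded below by a positive constant and all space-time derivatives (of every order, including order $0$) of $\rho-1$ and $u$ are bounded on $\Omega$ and bounded in $L^2(\Omega)$. Let $(\rho_{0,\varepsilon},u_{0,\varepsilon})_{0<\varepsilon\le1}$ be smooth initial data such that (i) $\rho_{0,\varepsilon}=1+\varepsilon r_{0,\varepsilon}$ with $(r_{0,\varepsilon})_\varepsilon$ bounded in $H^1(\Omega)\cap L^\infty(\Omega)$, and (ii) $(u_{0,\varepsilon})_\varepsilon$ is bounded in $L^2(\Omega)$. Let $(\rho_\varepsilon,u_\varepsilon)$ be corresponding smooth solutions on $[0,T_\varepsilon[$. Then there are $K_0>0$ and $\varepsilon_1\in\,]0,1]$ with $$E_\varepsilon[\rho_{0,\varepsilon},u_{0,\varepsilon}]+F_\varepsilon[\rho_{0,\varepsilon}]\le K_0\qquad\text{for all }0<\varepsilon\le\varepsilon_1 .\qquad(*)$$ Moreover there are $\varepsilon_0>0$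 and $C>0$, depending only on $K_0$ and $\nu$ (and not on $\alpha$, $\gamma$, $\varepsilon$, $T_\varepsilon$ or the solutions), such that whenever $(*)$ holds for some $K_0>0$ and $\varepsilon_1\in\,]0,1]$, then $$F_\varepsilon[\rho_\varepsilon](t)+\frac{\nu}{\varepsilon^2}\int_0^t\!\!\int_\Omega P'(\rho_\varepsilon)\,|\nabla\sqrt{\rho_\varepsilon}|^2\,dx\,d\tau+\frac{\nu}{\varepsilon^{2(1-\alpha)}}\int_0^t\!\!\int_\Omega|\nabla^2\rho_\varepsilon|^2\,dx\,d\tau\le C\,(1+t)$$ for all $0<\varepsilon\le\min(\varepsilon_0,\varepsilon_1)$ and all $0\le t<T_\varepsilon$. -/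

import Mathlib

open MeasureTheory Set
open scoped ContDiff NNReal ENNReal

noncomputable section

namespace NSK

/-- Points and vectors of three-dimensional space; the coordinates `x¹, x², x³` are
`x 0, x 1, x 2`. -/
abbrev E3 : Type := EuclideanSpace ℝ (Fin 3)

/-- The open infinite slab `Ω = ℝ² × ]0,1[`. -/
def slab : Set E3 := {x | 0 < x 2 ∧ x 2 < 1}

/-- The closed slab `ℝ² × [0,1]`. -/
def closedSlab : Set E3 := {x | 0 ≤ x 2 ∧ x 2 ≤ 1}

/-- The space-time domain `[0,T[ × ℝ² × [0,1]`, for a lifespan `T` which may be `+∞`. -/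
def spaceTime (T : EReal) : Set (ℝ × E3) :=
  {p | 0 ≤ p.1 ∧ (p.1 : EReal) < T ∧ p.2 ∈ closedSlab}

/-- The `i`-th partial derivative of a function on the closed slab (one-sided in the normal
direction at the boundary, the ordinary partial derivative inside). -/
def pd (i : Fin 3) (f : E3 → ℝ) (x : E3) : ℝ :=
  fderivWithin ℝ f closedSlab x (EuclideanSpace.single i 1)

/-- `|∇f|²`. -/
def gradSq (f : E3 → ℝ) (x : E3) : ℝ := ∑ i, pd i f x ^ 2

/-- `|∇²f|²`, with the Frobenius norm of the Hessian matrix. -/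
def hessSq (f : E3 → ℝ) (x : E3) : ℝ := ∑ i, ∑ j, pd i (pd j f) x ^ 2

/-- The Laplacian `Δf`. -/
def lap (f : E3 → ℝ) (x : E3) : ℝ := ∑ i, pd i (pd i f) x

/-- The matrix `Du = (∇u + ᵗ∇u) / 2`. -/
def strain (u : E3 → E3) (x : E3) : Matrix (Fin 3) (Fin 3) ℝ :=
  Matrix.of fun i j => (pd j (fun y => u y i) x + pd i (fun y => u y j) x) / 2

/-- The pressure `P(z) = z ^ γ / γ`. -/
def pressure (γ z : ℝ) : ℝ := z ^ γ / γ

/-- The internal energy `h`, i.e. the solution of `h'' = P' / z` on `]0,∞[` with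
`h 1 = h' 1 = 0`, see `internalEnergy_spec`. -/
def internalEnergy (γ z : ℝ) : ℝ := (z ^ γ - 1 - γ * (z - 1)) / (γ * (γ - 1))

theorem internalEnergy_spec (γ : ℝ) (hγ : 1 < γ) :
    internalEnergy γ 1 = 0 ∧ deriv (internalEnergy γ) 1 = 0 ∧
      ∀ z : ℝ, 0 < z → DifferentiableAt ℝ (internalEnergy γ) z ∧
        HasDerivAt (deriv (internalEnergy γ)) (deriv (pressure γ) z / z) z := by
  have h0 : γ ≠ 0 := by linarith
  have h1 : γ - 1 ≠ 0 := by linarith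
  have key : ∀ z : ℝ, 0 < z →
      HasDerivAt (internalEnergy γ) ((z ^ (γ - 1) - 1) / (γ - 1)) z := by
    intro z hz
    have a := ((((Real.hasDerivAt_rpow_const (p := γ) (Or.inl hz.ne')).sub_const 1).sub
      (((hasDerivAt_id z).sub_const 1).const_mul γ)).div_const (γ * (γ - 1)))
    refine a.congr_deriv ?_
    field_simp
  have hP : ∀ z : ℝ, 0 < z → deriv (pressure γ) z = z ^ (γ - 1) := by
    intro z hz
    have a := (Real.hasDerivAt_rpow_const (p := γ) (Or.inl hz.ne')).div_const γ
    refine (a.congr_deriv ?_).deriv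
    field_simp
  refine ⟨by simp [internalEnergy], by rw [(key 1 one_pos).deriv]; simp, fun z hz => ?_⟩
  refine ⟨(key z hz).differentiableAt, ?_⟩
  have hev : deriv (internalEnergy γ) =ᶠ[nhds z] fun y => (y ^ (γ - 1) - 1) / (γ - 1) := by
    filter_upwards [lt_mem_nhds hz] with y hy using (key y hy).deriv
  have a := ((Real.hasDerivAt_rpow_const (p := γ - 1) (Or.inl hz.ne')).sub_const 1).div_const
    (γ - 1)
  refine (a.congr_deriv ?_).congr_of_eventuallyEq hev
  rw [hP z hz, Real.rpow_sub_one hz.ne' (γ - 1)]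
  field_simp

/-- The energy `E_ε[ρ,u]` of a density `ρ` and a velocity field `u` on the slab
(the integrand is nonnegative). -/
def energyE (α γ ε : ℝ) (ρ : E3 → ℝ) (u : E3 → E3) : ℝ≥0∞ :=
  ∫⁻ x in slab, ENNReal.ofReal
    (internalEnergy γ (ρ x) / ε ^ 2 + ρ x * ‖u x‖ ^ 2 / 2 +
      gradSq ρ x / (2 * ε ^ (2 * (1 - α))))

/-- The BD entropy `F_ε[ρ] = (ν² / 2) ∫ ρ |∇ log ρ|²` of a positive density `ρ` on the slab. -/
def entropyF (ν : ℝ) (ρ : E3 → ℝ) : ℝ≥0∞ :=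
  ∫⁻ x in slab, ENNReal.ofReal (ν ^ 2 / 2 * (ρ x * gradSq (fun y => Real.log (ρ y)) x))

/-- Smoothness and integrability of a time-dependent field: it is `C^∞` up to the boundary on
`[0,T[ × ℝ² × [0,1]`, and its space-time derivatives of every order are bounded and square
integrable over the slab, uniformly for `t` in compact subintervals of `[0,T[`. -/
def IsSmoothField {V : Type} [NormedAddCommGroup V] [NormedSpace ℝ V] (T : EReal)
    (f : ℝ → E3 → V) : Prop :=
  ContDiffOn ℝ ∞ (Function.uncurry f) (spaceTime T) ∧
    ∀ (n : ℕ) (τ : ℝ), (τ : EReal) < T → ∃ M : ℝ≥0, ∀ t ∈ Icc 0 τ,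
      (∀ x ∈ closedSlab,
        ‖iteratedFDerivWithin ℝ n (Function.uncurry f) (spaceTime T) (t, x)‖ ≤ M) ∧
      eLpNorm (fun x => iteratedFDerivWithin ℝ n (Function.uncurry f) (spaceTime T) (t, x)) 2
        (volume.restrict slab) ≤ M

/-- `(ρ, u)` is a smooth solution, without vacuum and with `(ρ, u) → (1, 0)` at infinity, of the
scaled Navier-Stokes-Korteweg system with rotation in `[0,T[ × Ω`, with complete slip boundary
conditions. -/
structure IsSmoothSolution (α γ ν ε : ℝ) (T : EReal) (ρ : ℝ → E3 → ℝ) (u : ℝ → E3 → E3) :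
    Prop where
  smooth_density : IsSmoothField T (fun t x => ρ t x - 1)
  smooth_velocity : IsSmoothField T u
  /-- no vacuum, locally uniformly in time -/
  density_pos : ∀ τ : ℝ, (τ : EReal) < T → ∃ c : ℝ, 0 < c ∧
    ∀ t ∈ Icc 0 τ, ∀ x ∈ closedSlab, c ≤ ρ t x
  /-- `∂ₜρ + div (ρu) = 0` -/
  mass : ∀ t : ℝ, 0 < t → (t : EReal) < T → ∀ x ∈ slab,
    deriv (fun s => ρ s x) t + ∑ j, pd j (fun y => ρ t y * u t y j) x = 0
  /-- `∂ₜ(ρu) + div (ρu ⊗ u) + ε⁻² ∇P(ρ) + ε⁻¹ e³ × ρu - ν div (ρDu) - ε^(-2(1-α)) ρ∇Δρ = 0` -/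
  momentum : ∀ t : ℝ, 0 < t → (t : EReal) < T → ∀ x ∈ slab, ∀ i : Fin 3,
    deriv (fun s => ρ s x * u s x i) t + ∑ j, pd j (fun y => ρ t y * u t y i * u t y j) x
      + 1 / ε ^ 2 * pd i (fun y => pressure γ (ρ t y)) x
      + 1 / ε * crossProduct ![0, 0, 1] (fun k => ρ t x * u t x k) i
      - ν * ∑ j, pd j (fun y => ρ t y * strain (u t) y i j) x
      - 1 / ε ^ (2 * (1 - α)) * (ρ t x * pd i (lap (ρ t)) x) = 0
  /-- `u · n = 0`, `∇ρ · n = 0` and `(Du)n × n = 0` on the boundary, where the outward unit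
  normal is `n = (0, 0, 2x³ - 1)`, i.e. `-e³` on `{x³ = 0}` and `e³` on `{x³ = 1}` -/
  boundary : ∀ t : ℝ, 0 < t → (t : EReal) < T → ∀ x : E3, (x 2 = 0 ∨ x 2 = 1) →
    ∀ n : Fin 3 → ℝ, n = ![0, 0, 2 * x 2 - 1] →
      ∑ i, u t x i * n i = 0 ∧ ∑ i, pd i (ρ t) x * n i = 0 ∧
        crossProduct ((strain (u t) x).mulVec n) n = 0

/-- The assumptions on a family, indexed by `0 < ε ≤ 1`, of smooth initial data
`(1 + ε r₀, u₀)`: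
(i) the family `r₀` is bounded in `H¹(Ω) ∩ L^∞(Ω)`; (ii) the family `u₀` is bounded in `L²(Ω)`. -/
structure IsBoundedData (r₀ : ℝ → E3 → ℝ) (u₀ : ℝ → E3 → E3) : Prop where
  smooth : ∀ ε ∈ Ioc (0 : ℝ) 1,
    ContDiffOn ℝ ∞ (r₀ ε) closedSlab ∧ ContDiffOn ℝ ∞ (u₀ ε) closedSlab
  bounded : ∃ M : ℝ≥0, ∀ ε ∈ Ioc (0 : ℝ) 1,
    eLpNorm (r₀ ε) 2 (volume.restrict slab) ≤ M ∧
    (∀ i, eLpNorm (pd i (r₀ ε)) 2 (volume.restrict slab) ≤ M) ∧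
    eLpNorm (r₀ ε) ⊤ (volume.restrict slab) ≤ M ∧
    eLpNorm (u₀ ε) 2 (volume.restrict slab) ≤ M

end NSK

end

/-! ### The space-time domain and the class of admissible fields. -/

noncomputable section

namespace NSK

/-! Write a = ε⁻², κ = ε^(-2(1-α)), β = 1/ε, so that β² = a and κ ≥ 1. Testing the momentum equation
with u gives the energy balance (`energy_balance`): the energy never exceeds its initial value, and
ν∬ρ|Du|² ≤ K. Testing it with ∇log ρ gives the Bresch–Desjardins balance (`bd_balance`): the time
derivative of ∫(ν/2 ρ|∇log ρ|² + u·∇ρ), plus aX + κY with X = ∫ρ^(γ-2)|∇ρ|² and Y = ∫|∇²ρ|², equals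
∫ρ ∂ⱼuᵢ∂ᵢuⱼ minus the Coriolis term β∫(e³×u)·∇ρ. The first source is at most ∫ρ|Du|², which the
energy controls, and Young's inequality absorbs u·∇ρ. What remains is the Coriolis term, which has a
singular factor and no sign (`coriolis_le`).

Its integrand is at most β√(ρ|u|²)√L with L = ρ|∇log ρ|². Where ρ ≥ 1/2, L is at most twice the
integrand of X, and since β² = a, Young's inequality gives a small multiple of aX plus kinetic
energy. On A = {ρ < 1/2} that comparison may fail, and the smallness of A is used instead. By
Cauchy–Schwarz, ∫_A L ≤ (∫L²)^(1/2)|A|^(1/2). An integration by parts bounds ∫L² = ∫|∇ρ|⁴/ρ² by 14Y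
(`integral_log_pow_four_le`). A Sobolev inequality for (3/4-ρ)₊ bounds |A| by a constant times X³
(`measure_low_density_le`); the zero-order term of that inequality is absorbed because the energy
makes {ρ < 3/4} small. The fourth power of the low-density contribution is therefore at most a
constant times K²a²X³Y, that is a⁻¹K²(aX)³Y. For a large compared with K² it is absorbed by aX and
κY, which fixes ε₀.

The bound on the initial data is direct: once ε‖r₀‖_∞ ≤ 1/2 the initial density lies between 1/2 and
2 almost everywhere, and each part of E + F is compared with the norms of r₀ and u₀
(`initial_bound`).

All integrations by parts take place in the class `Adm`. It is stable under derivatives and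
products, contains ρ - 1, u and, with p = ∞, the powers of ρ; its L¹ members satisfy the divergence
theorem on the slab. -/

theorem convex_closedSlab : Convex ℝ closedSlab := by
  intro x hx y hy a b ha hb hab
  simp only [closedSlab, mem_ofPred_eq, PiLp.add_apply, PiLp.smul_apply, smul_eq_mul] at *
  constructor
  · nlinarith [mul_nonneg ha hx.1, mul_nonneg hb hy.1]
  · nlinarith [mul_nonneg ha (sub_nonneg.2 hx.2), mul_nonneg hb (sub_nonneg.2 hy.2)]

theorem isOpen_slab : IsOpen slab := by
  have h : Continuous fun x : E3 => x 2 := by fun_prop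
  exact (isOpen_lt continuous_const h).inter (isOpen_lt h continuous_const)

theorem measurableSet_slab : MeasurableSet slab := isOpen_slab.measurableSet

theorem slab_subset : slab ⊆ closedSlab := fun _ hx => ⟨hx.1.le, hx.2.le⟩

theorem slab_nonempty : slab.Nonempty :=
  ⟨EuclideanSpace.single 2 (1 / 2), by simp [slab]; norm_num⟩

theorem uniqueDiffOn_closedSlab : UniqueDiffOn ℝ closedSlab :=
  uniqueDiffOn_convex convex_closedSlab
    (slab_nonempty.mono (interior_maximal slab_subset isOpen_slab))

theorem spaceTime_eq (T : EReal) :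
    spaceTime T = {t : ℝ | 0 ≤ t ∧ (t : EReal) < T} ×ˢ closedSlab := by
  ext p
  simp [spaceTime, and_assoc]

theorem convex_spaceTime (T : EReal) : Convex ℝ (spaceTime T) := by
  rw [spaceTime_eq]
  refine Convex.prod (OrdConnected.convex ⟨fun x hx y hy z hz => ⟨hx.1.trans hz.1, ?_⟩⟩)
    convex_closedSlab
  exact lt_of_le_of_lt (EReal.coe_le_coe_iff.2 hz.2) hy.2

theorem mem_interior_spaceTime {T : EReal} {t : ℝ} {x : E3} (h0 : 0 < t) (h1 : (t : EReal) < T)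
    (hx : x ∈ slab) : (t, x) ∈ interior (spaceTime T) := by
  have ho : IsOpen ({t : ℝ | 0 < t ∧ (t : EReal) < T} ×ˢ slab) := by
    refine IsOpen.prod (IsOpen.inter isOpen_Ioi ?_) isOpen_slab
    exact isOpen_Iio.preimage continuous_coe_real_ereal
  refine interior_maximal ?_ ho ⟨⟨h0, h1⟩, hx⟩
  rintro ⟨s, y⟩ ⟨h, hy⟩
  exact ⟨h.1.le, h.2, slab_subset hy⟩

theorem interior_spaceTime_nonempty {T : EReal} (hT : 0 < T) :
    (interior (spaceTime T)).Nonempty := by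
  obtain ⟨s, hs0, hs1⟩ := EReal.lt_iff_exists_real_btwn.1 hT
  obtain ⟨x, hx⟩ := slab_nonempty
  exact ⟨(s, x), mem_interior_spaceTime (by exact_mod_cast hs0) hs1 hx⟩

theorem uniqueDiffOn_spaceTime {T : EReal} (hT : 0 < T) : UniqueDiffOn ℝ (spaceTime T) :=
  uniqueDiffOn_convex (convex_spaceTime T) (interior_spaceTime_nonempty hT)

/-- The derivative in the direction `v`, within the space-time domain. -/
def dd (T : EReal) (v : ℝ × E3) (F : ℝ × E3 → ℝ) (p : ℝ × E3) : ℝ :=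
  fderivWithin ℝ F (spaceTime T) p v

/-- Boundedness, uniform for `t ∈ [0,τ]`, in `L^∞` and in `L^p` over the slab. -/
def UnifBdd (τ : ℝ) (p : ℝ≥0∞) (F : ℝ × E3 → ℝ) : Prop :=
  ∃ M : ℝ≥0, ∀ t ∈ Icc 0 τ, (∀ x ∈ closedSlab, ‖F (t, x)‖ ≤ M) ∧
    eLpNorm (fun x => F (t, x)) p (volume.restrict slab) ≤ M

/-- Uniform boundedness of all derivatives up to a given order. -/
def BddDerivs (T : EReal) (τ : ℝ) (p : ℝ≥0∞) : ℕ → (ℝ × E3 → ℝ) → Prop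
  | 0, F => UnifBdd τ p F
  | n + 1, F => UnifBdd τ p F ∧ ∀ v, BddDerivs T τ p n (dd T v F)

/-- Smooth fields, all derivatives of which are bounded in `L^∞ ∩ L^p` uniformly on `[0,τ]`. -/
structure Adm (T : EReal) (τ : ℝ) (p : ℝ≥0∞) (F : ℝ × E3 → ℝ) : Prop where
  nonneg : 0 ≤ τ
  lt : (τ : EReal) < T
  smooth : ContDiffOn ℝ ∞ F (spaceTime T)
  bdd : ∀ n, BddDerivs T τ p n F

variable {T : EReal} {τ : ℝ} {p q r : ℝ≥0∞} {F G : ℝ × E3 → ℝ}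

theorem BddDerivs.unifBdd : ∀ {n : ℕ}, BddDerivs T τ p n F → UnifBdd τ p F
  | 0, h => h
  | _ + 1, h => h.1

theorem BddDerivs.of_succ : ∀ {n : ℕ} {F : ℝ × E3 → ℝ}, BddDerivs T τ p (n + 1) F →
    BddDerivs T τ p n F
  | 0, _, h => h.1
  | _ + 1, _, h => ⟨h.1, fun v => (h.2 v).of_succ⟩

theorem mem_spaceTime {t : ℝ} {x : E3} (hτ : (τ : EReal) < T) (ht : t ∈ Icc 0 τ)
    (hx : x ∈ closedSlab) : (t, x) ∈ spaceTime T :=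
  ⟨ht.1, lt_of_le_of_lt (EReal.coe_le_coe_iff.2 ht.2) hτ, hx⟩

theorem UnifBdd.congr (hτ : (τ : EReal) < T) (h : EqOn F G (spaceTime T)) (hF : UnifBdd τ p F) :
    UnifBdd τ p G := by
  obtain ⟨M, hM⟩ := hF
  refine ⟨M, fun t ht => ⟨fun x hx => ?_, ?_⟩⟩
  · rw [← h (mem_spaceTime hτ ht hx)]; exact (hM t ht).1 x hx
  · refine le_trans (eLpNorm_congr_ae ?_).le (hM t ht).2
    filter_upwards [ae_restrict_mem measurableSet_slab] with x hx
    exact (h (mem_spaceTime hτ ht (slab_subset hx))).symm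

theorem dd_congr (h : EqOn F G (spaceTime T)) (v : ℝ × E3) :
    EqOn (dd T v F) (dd T v G) (spaceTime T) := fun x hx => by
  simp only [dd]
  rw [fderivWithin_congr h (h hx)]

theorem BddDerivs.congr (hτ : (τ : EReal) < T) : ∀ {n : ℕ} {F G : ℝ × E3 → ℝ},
    EqOn F G (spaceTime T) → BddDerivs T τ p n F → BddDerivs T τ p n G
  | 0, _, _, h, hF => UnifBdd.congr hτ h hF
  | _ + 1, _, _, h, hF => ⟨hF.1.congr hτ h, fun v => (hF.2 v).congr hτ (dd_congr h v)⟩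

theorem Adm.congr (hF : Adm T τ p F) (h : EqOn F G (spaceTime T)) : Adm T τ p G :=
  ⟨hF.nonneg, hF.lt, hF.smooth.congr fun _ hx => (h hx).symm, fun n => (hF.bdd n).congr hF.lt h⟩

theorem Adm.pos (hF : Adm T τ p F) : 0 < T :=
  lt_of_le_of_lt (by exact_mod_cast hF.nonneg) hF.lt

theorem Adm.uniqueDiffOn (hF : Adm T τ p F) : UniqueDiffOn ℝ (spaceTime T) :=
  uniqueDiffOn_spaceTime hF.pos

theorem Adm.differentiableOn (hF : Adm T τ p F) : DifferentiableOn ℝ F (spaceTime T) :=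
  hF.smooth.differentiableOn (by simp)

theorem contDiffOn_dd (hT : 0 < T) (hF : ContDiffOn ℝ ∞ F (spaceTime T)) (v : ℝ × E3) :
    ContDiffOn ℝ ∞ (dd T v F) (spaceTime T) :=
  (hF.fderivWithin (uniqueDiffOn_spaceTime hT) (by simp)).clm_apply contDiffOn_const

theorem Adm.dd (hF : Adm T τ p F) (v : ℝ × E3) : Adm T τ p (dd T v F) :=
  ⟨hF.nonneg, hF.lt, contDiffOn_dd hF.pos hF.smooth v, fun n => (hF.bdd (n + 1)).2 v⟩

/-- A field is admissible if its values and its first derivatives are. -/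
theorem Adm.of_dd (h0 : 0 ≤ τ) (hτ : (τ : EReal) < T) (hF : ContDiffOn ℝ ∞ F (spaceTime T))
    (hb : UnifBdd τ p F) (hd : ∀ v, Adm T τ p (NSK.dd T v F)) : Adm T τ p F :=
  ⟨h0, hτ, hF, fun n => by
    cases n with
    | zero => exact hb
    | succ n => exact ⟨hb, fun v => (hd v).bdd n⟩⟩

theorem continuousOn_slice (hτ : (τ : EReal) < T) (hF : ContinuousOn F (spaceTime T)) {t : ℝ}
    (ht : t ∈ Icc 0 τ) : ContinuousOn (fun x => F (t, x)) closedSlab :=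
  hF.comp (by fun_prop) fun _ hx => mem_spaceTime hτ ht hx

theorem aestronglyMeasurable_slice (hτ : (τ : EReal) < T) (hF : ContinuousOn F (spaceTime T))
    {t : ℝ} (ht : t ∈ Icc 0 τ) :
    AEStronglyMeasurable (fun x => F (t, x)) (volume.restrict slab) :=
  ((continuousOn_slice hτ hF ht).mono slab_subset).aestronglyMeasurable measurableSet_slab

theorem UnifBdd.add (hp : 1 ≤ p) (hτ : (τ : EReal) < T) (hF : UnifBdd τ p F) (hG : UnifBdd τ p G)
    (hFc : ContinuousOn F (spaceTime T)) (hGc : ContinuousOn G (spaceTime T)) :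
    UnifBdd τ p (fun x => F x + G x) := by
  obtain ⟨M, hM⟩ := hF
  obtain ⟨N, hN⟩ := hG
  refine ⟨M + N, fun t ht => ⟨fun x hx => ?_, ?_⟩⟩
  · exact (norm_add_le _ _).trans (add_le_add ((hM t ht).1 x hx) ((hN t ht).1 x hx))
  · refine (eLpNorm_add_le (aestronglyMeasurable_slice hτ hFc ht)
      (aestronglyMeasurable_slice hτ hGc ht) hp).trans ?_
    push_cast
    exact add_le_add (hM t ht).2 (hN t ht).2

/-- Hölder's inequality. Only two triples matter later: (2,2,1) makes quadratic quantities
integrable, and those with one exponent ⊤ let bounded coefficients pass. -/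
theorem UnifBdd.mul [p.HolderTriple q r] (hτ : (τ : EReal) < T) (hF : UnifBdd τ p F)
    (hG : UnifBdd τ q G) (hFc : ContinuousOn F (spaceTime T))
    (hGc : ContinuousOn G (spaceTime T)) : UnifBdd τ r (fun x => F x * G x) := by
  obtain ⟨M, hM⟩ := hF
  obtain ⟨N, hN⟩ := hG
  refine ⟨M * N, fun t ht => ⟨fun x hx => ?_, ?_⟩⟩
  · rw [norm_mul]
    exact mul_le_mul ((hM t ht).1 x hx) ((hN t ht).1 x hx) (norm_nonneg _) M.2
  · refine (eLpNorm_smul_le_mul_eLpNorm (p := p) (q := q) (aestronglyMeasurable_slice hτ hGc ht)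
      (aestronglyMeasurable_slice hτ hFc ht)).trans ?_
    push_cast
    exact mul_le_mul' (hM t ht).2 (hN t ht).2

theorem dd_add (hT : 0 < T) (hF : DifferentiableOn ℝ F (spaceTime T))
    (hG : DifferentiableOn ℝ G (spaceTime T)) (v : ℝ × E3) :
    EqOn (dd T v (fun x => F x + G x)) (fun x => dd T v F x + dd T v G x) (spaceTime T) := by
  intro x hx
  simp only [dd]
  rw [fderivWithin_fun_add (uniqueDiffOn_spaceTime hT x hx) (hF x hx) (hG x hx)]
  rfl

theorem dd_mul (hT : 0 < T) (hF : DifferentiableOn ℝ F (spaceTime T))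
    (hG : DifferentiableOn ℝ G (spaceTime T)) (v : ℝ × E3) :
    EqOn (dd T v (fun x => F x * G x)) (fun x => dd T v F x * G x + F x * dd T v G x)
      (spaceTime T) := by
  intro x hx
  simp only [dd]
  rw [fderivWithin_fun_mul (uniqueDiffOn_spaceTime hT x hx) (hF x hx) (hG x hx)]
  simp
  ring

theorem BddDerivs.add (hp : 1 ≤ p) (hT : 0 < T) (hτ : (τ : EReal) < T) :
    ∀ {n : ℕ} {F G : ℝ × E3 → ℝ}, ContDiffOn ℝ ∞ F (spaceTime T) →
      ContDiffOn ℝ ∞ G (spaceTime T) → BddDerivs T τ p n F → BddDerivs T τ p n G →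
      BddDerivs T τ p n (fun x => F x + G x)
  | 0, _, _, hF, hG, h, k => UnifBdd.add hp hτ h k hF.continuousOn hG.continuousOn
  | _ + 1, _, _, hF, hG, h, k => ⟨h.1.add hp hτ k.1 hF.continuousOn hG.continuousOn, fun v =>
      ((h.2 v).add hp hT hτ (contDiffOn_dd hT hF v) (contDiffOn_dd hT hG v) (k.2 v)).congr hτ
        (dd_add hT (hF.differentiableOn (by simp)) (hG.differentiableOn (by simp)) v).symm⟩

theorem BddDerivs.mul (hr : 1 ≤ r) [p.HolderTriple q r] (hT : 0 < T) (hτ : (τ : EReal) < T) :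
    ∀ {n : ℕ} {F G : ℝ × E3 → ℝ}, ContDiffOn ℝ ∞ F (spaceTime T) →
      ContDiffOn ℝ ∞ G (spaceTime T) → BddDerivs T τ p n F → BddDerivs T τ q n G →
      BddDerivs T τ r n (fun x => F x * G x)
  | 0, _, _, hF, hG, h, k => UnifBdd.mul (p := p) (q := q) hτ h k hF.continuousOn hG.continuousOn
  | n + 1, _, _, hF, hG, h, k =>
    ⟨h.1.mul (p := p) (q := q) hτ k.1 hF.continuousOn hG.continuousOn, fun v =>
      (BddDerivs.add hr hT hτ ((contDiffOn_dd hT hF v).mul hG) (hF.mul (contDiffOn_dd hT hG v))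
        (BddDerivs.mul hr hT hτ (contDiffOn_dd hT hF v) hG (h.2 v) k.of_succ)
        (BddDerivs.mul hr hT hτ hF (contDiffOn_dd hT hG v) h.of_succ (k.2 v))).congr hτ
        (dd_mul hT (hF.differentiableOn (by simp)) (hG.differentiableOn (by simp)) v).symm⟩

theorem Adm.add' (hp : 1 ≤ p) (hF : Adm T τ p F) (hG : Adm T τ p G) :
    Adm T τ p (fun x => F x + G x) :=
  ⟨hF.nonneg, hF.lt, hF.smooth.add hG.smooth,
    fun n => (hF.bdd n).add hp hF.pos hF.lt hF.smooth hG.smooth (hG.bdd n)⟩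

theorem Adm.mul' (hr : 1 ≤ r) [p.HolderTriple q r] (hF : Adm T τ p F) (hG : Adm T τ q G) :
    Adm T τ r (fun x => F x * G x) :=
  ⟨hF.nonneg, hF.lt, hF.smooth.mul hG.smooth,
    fun n => BddDerivs.mul hr hF.pos hF.lt hF.smooth hG.smooth (hF.bdd n) (hG.bdd n)⟩

theorem UnifBdd.top (hF : UnifBdd τ p F) : UnifBdd τ ⊤ F := by
  obtain ⟨M, hM⟩ := hF
  refine ⟨M, fun t ht => ⟨(hM t ht).1, ?_⟩⟩
  rw [eLpNorm_exponent_top, eLpNormEssSup]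
  refine essSup_le_of_ae_le _ ?_
  filter_upwards [ae_restrict_mem measurableSet_slab] with x hx
  have := (hM t ht).1 x (slab_subset hx)
  rw [← ofReal_norm]
  exact ENNReal.ofReal_le_of_le_toReal (by simpa using this)

theorem BddDerivs.top : ∀ {n : ℕ} {F : ℝ × E3 → ℝ}, BddDerivs T τ p n F → BddDerivs T τ ⊤ n F
  | 0, _, h => UnifBdd.top h
  | _ + 1, _, h => ⟨h.1.top, fun v => (h.2 v).top⟩

theorem Adm.top (hF : Adm T τ p F) : Adm T τ ⊤ F :=
  ⟨hF.nonneg, hF.lt, hF.smooth, fun n => (hF.bdd n).top⟩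

theorem dd_const (c : ℝ) (v : ℝ × E3) : dd T v (fun _ => c) = fun _ => 0 := by
  funext x
  simp [dd]

theorem BddDerivs.const : ∀ {n : ℕ} (c : ℝ), BddDerivs T τ ⊤ n (fun _ => c)
  -- For p = 0 the seminorm `eLpNorm` is zero, so only the pointwise bound has to be checked, and
  -- `UnifBdd.top` upgrades it to p = ⊤.
  | 0, c => UnifBdd.top (p := 0) ⟨‖c‖₊, fun t _ => ⟨fun x _ => by simp, by simp⟩⟩
  | _ + 1, c => ⟨UnifBdd.top (p := 0) ⟨‖c‖₊, fun t _ => ⟨fun x _ => by simp, by simp⟩⟩, fun v => by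
      rw [dd_const]; exact BddDerivs.const 0⟩

theorem Adm.const (h0 : 0 ≤ τ) (hτ : (τ : EReal) < T) (c : ℝ) : Adm T τ ⊤ (fun _ => c) :=
  ⟨h0, hτ, contDiffOn_const, fun _ => BddDerivs.const c⟩

end NSK
end

/-! ### Algebra of admissible fields, pointwise differentiation rules, and smooth fields. -/

noncomputable section

namespace NSK

variable {T : EReal} {τ : ℝ} {p q r : ℝ≥0∞} {F G : ℝ × E3 → ℝ}

theorem Adm.add (hF : Adm T τ p F) (hG : Adm T τ p G) (hp : 1 ≤ p := by norm_num) :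
    Adm T τ p (fun x => F x + G x) := hF.add' hp hG

theorem Adm.mul_bdd (hF : Adm T τ p F) (hG : Adm T τ q G) (hp : 1 ≤ p := by norm_num) :
    Adm T τ p (fun x => F x * G x) := hF.mul' (q := ⊤) hp hG.top

theorem Adm.bdd_mul (hF : Adm T τ q F) (hG : Adm T τ p G) (hp : 1 ≤ p := by norm_num) :
    Adm T τ p (fun x => F x * G x) := hF.top.mul' (q := p) hp hG

theorem Adm.mul_two (hF : Adm T τ 2 F) (hG : Adm T τ 2 G) :
    Adm T τ 1 (fun x => F x * G x) := hF.mul' (q := 2) le_rfl hG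

theorem Adm.const_mul (hF : Adm T τ p F) (c : ℝ) (hp : 1 ≤ p := by norm_num) :
    Adm T τ p (fun x => c * F x) := (Adm.const hF.nonneg hF.lt c).bdd_mul hF hp

theorem Adm.sub (hF : Adm T τ p F) (hG : Adm T τ p G) (hp : 1 ≤ p := by norm_num) :
    Adm T τ p (fun x => F x - G x) :=
  (hF.add (hG.const_mul (-1) hp) hp).congr fun x _ => by ring

theorem unifBdd_zero : UnifBdd τ p (fun _ => 0) := ⟨0, fun t _ => ⟨fun x _ => by simp, by simp⟩⟩

theorem BddDerivs.zero : ∀ {n : ℕ}, BddDerivs T τ p n (fun _ => 0)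
  | 0 => unifBdd_zero
  | _ + 1 => ⟨unifBdd_zero, fun v => by rw [dd_const]; exact BddDerivs.zero⟩

theorem Adm.sum {ι : Type} (s : Finset ι) {F : ι → ℝ × E3 → ℝ} (h0 : 0 ≤ τ) (hτ : (τ : EReal) < T)
    (hF : ∀ i, Adm T τ p (F i)) (hp : 1 ≤ p := by norm_num) :
    Adm T τ p (fun x => ∑ i ∈ s, F i x) := by
  classical
  induction s using Finset.induction_on with
  | empty => simpa using ⟨h0, hτ, contDiffOn_const, fun _ => BddDerivs.zero⟩
  | insert i s hi ih =>
    exact ((hF i).add ih hp).congr fun x _ => by simp [Finset.sum_insert hi]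

/-! ### Pointwise calculus -/

/-- `F` is differentiable at `x` within the space-time domain, with derivative `c` along `v`. -/
def HasDD (T : EReal) (v : ℝ × E3) (F : ℝ × E3 → ℝ) (x : ℝ × E3) (c : ℝ) : Prop :=
  x ∈ spaceTime T ∧ UniqueDiffWithinAt ℝ (spaceTime T) x ∧
    DifferentiableWithinAt ℝ F (spaceTime T) x ∧ dd T v F x = c

variable {v : ℝ × E3} {x : ℝ × E3} {a b : ℝ}

theorem Adm.hasDD (hF : Adm T τ p F) (v : ℝ × E3) (hx : x ∈ spaceTime T) :
    HasDD T v F x (NSK.dd T v F x) :=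
  ⟨hx, hF.uniqueDiffOn x hx, hF.differentiableOn x hx, rfl⟩

theorem HasDD.eq (h : HasDD T v F x a) : dd T v F x = a := h.2.2.2

theorem HasDD.add (hF : HasDD T v F x a) (hG : HasDD T v G x b) :
    HasDD T v (fun y => F y + G y) x (a + b) := by
  obtain ⟨hx, hu, hF, rfl⟩ := hF
  obtain ⟨-, -, hG, rfl⟩ := hG
  refine ⟨hx, hu, hF.add hG, ?_⟩
  simp only [dd]
  rw [fderivWithin_fun_add hu hF hG]
  rfl

theorem HasDD.sub (hF : HasDD T v F x a) (hG : HasDD T v G x b) :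
    HasDD T v (fun y => F y - G y) x (a - b) := by
  obtain ⟨hx, hu, hF, rfl⟩ := hF
  obtain ⟨-, -, hG, rfl⟩ := hG
  refine ⟨hx, hu, hF.sub hG, ?_⟩
  simp only [dd]
  rw [fderivWithin_fun_sub hu hF hG]
  rfl

theorem HasDD.mul (hF : HasDD T v F x a) (hG : HasDD T v G x b) :
    HasDD T v (fun y => F y * G y) x (a * G x + F x * b) := by
  obtain ⟨hx, hu, hF, rfl⟩ := hF
  obtain ⟨-, -, hG, rfl⟩ := hG
  refine ⟨hx, hu, hF.mul hG, ?_⟩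
  simp only [dd]
  rw [fderivWithin_fun_mul hu hF hG]
  simp
  ring

theorem HasDD.const_mul (c : ℝ) (hF : HasDD T v F x a) :
    HasDD T v (fun y => c * F y) x (c * a) := by
  obtain ⟨hx, hu, hF, rfl⟩ := hF
  refine ⟨hx, hu, hF.const_mul c, ?_⟩
  simp only [dd]
  rw [fderivWithin_const_mul hu hF]
  rfl

theorem HasDD.sum {ι : Type} {s : Finset ι} {F : ι → ℝ × E3 → ℝ} {a : ι → ℝ}
    (hx : x ∈ spaceTime T) (hu : UniqueDiffWithinAt ℝ (spaceTime T) x)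
    (hF : ∀ i, HasDD T v (F i) x (a i)) :
    HasDD T v (fun y => ∑ i ∈ s, F i y) x (∑ i ∈ s, a i) := by
  refine ⟨hx, hu, DifferentiableWithinAt.fun_sum fun i _ => (hF i).2.2.1, ?_⟩
  simp only [dd]
  rw [fderivWithin_fun_sum hu fun i _ => (hF i).2.2.1]
  simp only [FunLike.coe_sum, Finset.sum_apply]
  exact Finset.sum_congr rfl fun i _ => (hF i).eq

theorem HasDD.comp {g : ℝ → ℝ} {g' : ℝ} (hg : HasDerivAt g g' (F x)) (hF : HasDD T v F x a) :
    HasDD T v (fun y => g (F y)) x (g' * a) := by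
  obtain ⟨hx, hu, hF, rfl⟩ := hF
  have h := hg.comp_hasFDerivWithinAt x hF.hasFDerivWithinAt
  refine ⟨hx, hu, h.differentiableWithinAt, ?_⟩
  have h2 := h.fderivWithin hu
  simp only [dd]
  simp only [Function.comp_def] at h2
  rw [h2]
  simp

theorem HasDD.congr (hF : HasDD T v F x a) (h : EqOn G F (spaceTime T)) : HasDD T v G x a := by
  obtain ⟨hx, hu, hF, rfl⟩ := hF
  exact ⟨hx, hu, hF.congr (fun y hy => h hy) (h hx), dd_congr h v hx⟩

/-- Mixed derivatives commute. -/
theorem Adm.dd_comm (hF : Adm T τ p F) (v w : ℝ × E3) (hx : x ∈ spaceTime T) :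
    NSK.dd T v (NSK.dd T w F) x = NSK.dd T w (NSK.dd T v F) x := by
  have hd : ContDiffOn ℝ ∞ (fderivWithin ℝ F (spaceTime T)) (spaceTime T) :=
    hF.smooth.fderivWithin hF.uniqueDiffOn (by simp)
  have hd' := hd.differentiableOn (by simp) x hx
  have key : ∀ v w, NSK.dd T v (NSK.dd T w F) x =
      fderivWithin ℝ (fderivWithin ℝ F (spaceTime T)) (spaceTime T) x v w := by
    intro v w
    have h := (hd'.hasFDerivWithinAt.clm_apply (hasFDerivWithinAt_const w x _)).fderivWithin
      (hF.uniqueDiffOn x hx)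
    change fderivWithin ℝ (fun y => fderivWithin ℝ F (spaceTime T) y w) (spaceTime T) x v = _
    rw [h]
    simp
  rw [key, key]
  -- Symmetry up to the boundary requires the point to be a limit of interior points; for a convex
  -- set with nonempty interior every point is.
  have hs := (hF.smooth x hx).isSymmSndFDerivWithinAt
    (by
      rw [minSmoothness_of_isRCLikeNormedField]
      exact WithTop.coe_le_coe.2 (le_top : (2 : ℕ∞) ≤ ⊤)) hF.uniqueDiffOn
    (by
      rw [(convex_spaceTime T).closure_interior_eq_closure_of_nonempty_interior
        (interior_spaceTime_nonempty hF.pos)]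
      exact subset_closure hx) hx
  exact hs.eq v w

/-! ### Smooth fields are admissible -/

/-- Serves twice: it extracts the components of the velocity, and it evaluates a Fréchet derivative
in a fixed direction, which turns bounds on iterated derivatives into the recursive bounds of
`BddDerivs`. -/
theorem isSmoothField_clm {V W : Type} [NormedAddCommGroup V] [NormedSpace ℝ V]
    [NormedAddCommGroup W] [NormedSpace ℝ W] (hT : 0 < T) {f : ℝ → E3 → V}
    (hf : IsSmoothField T f) (L : V →L[ℝ] W) : IsSmoothField T (fun t x => L (f t x)) := by
  refine ⟨L.contDiff.comp_contDiffOn hf.1, fun n τ hτ => ?_⟩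
  obtain ⟨M, hM⟩ := hf.2 n τ hτ
  have hb : ∀ p ∈ spaceTime T, ‖iteratedFDerivWithin ℝ n
      (Function.uncurry fun t x => L (f t x)) (spaceTime T) p‖ ≤
      ‖L‖ * ‖iteratedFDerivWithin ℝ n (Function.uncurry f) (spaceTime T) p‖ := fun p hp =>
    L.norm_iteratedFDerivWithin_comp_left (hf.1 p hp) (uniqueDiffOn_spaceTime hT) hp
      (by exact_mod_cast le_top)
  refine ⟨‖L‖₊ * M, fun t ht => ⟨fun x hx => ?_, ?_⟩⟩
  · exact (hb _ (mem_spaceTime hτ ht hx)).trans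
      (mul_le_mul_of_nonneg_left ((hM t ht).1 x hx) (norm_nonneg _))
  · refine (eLpNorm_le_nnreal_smul_eLpNorm_of_ae_le_mul (c := ‖L‖₊)
      (g := fun x => iteratedFDerivWithin ℝ n (Function.uncurry f) (spaceTime T) (t, x)) ?_ 2).trans
      ?_
    · filter_upwards [ae_restrict_mem measurableSet_slab] with x hx
      exact hb _ (mem_spaceTime hτ ht (slab_subset hx))
    · rw [ENNReal.smul_def, smul_eq_mul]
      push_cast
      exact mul_le_mul' le_rfl (hM t ht).2

theorem isSmoothField_fderivWithin {V : Type} [NormedAddCommGroup V] [NormedSpace ℝ V]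
    (hT : 0 < T) {f : ℝ → E3 → V} (hf : IsSmoothField T f) :
    IsSmoothField T (fun t x => fderivWithin ℝ (Function.uncurry f) (spaceTime T) (t, x)) := by
  refine ⟨hf.1.fderivWithin (uniqueDiffOn_spaceTime hT) (by simp), fun n τ hτ => ?_⟩
  obtain ⟨M, hM⟩ := hf.2 (n + 1) τ hτ
  have hb : ∀ p ∈ spaceTime T, ‖iteratedFDerivWithin ℝ n
      (Function.uncurry fun t x => fderivWithin ℝ (Function.uncurry f) (spaceTime T) (t, x))
        (spaceTime T) p‖ =
      ‖iteratedFDerivWithin ℝ (n + 1) (Function.uncurry f) (spaceTime T) p‖ := fun p hp =>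
    norm_iteratedFDerivWithin_fderivWithin (uniqueDiffOn_spaceTime hT) hp
  refine ⟨M, fun t ht => ⟨fun x hx => ?_, ?_⟩⟩
  · rw [hb _ (mem_spaceTime hτ ht hx)]
    exact (hM t ht).1 x hx
  · refine (eLpNorm_congr_norm_ae ?_).le.trans (hM t ht).2
    filter_upwards [ae_restrict_mem measurableSet_slab] with x hx
    exact hb _ (mem_spaceTime hτ ht (slab_subset hx))

theorem IsSmoothField.unifBdd {f : ℝ → E3 → ℝ} (hf : IsSmoothField T f) (hτ : (τ : EReal) < T) :
    UnifBdd τ 2 (Function.uncurry f) := by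
  obtain ⟨M, hM⟩ := hf.2 0 τ hτ
  refine ⟨M, fun t ht => ⟨fun x hx => ?_, ?_⟩⟩
  · rw [← norm_iteratedFDerivWithin_zero (𝕜 := ℝ) (s := spaceTime T)]
    exact (hM t ht).1 x hx
  · refine (eLpNorm_congr_norm_ae ?_).le.trans (hM t ht).2
    filter_upwards with x
    rw [norm_iteratedFDerivWithin_zero]

theorem IsSmoothField.bddDerivs (hT : 0 < T) (hτ : (τ : EReal) < T) :
    ∀ {n : ℕ} {f : ℝ → E3 → ℝ}, IsSmoothField T f → BddDerivs T τ 2 n (Function.uncurry f)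
  | 0, _, hf => hf.unifBdd hτ
  | _ + 1, _, hf => ⟨hf.unifBdd hτ, fun v => IsSmoothField.bddDerivs hT hτ
      (isSmoothField_clm hT (isSmoothField_fderivWithin hT hf)
        (ContinuousLinearMap.apply ℝ ℝ v))⟩

theorem IsSmoothField.adm {f : ℝ → E3 → ℝ} (hf : IsSmoothField T f) (h0 : 0 ≤ τ)
    (hτ : (τ : EReal) < T) : Adm T τ 2 (Function.uncurry f) :=
  ⟨h0, hτ, hf.1, fun _ =>
    hf.bddDerivs (lt_of_le_of_lt (by exact_mod_cast h0) hτ) hτ⟩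

/-! ### Space and time derivatives -/

/-- The `i`-th spatial derivative of a space-time field. -/
abbrev dx (T : EReal) (i : Fin 3) (F : ℝ × E3 → ℝ) : ℝ × E3 → ℝ :=
  dd T (0, EuclideanSpace.single i 1) F

/-- The time derivative of a space-time field. -/
abbrev dt (T : EReal) (F : ℝ × E3 → ℝ) : ℝ × E3 → ℝ := dd T (1, 0) F

theorem pd_congr {f g : E3 → ℝ} (h : EqOn f g closedSlab) (i : Fin 3) :
    EqOn (pd i f) (pd i g) closedSlab := fun y hy => by
  simp only [pd]
  rw [fderivWithin_congr h (h hy)]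

/-- The chain rule through x ↦ (t, x). It is the bridge between the spatial derivatives of the
statement and those used throughout the proof. -/
theorem pd_slice (hF : DifferentiableOn ℝ F (spaceTime T)) {t : ℝ} (h0 : 0 ≤ t)
    (hτ : (t : EReal) < T) (i : Fin 3) :
    EqOn (pd i (fun x => F (t, x))) (fun x => dx T i F (t, x)) closedSlab := by
  intro y hy
  have hm : ∀ z ∈ closedSlab, (t, z) ∈ spaceTime T := fun z hz => ⟨h0, hτ, hz⟩
  have h1 : HasFDerivWithinAt (fun z : E3 => (t, z)) (ContinuousLinearMap.inr ℝ ℝ E3)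
      closedSlab y := (hasFDerivAt_prodMk_right t y).hasFDerivWithinAt
  have h2 := (hF _ (hm y hy)).hasFDerivWithinAt.comp y h1 hm
  have h3 := h2.fderivWithin (uniqueDiffOn_closedSlab y hy)
  simp only [Function.comp_def] at h3
  simp only [pd, dx, dd]
  rw [h3]
  simp

theorem hasDerivAt_time (hF : DifferentiableOn ℝ F (spaceTime T)) {t : ℝ} (h0 : 0 < t)
    (hτ : (t : EReal) < T) {y : E3} (hy : y ∈ closedSlab) :
    HasDerivAt (fun s => F (s, y)) (dt T F (t, y)) t := by
  have hU : {s : ℝ | 0 < s ∧ (s : EReal) < T} ∈ nhds t :=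
    (IsOpen.inter isOpen_Ioi (isOpen_Iio.preimage continuous_coe_real_ereal)).mem_nhds ⟨h0, hτ⟩
  have hm : MapsTo (fun s : ℝ => (s, y)) {s : ℝ | 0 < s ∧ (s : EReal) < T} (spaceTime T) :=
    fun s hs => ⟨hs.1.le, hs.2, hy⟩
  have h1 : HasFDerivWithinAt (fun s : ℝ => (s, y)) (ContinuousLinearMap.inl ℝ ℝ E3)
      {s : ℝ | 0 < s ∧ (s : EReal) < T} t := (hasFDerivAt_prodMk_left t y).hasFDerivWithinAt
  have h2 := ((hF _ (hm ⟨h0, hτ⟩)).hasFDerivWithinAt.comp t h1 hm).hasFDerivAt hU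
  have h3 := h2.hasDerivAt
  simpa [dt, dd, Function.comp_def] using h3

end NSK
end

/-! ### Integrals of admissible fields: Fubini in time and along coordinate lines, and the
divergence theorem. -/

noncomputable section

namespace NSK

variable {T : EReal} {τ : ℝ} {p q r : ℝ≥0∞} {F G : ℝ × E3 → ℝ}

/-! ### Integrability -/

theorem Adm.continuousOn (hF : Adm T τ p F) : ContinuousOn F (spaceTime T) :=
  hF.smooth.continuousOn

theorem Adm.integrable_slice (hF : Adm T τ 1 F) {t : ℝ} (ht : t ∈ Icc 0 τ) :
    IntegrableOn (fun x => F (t, x)) slab := by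
  obtain ⟨M, hM⟩ := (hF.bdd 0).unifBdd
  exact memLp_one_iff_integrable.1 ⟨aestronglyMeasurable_slice hF.lt hF.continuousOn ht,
    lt_of_le_of_lt (hM t ht).2 ENNReal.coe_lt_top⟩

/-- The L¹ bound is uniform in time and the time interval is finite; this supplies the hypothesis of
Fubini's theorem. -/
theorem Adm.integrable_prod (hF : Adm T τ 1 F) :
    Integrable F ((volume.restrict (Ioc 0 τ)).prod (volume.restrict slab)) := by
  have hm : AEStronglyMeasurable F ((volume.restrict (Ioc 0 τ)).prod (volume.restrict slab)) := by
    rw [Measure.prod_restrict]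
    refine ContinuousOn.aestronglyMeasurable (hF.continuousOn.mono ?_)
      (measurableSet_Ioc.prod measurableSet_slab)
    exact fun z hz => mem_spaceTime hF.lt (Ioc_subset_Icc_self hz.1) (slab_subset hz.2)
  obtain ⟨M, hM⟩ := (hF.bdd 0).unifBdd
  rw [integrable_prod_iff hm]
  refine ⟨?_, ?_⟩
  · filter_upwards [ae_restrict_mem measurableSet_Ioc] with t ht
    exact hF.integrable_slice (Ioc_subset_Icc_self ht)
  · refine Integrable.of_bound hm.norm.integral_prod_right' (M : ℝ) ?_
    filter_upwards [ae_restrict_mem measurableSet_Ioc] with t ht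
    rw [Real.norm_of_nonneg (integral_nonneg fun _ => norm_nonneg _),
      integral_norm_eq_lintegral_enorm (hF.integrable_slice (Ioc_subset_Icc_self ht)).1,
      ← eLpNorm_one_eq_lintegral_enorm]
    exact ENNReal.toReal_le_of_le_ofReal M.2
      (by simpa using (hM t (Ioc_subset_Icc_self ht)).2)

theorem Adm.integrable_time (hF : Adm T τ 1 F) :
    IntegrableOn (fun t => ∫ x in slab, F (t, x)) (Ioc 0 τ) :=
  hF.integrable_prod.integral_prod_left

/-- The fundamental theorem of calculus in time, integrated over the slab. -/
theorem Adm.integral_dt (hF : Adm T τ 1 F) :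
    ∫ t in Ioc 0 τ, ∫ x in slab, dt T F (t, x) =
      (∫ x in slab, F (τ, x)) - ∫ x in slab, F (0, x) := by
  have h0 := hF.nonneg
  rw [integral_integral_swap (f := fun t x => dt T F (t, x)) (hF.dd _).integrable_prod,
    ← integral_sub (hF.integrable_slice (right_mem_Icc.2 h0))
      (hF.integrable_slice (left_mem_Icc.2 h0))]
  refine setIntegral_congr_fun measurableSet_slab fun x hx => ?_
  have hm : MapsTo (fun t : ℝ => (t, x)) (Icc 0 τ) (spaceTime T) := fun t ht =>
    mem_spaceTime hF.lt ht (slab_subset hx)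
  have hc : ∀ {G : ℝ × E3 → ℝ}, ContinuousOn G (spaceTime T) →
      ContinuousOn (fun t => G (t, x)) (Icc 0 τ) := fun hG => hG.comp (by fun_prop) hm
  have h := intervalIntegral.integral_eq_sub_of_hasDerivAt_of_le h0 (hc hF.continuousOn)
    (fun t ht => hasDerivAt_time hF.differentiableOn ht.1
      (hm ⟨ht.1.le, ht.2.le⟩).2.1 (slab_subset hx))
    ((hc (hF.dd (1, 0)).continuousOn).intervalIntegrable_of_Icc h0)
  rw [intervalIntegral.integral_of_le h0] at h
  exact h

/-! ### Integration by parts -/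

/-- The line in the direction `i` through the point with other coordinates `y`. -/
def line (i : Fin 3) (y : Fin 2 → ℝ) (s : ℝ) : E3 := WithLp.toLp 2 (i.insertNth s y)

theorem line_apply (i : Fin 3) (y : Fin 2 → ℝ) (s : ℝ) (j : Fin 3) :
    line i y s j = if j = i then s else line i y 0 j := by
  simp only [line]
  split_ifs with h
  · subst h; simp
  · obtain ⟨k, rfl⟩ := Fin.exists_succAbove_eq h
    simp

theorem line_eq (i : Fin 3) (y : Fin 2 → ℝ) (s : ℝ) :
    line i y s = line i y 0 + s • EuclideanSpace.single i 1 := by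
  ext j
  rw [line_apply]
  by_cases h : j = i
  · subst h; simp [line]
  · simp [h]

theorem hasDerivAt_line (i : Fin 3) (y : Fin 2 → ℝ) (s : ℝ) :
    HasDerivAt (line i y) (EuclideanSpace.single i 1) s := by
  have h : line i y = fun s => line i y 0 + s • EuclideanSpace.single i 1 := by
    funext s; exact line_eq i y s
  rw [h]
  simpa using ((hasDerivAt_id s).smul_const (EuclideanSpace.single i (1 : ℝ))).const_add
    (line i y 0)

theorem continuous_line (i : Fin 3) (y : Fin 2 → ℝ) : Continuous (line i y) :=
  continuous_iff_continuousAt.2 fun s => (hasDerivAt_line i y s).continuousAt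

theorem measurePreserving_line (i : Fin 3) :
    MeasurePreserving (fun z : ℝ × (Fin 2 → ℝ) => line i z.2 z.1) volume volume :=
  (EuclideanSpace.volume_preserving_symm_measurableEquiv_toLp (Fin 3)).symm.comp
    (volume_preserving_piFinSuccAbove (fun _ => ℝ) i).symm

theorem measurableEmbedding_line (i : Fin 3) :
    MeasurableEmbedding (fun z : ℝ × (Fin 2 → ℝ) => line i z.2 z.1) :=
  (MeasurableEquiv.toLp 2 (Fin 3 → ℝ)).measurableEmbedding.comp
    (MeasurableEquiv.piFinSuccAbove (fun _ => ℝ) i).symm.measurableEmbedding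

theorem integrable_comp_line {f : E3 → ℝ} (hf : Integrable f) (i : Fin 3) :
    Integrable (fun z : ℝ × (Fin 2 → ℝ) => f (line i z.2 z.1)) (volume.prod volume) :=
  (measurePreserving_line i).integrable_comp_of_integrable hf

theorem integral_eq_integral_line {f : E3 → ℝ} (hf : Integrable f) (i : Fin 3) :
    ∫ x, f x = ∫ y, ∫ s, f (line i y s) := by
  rw [← (measurePreserving_line i).integral_comp (measurableEmbedding_line i)]
  exact integral_prod_symm _ (integrable_comp_line hf i)

theorem line_mem_slab {i : Fin 3} (hi : i ≠ 2) (y : Fin 2 → ℝ) (s : ℝ) :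
    line i y s ∈ slab ↔ line i y 0 ∈ slab := by
  simp only [slab, mem_ofPred_eq]
  rw [line_apply, if_neg (Ne.symm hi)]

theorem line_two_mem_slab (y : Fin 2 → ℝ) (s : ℝ) : line 2 y s ∈ slab ↔ s ∈ Ioo 0 1 := by
  simp only [slab, mem_ofPred_eq]
  rw [line_apply, if_pos rfl]
  rfl

theorem hasDerivAt_comp_line (hF : DifferentiableOn ℝ F (spaceTime T)) {t : ℝ} (h0 : 0 ≤ t)
    (hτ : (t : EReal) < T) {i : Fin 3} {y : Fin 2 → ℝ} {s : ℝ} (hs : line i y s ∈ slab) :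
    HasDerivAt (fun s => F (t, line i y s)) (dx T i F (t, line i y s)) s := by
  have hd : DifferentiableOn ℝ (fun x => F (t, x)) closedSlab :=
    hF.comp (by fun_prop) fun _ hx => ⟨h0, hτ, hx⟩
  have hn : closedSlab ∈ nhds (line i y s) :=
    Filter.mem_of_superset (isOpen_slab.mem_nhds hs) slab_subset
  have h := ((hd _ (slab_subset hs)).hasFDerivWithinAt.hasFDerivAt hn).comp_hasDerivAt s
    (hasDerivAt_line i y s)
  have h2 := pd_slice hF h0 hτ i (slab_subset hs)
  simp only [pd] at h2
  rw [h2] at h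
  exact h

/-- The integral of a partial derivative over the slab vanishes; in the normal direction the
field has to vanish at the boundary. -/
theorem Adm.integral_dx (hF : Adm T τ 1 F) {t : ℝ} (ht : t ∈ Icc 0 τ) (i : Fin 3)
    (hb : i = 2 → ∀ x : E3, (x 2 = 0 ∨ x 2 = 1) → F (t, x) = 0) :
    ∫ x in slab, dx T i F (t, x) = 0 := by
  have hτ : (t : EReal) < T := lt_of_le_of_lt (EReal.coe_le_coe_iff.2 ht.2) hF.lt
  have hi0 := ((hF.integrable_slice ht).integrable_indicator measurableSet_slab)
  have hi1 := (((hF.dd (0, EuclideanSpace.single i 1)).integrable_slice ht).integrable_indicator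
    measurableSet_slab)
  rw [← integral_indicator measurableSet_slab, integral_eq_integral_line hi1 i]
  have ha0 := (integrable_comp_line hi0 i).prod_left_ae
  have ha1 := (integrable_comp_line hi1 i).prod_left_ae
  refine integral_eq_zero_of_ae ?_
  filter_upwards [ha0, ha1] with y hy0 hy1
  -- A vertical line meets the slab in a unit interval, so the fundamental theorem and the boundary
  -- condition apply. A horizontal line lies inside the slab or misses it; on the whole line the
  -- derivative of an integrable function, if integrable, has integral zero.
  by_cases hi : i = 2
  · subst hi
    have e : (fun s => slab.indicator (fun x => dx T 2 F (t, x)) (line 2 y s)) =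
        (Ioo 0 1).indicator fun s => dx T 2 F (t, line 2 y s) := by
      funext s
      simp only [indicator, line_two_mem_slab]
    have hc : ∀ {G : ℝ × E3 → ℝ}, ContinuousOn G (spaceTime T) →
        ContinuousOn (fun s => G (t, line 2 y s)) (Icc 0 1) := fun hG =>
      hG.comp (by have := continuous_line 2 y; fun_prop) fun s hs =>
        ⟨ht.1, hτ, by simpa [closedSlab, line_apply 2 y s] using hs⟩
    have h := intervalIntegral.integral_eq_sub_of_hasDerivAt_of_le zero_le_one
      (hc hF.continuousOn)
      (fun s hs => hasDerivAt_comp_line hF.differentiableOn ht.1 hτ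
        ((line_two_mem_slab y s).2 hs))
      ((hc (hF.dd (0, EuclideanSpace.single 2 1)).continuousOn).intervalIntegrable_of_Icc
        zero_le_one)
    rw [intervalIntegral.integral_of_le zero_le_one, integral_Ioc_eq_integral_Ioo,
      hb rfl (line 2 y 0) (Or.inl (by rw [line_apply, if_pos rfl])),
      hb rfl (line 2 y 1) (Or.inr (by rw [line_apply, if_pos rfl])), sub_zero] at h
    rw [e, integral_indicator measurableSet_Ioo]
    exact h
  · by_cases hs : line i y 0 ∈ slab
    · have hs' : ∀ s, line i y s ∈ slab := fun s => (line_mem_slab hi y s).2 hs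
      simp only [indicator, hs', if_true] at hy0 hy1 ⊢
      exact integral_eq_zero_of_hasDerivAt_of_integrable
        (fun s => hasDerivAt_comp_line hF.differentiableOn ht.1 hτ (hs' s)) hy1 hy0
    · have hs' : ∀ s, line i y s ∉ slab := fun s h => hs ((line_mem_slab hi y s).1 h)
      simp [indicator, hs']

/-- The divergence theorem on the slab for fields tangential to the boundary. -/
theorem integral_div_eq_zero {Q : Fin 3 → ℝ × E3 → ℝ} (hQ : ∀ j, Adm T τ 1 (Q j)) {t : ℝ}
    (ht : t ∈ Icc 0 τ) (hb : ∀ x : E3, (x 2 = 0 ∨ x 2 = 1) → Q 2 (t, x) = 0) :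
    ∫ x in slab, ∑ j, dx T j (Q j) (t, x) = 0 := by
  rw [integral_finsetSum _ fun j _ => ((hQ j).dd _).integrable_slice ht]
  refine Finset.sum_eq_zero fun j _ => (hQ j).integral_dx ht j ?_
  rintro rfl
  exact hb

/-- Derivatives tangential to the boundary of a field vanishing there. -/
theorem dx_eq_zero_of_boundary (hF : DifferentiableOn ℝ F (spaceTime T)) {t : ℝ} (h0 : 0 ≤ t)
    (hτ : (t : EReal) < T) (hb : ∀ x : E3, (x 2 = 0 ∨ x 2 = 1) → F (t, x) = 0) {i : Fin 3}
    (hi : i ≠ 2) {x : E3} (hx : x 2 = 0 ∨ x 2 = 1) : dx T i F (t, x) = 0 := by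
  have hl : ∀ s : ℝ, (x + s • EuclideanSpace.single i (1 : ℝ)) 2 = x 2 := fun s => by
    simp [Ne.symm hi]
  have hm : ∀ s : ℝ, (t, x + s • EuclideanSpace.single i (1 : ℝ)) ∈ spaceTime T := fun s => by
    refine ⟨h0, hτ, ?_⟩
    simp only [closedSlab, mem_ofPred_eq]
    rw [hl]
    rcases hx with h | h <;> rw [h] <;> norm_num
  have h1 : HasDerivWithinAt (fun s : ℝ => (t, x + s • EuclideanSpace.single i (1 : ℝ)))
      (0, EuclideanSpace.single i 1) univ 0 := by
    have := ((hasDerivAt_id (0 : ℝ)).smul_const (EuclideanSpace.single i (1 : ℝ))).const_add x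
    exact (by simpa using (hasDerivAt_const (0 : ℝ) t).prodMk this :
      HasDerivAt _ _ _).hasDerivWithinAt
  have h2 := ((hF _ (hm 0)).hasFDerivWithinAt.comp_hasDerivWithinAt (0 : ℝ) h1
    fun s _ => hm s).hasDerivAt Filter.univ_mem
  have h3 : (F ∘ fun s : ℝ => (t, x + s • EuclideanSpace.single i (1 : ℝ))) = fun _ => 0 := by
    funext s
    exact hb _ (by rw [hl]; exact hx)
  rw [h3] at h2
  have h4 := h2.unique (hasDerivAt_const _ _)
  simpa [dx, dd] using h4

end NSK
end

/-! ### Gagliardo–Nirenberg on the slab, and the measure of the low-density set. -/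

noncomputable section

namespace NSK

/-! ### The Sobolev inequality on the slab -/

/-- Cauchy–Schwarz by the discriminant of l ↦ ∫(a + l b)². The squared form keeps roots out of the
later computations. -/
theorem sq_integral_mul_le {X : Type*} [MeasurableSpace X] {μ : Measure X} {a b : X → ℝ}
    (ha : Integrable (fun x => a x ^ 2) μ) (hb : Integrable (fun x => b x ^ 2) μ)
    (hab : Integrable (fun x => a x * b x) μ) :
    (∫ x, a x * b x ∂μ) ^ 2 ≤ (∫ x, a x ^ 2 ∂μ) * ∫ x, b x ^ 2 ∂μ := by
  have h : ∀ l : ℝ, 0 ≤ (∫ x, b x ^ 2 ∂μ) * (l * l) + (2 * ∫ x, a x * b x ∂μ) * l +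
      ∫ x, a x ^ 2 ∂μ := by
    intro l
    have e : ∫ x, (a x + l * b x) ^ 2 ∂μ = (∫ x, b x ^ 2 ∂μ) * (l * l) +
        (2 * ∫ x, a x * b x ∂μ) * l + ∫ x, a x ^ 2 ∂μ := by
      have e1 : ∀ x, (a x + l * b x) ^ 2 = (l * l) * b x ^ 2 + (2 * l) * (a x * b x) + a x ^ 2 :=
        fun x => by ring
      simp only [e1]
      have h1 : Integrable (fun x => (l * l) * b x ^ 2 + (2 * l) * (a x * b x)) μ :=
        (hb.const_mul (l * l)).add (hab.const_mul (2 * l))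
      rw [integral_add h1 ha, integral_add (hb.const_mul (l * l)) (hab.const_mul (2 * l)),
        integral_const_mul, integral_const_mul]
      ring
    rw [← e]
    exact integral_nonneg fun x => sq_nonneg _
  have := discrim_le_zero h
  rw [discrim] at this
  nlinarith

/-- A nonnegative function is bounded by its `W^{1,1}`-norm on a unit interval. -/
theorem le_lintegral_of_hasDerivAt {φ φ' : ℝ → ℝ} {a x : ℝ} (hx : x ∈ Ioo a (a + 1))
    (hd : ∀ s ∈ Ioo a (a + 1), HasDerivAt φ (φ' s) s) (hc : ContinuousOn φ' (Ioo a (a + 1)))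
    (h0 : ∀ s ∈ Ioo a (a + 1), 0 ≤ φ s) :
    ENNReal.ofReal (φ x) ≤ ∫⁻ s in Ioo a (a + 1), ENNReal.ofReal (φ s + |φ' s|) := by
  -- The fundamental theorem between x and an arbitrary y; averaging over y, in an interval of
  -- measure one, then gives the claim with constant one.
  have key : ∀ y ∈ Ioo a (a + 1), ENNReal.ofReal (φ x) ≤ ENNReal.ofReal (φ y) +
      ∫⁻ s in Ioo a (a + 1), ENNReal.ofReal |φ' s| := by
    intro y hy
    have hsub : uIcc y x ⊆ Ioo a (a + 1) := ordConnected_Ioo.uIcc_subset hy hx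
    have hi : IntervalIntegrable φ' volume y x := (hc.mono hsub).intervalIntegrable
    have h := intervalIntegral.integral_eq_sub_of_hasDerivAt (fun s hs => hd s (hsub hs)) hi
    have h2 : φ x ≤ φ y + ∫ s in uIoc y x, |φ' s| := by
      have := intervalIntegral.norm_integral_le_integral_norm_uIoc (f := φ') (a := y) (b := x)
        (μ := volume)
      simp only [Real.norm_eq_abs] at this
      rw [h] at this
      linarith [le_abs_self (φ x - φ y)]
    refine (ENNReal.ofReal_le_ofReal h2).trans (ENNReal.ofReal_add_le.trans
      (add_le_add le_rfl ?_))
    rw [ofReal_integral_eq_lintegral_ofReal hi.def'.abs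
      (Filter.Eventually.of_forall fun _ => abs_nonneg _)]
    exact lintegral_mono_set (uIoc_subset_uIcc.trans hsub)
  have hv : volume (Ioo a (a + 1)) = 1 := by simp
  have hφ : ContinuousOn φ (Ioo a (a + 1)) := fun s hs => (hd s hs).continuousAt.continuousWithinAt
  calc ENNReal.ofReal (φ x) = ∫⁻ _ in Ioo a (a + 1), ENNReal.ofReal (φ x) := by simp [hv]
    _ ≤ ∫⁻ y in Ioo a (a + 1), (ENNReal.ofReal (φ y) +
        ∫⁻ s in Ioo a (a + 1), ENNReal.ofReal |φ' s|) :=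
      setLIntegral_mono_ae' measurableSet_Ioo (Filter.Eventually.of_forall key)
    _ = (∫⁻ y in Ioo a (a + 1), ENNReal.ofReal (φ y)) +
        ∫⁻ s in Ioo a (a + 1), ENNReal.ofReal |φ' s| := by
      rw [lintegral_add_right _ measurable_const]
      simp [hv]
    _ = ∫⁻ s in Ioo a (a + 1), ENNReal.ofReal (φ s + |φ' s|) := by
      rw [← lintegral_add_left' (hφ.aemeasurable measurableSet_Ioo).ennreal_ofReal]
      refine setLIntegral_congr_fun measurableSet_Ioo fun s hs => ?_
      exact (ENNReal.ofReal_add (h0 s hs) (abs_nonneg _)).symm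

/-- In each direction a point of the slab lies in a segment of length one inside the slab, so a
single one-dimensional estimate handles bounded vertical and unbounded horizontal lines alike. -/
theorem exists_unit_interval (i : Fin 3) (y : Fin 2 → ℝ) (s : ℝ) (hs : line i y s ∈ slab) :
    ∃ a, s ∈ Ioo a (a + 1) ∧ ∀ r ∈ Ioo a (a + 1), line i y r ∈ slab := by
  by_cases hi : i = 2
  · subst hi
    refine ⟨0, by simpa using (line_two_mem_slab y s).1 hs, fun r hr => ?_⟩
    exact (line_two_mem_slab y r).2 (by simpa using hr)
  · exact ⟨s - 1 / 2, ⟨by linarith, by linarith⟩, fun r _ =>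
      (line_mem_slab hi y r).2 ((line_mem_slab hi y s).1 hs)⟩

theorem update_eq_line (z : Fin 3 → ℝ) (i : Fin 3) (s : ℝ) :
    WithLp.toLp 2 (Function.update z i s) = line i (fun k => z (i.succAbove k)) s := by
  ext j
  by_cases h : j = i
  · subst h; simp [line]
  · obtain ⟨k, rfl⟩ := Fin.exists_succAbove_eq h
    simp [line]

/-- The Gagliardo-Nirenberg inequality `‖g‖_{L^{3/2}} ≤ ‖g‖_{W^{1,1}}` on the slab. -/
theorem slab_gagliardo {g H : E3 → ℝ} {g' : Fin 3 → E3 → ℝ} (h0 : ∀ x ∈ slab, 0 ≤ g x)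
    (hd : ∀ i y s, line i y s ∈ slab →
      HasDerivAt (fun s => g (line i y s)) (g' i (line i y s)) s)
    (hc : ∀ i, ContinuousOn (g' i) slab) (hH : ContinuousOn H slab)
    (hle : ∀ i, ∀ x ∈ slab, g x + |g' i x| ≤ H x) :
    ∫⁻ x in slab, ENNReal.ofReal (g x) ^ (3 / 2 : ℝ) ≤
      (∫⁻ x in slab, ENNReal.ofReal (H x)) ^ (3 / 2 : ℝ) := by
  have hΦ : Measurable (slab.indicator fun x => ENNReal.ofReal (H x)) := by
    classical
    rw [← piecewise_eq_indicator]
    exact ContinuousOn.measurable_piecewise (ENNReal.continuous_ofReal.comp_continuousOn hH)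
      continuousOn_const measurableSet_slab
  have hmp := PiLp.volume_preserving_toLp (Fin 3)
  have hΦ' := hΦ.comp (WithLp.measurable_toLp 2 (Fin 3 → ℝ))
  have hconj : Real.HolderConjugate (Fintype.card (Fin 3) : ℝ) (3 / 2) := by
    rw [Real.holderConjugate_iff]
    norm_num
  -- The grid-lines (Loomis–Whitney) inequality in dimension three: the product of the square roots
  -- of the three line integrals is integrated against the 3/2 power of the total integral.
  have hgrid := lintegral_prod_lintegral_pow_le (fun _ : Fin 3 => (volume : Measure ℝ)) hconj hΦ'
  rw [← volume_pi] at hgrid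
  have hr : ∫⁻ z : Fin 3 → ℝ, ((slab.indicator fun x => ENNReal.ofReal (H x)) ∘ WithLp.toLp 2) z =
      ∫⁻ x in slab, ENNReal.ofReal (H x) := by
    rw [← lintegral_indicator measurableSet_slab]
    exact hmp.lintegral_comp hΦ
  rw [hr] at hgrid
  refine le_trans ?_ hgrid
  rw [← lintegral_indicator measurableSet_slab]
  rw [← hmp.lintegral_comp_emb (MeasurableEquiv.toLp 2 (Fin 3 → ℝ)).measurableEmbedding]
  refine lintegral_mono fun z => ?_
  by_cases hz : WithLp.toLp 2 z ∈ slab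
  swap
  · simp [indicator, hz]
  rw [indicator_of_mem hz]
  have hline : ∀ i, ENNReal.ofReal (g (WithLp.toLp 2 z)) ≤ ∫⁻ s, ((slab.indicator fun x =>
      ENNReal.ofReal (H x)) ∘ WithLp.toLp 2) (Function.update z i s) := by
    intro i
    set y : Fin 2 → ℝ := fun k => z (i.succAbove k)
    have hz' : WithLp.toLp 2 z = line i y (z i) := by
      rw [← update_eq_line, Function.update_eq_self]
    rw [hz'] at hz ⊢
    obtain ⟨a, ha, hs⟩ := exists_unit_interval i y (z i) hz
    refine (le_lintegral_of_hasDerivAt ha (fun s h => hd i y s (hs s h))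
      ((hc i).comp (continuous_line i y).continuousOn hs) fun s h => h0 _ (hs s h)).trans ?_
    rw [← lintegral_indicator measurableSet_Ioo]
    refine lintegral_mono fun s => ?_
    by_cases h : s ∈ Ioo a (a + 1)
    · rw [indicator_of_mem h]
      simp only [Function.comp_apply]
      rw [update_eq_line, indicator_of_mem (hs s h)]
      exact ENNReal.ofReal_le_ofReal (hle i _ (hs s h))
    · rw [indicator_of_notMem h]
      exact zero_le
  calc ENNReal.ofReal (g (WithLp.toLp 2 z)) ^ (3 / 2 : ℝ)
      = ∏ _i : Fin 3, ENNReal.ofReal (g (WithLp.toLp 2 z)) ^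
          (1 / ((Fintype.card (Fin 3) : ℝ) - 1)) := by
        rw [Finset.prod_const, ← ENNReal.rpow_natCast, ← ENNReal.rpow_mul]
        norm_num
    _ ≤ _ := Finset.prod_le_prod' fun i _ => ENNReal.rpow_le_rpow (hline i) (by norm_num)

/-- The fourth power is the Sobolev choice: (f⁴)^(3/2) = f⁶. It also removes the kink of the
positive part, so classical derivatives along lines suffice. -/
theorem hasDerivAt_posPart_pow (x : ℝ) :
    HasDerivAt (fun s => max s 0 ^ 4) (4 * max x 0 ^ 3) x := by
  rcases lt_trichotomy x 0 with h | rfl | h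
  · rw [max_eq_right h.le]
    refine ((hasDerivAt_const x (0 : ℝ)).congr_of_eventuallyEq ?_).congr_deriv (by norm_num)
    filter_upwards [gt_mem_nhds h] with s hs
    rw [max_eq_right hs.le]; norm_num
  · rw [hasDerivAt_iff_isLittleO_nhds_zero]
    simp only [zero_add, max_self, ne_eq, OfNat.ofNat_ne_zero, not_false_eq_true, zero_pow,
      mul_zero, sub_zero, smul_eq_mul]
    refine Asymptotics.IsBigO.trans_isLittleO (g := fun s : ℝ => s ^ 4) ?_
      (by simpa using Asymptotics.isLittleO_pow_pow (𝕜 := ℝ) (m := 1) (n := 4) (by norm_num))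
    refine Asymptotics.IsBigO.of_bound 1 (Filter.Eventually.of_forall fun s => ?_)
    rw [one_mul, norm_pow, norm_pow]
    refine pow_le_pow_left₀ (norm_nonneg _) ?_ 4
    rw [Real.norm_eq_abs, Real.norm_eq_abs, abs_of_nonneg (le_max_right _ _)]
    exact max_le (le_abs_self _) (abs_nonneg _)
  · rw [max_eq_left h.le]
    refine ((hasDerivAt_pow 4 x).congr_of_eventuallyEq ?_).congr_deriv (by norm_num)
    filter_upwards [lt_mem_nhds h] with s hs
    rw [max_eq_left hs.le]

/-- If the density is below `3/4` only on a small set, the measure of the set where it is below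
`1/2` is controlled by the gradient on the set where it is below `1`. -/
theorem measure_low_density_le {ρ : E3 → ℝ} {ρ' : Fin 3 → E3 → ℝ} (h0 : ∀ x ∈ slab, 0 ≤ ρ x)
    (hρ : ContinuousOn ρ slab) (hc : ∀ i, ContinuousOn (ρ' i) slab)
    (hd : ∀ i y s, line i y s ∈ slab →
      HasDerivAt (fun s => ρ (line i y s)) (ρ' i (line i y s)) s)
    (hi : IntegrableOn (fun x => ∑ i, ρ' i x ^ 2) slab)
    (hm : volume (slab ∩ {x | ρ x < 3 / 4}) ≤ ENNReal.ofReal (1 / 8)) :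
    (volume (slab ∩ {x | ρ x < 1 / 2})).toReal ≤
      2 ^ 30 * (∫ x in slab ∩ {x | ρ x < 1}, ∑ i, ρ' i x ^ 2) ^ 3 := by
  have hmeas : ∀ c : ℝ, MeasurableSet (slab ∩ {x | ρ x < c}) := fun c =>
    (hρ.isOpen_inter_preimage isOpen_slab isOpen_Iio).measurableSet
  set f : E3 → ℝ := fun x => max (3 / 4 - ρ x) 0 with hf
  set σ : E3 → ℝ := fun x => Real.sqrt (∑ i, ρ' i x ^ 2) with hσ
  set B := slab ∩ {x | ρ x < 3 / 4} with hB
  have hf0 : ∀ x, 0 ≤ f x := fun x => le_max_right _ _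
  have hf1 : ∀ x ∈ slab, f x ≤ 1 := fun x hx => max_le (by linarith [h0 x hx]) zero_le_one
  have hfc : ContinuousOn f slab := (continuousOn_const.sub hρ).sup continuousOn_const
  have hσc : ContinuousOn σ slab := Real.continuous_sqrt.comp_continuousOn
    (continuousOn_finsetSum _ fun i _ => (hc i).pow 2)
  have hs0 : ∀ x, 0 ≤ ∑ i, ρ' i x ^ 2 := fun x => Finset.sum_nonneg fun i _ => sq_nonneg _
  have hσ2 : ∀ x, σ x ^ 2 = ∑ i, ρ' i x ^ 2 := fun x => Real.sq_sqrt (hs0 x)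
  have hfB : ∀ x ∈ slab, x ∉ B → f x = 0 := by
    intro x hx hxB
    have : ¬ ρ x < 3 / 4 := fun h => hxB ⟨hx, h⟩
    exact max_eq_right (by linarith [not_lt.1 this])
  have hBfin : volume B ≠ ⊤ := ne_top_of_le_ne_top ENNReal.ofReal_ne_top hm
  -- reduction of integrals to the set `B`
  have hred : ∀ w : E3 → ℝ, (∀ x ∈ slab, x ∉ B → w x = 0) →
      ∫ x in slab, w x = ∫ x in B, w x := fun w hw =>
    setIntegral_eq_of_subset_of_forall_sdiff_eq_zero measurableSet_slab inter_subset_left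
      fun x hx => hw x hx.1 hx.2
  have hbdd : ∀ n : ℕ, IntegrableOn (fun x => f x ^ n) B := fun n => by
    refine IntegrableOn.of_bound hBfin.lt_top (((hfc.mono inter_subset_left).pow
      n).aestronglyMeasurable (hmeas _)) 1 ?_
    filter_upwards [ae_restrict_mem (hmeas _)] with x hx
    rw [Real.norm_of_nonneg (pow_nonneg (hf0 x) n)]
    exact pow_le_one₀ (hf0 x) (hf1 x hx.1)
  have hσi : IntegrableOn (fun x => σ x ^ 2) B := by
    simp only [hσ2]; exact hi.mono_set inter_subset_left
  have hfσ : IntegrableOn (fun x => f x ^ 3 * σ x) B := by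
    have hm' : AEStronglyMeasurable (fun x => f x ^ 3 * σ x) (volume.restrict B) :=
      (((hfc.pow 3).mul hσc).mono inter_subset_left).aestronglyMeasurable (hmeas _)
    refine Integrable.mono' ((hbdd 6).add hσi) hm' ?_
    filter_upwards with x
    rw [Real.norm_of_nonneg (mul_nonneg (pow_nonneg (hf0 x) 3) (Real.sqrt_nonneg _))]
    simp only [Pi.add_apply]
    nlinarith [sq_nonneg (f x ^ 3 - σ x), sq_nonneg (f x ^ 3), sq_nonneg (σ x)]
  set I := ∫ x in B, f x ^ 6 with hI
  set S := ∫ x in B, f x ^ 4 with hS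
  set N := ∫ x in B, f x ^ 3 * σ x with hN
  set Q := ∫ x in B, f x ^ 2 with hQ
  set g2 := ∫ x in slab ∩ {x | ρ x < 1}, ∑ i, ρ' i x ^ 2 with hg2
  have I0 : 0 ≤ I := integral_nonneg fun x => pow_nonneg (hf0 x) _
  have S0 : 0 ≤ S := integral_nonneg fun x => pow_nonneg (hf0 x) _
  have N0 : 0 ≤ N := integral_nonneg fun x =>
    mul_nonneg (pow_nonneg (hf0 x) _) (Real.sqrt_nonneg _)
  have g0 : 0 ≤ g2 := integral_nonneg hs0
  have hN2 : N ^ 2 ≤ I * g2 := by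
    have h := sq_integral_mul_le (μ := volume.restrict B) (a := fun x => f x ^ 3) (b := σ)
      (by simpa only [← pow_mul] using (hbdd (3 * 2)).integrable) hσi hfσ
    simp only [← pow_mul] at h
    refine h.trans (mul_le_mul_of_nonneg_left ?_ I0)
    simp only [hσ2]
    refine setIntegral_mono_set (hi.mono_set inter_subset_left)
      (Filter.Eventually.of_forall hs0) (LE.le.eventuallyLE ?_)
    exact fun x hx => ⟨hx.1, show ρ x < 1 from lt_trans hx.2 (by norm_num)⟩
  -- Together with Q² ≤ S|B| ≤ S/8 below, this yields S³ ≤ I²/8: the zero-order term of the Sobolev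
  -- inequality is at most half of the left side. This fixes the threshold 1/8 for the measure of {ρ
  -- < 3/4}.
  have hS2 : S ^ 2 ≤ I * Q := by
    have h := sq_integral_mul_le (μ := volume.restrict B) (a := fun x => f x ^ 3) (b := f)
      (by simpa only [← pow_mul] using (hbdd (3 * 2)).integrable) (hbdd 2)
      (by simpa only [← pow_succ] using (hbdd (3 + 1)).integrable)
    simpa only [← pow_mul, ← pow_succ] using h
  have hQ2 : Q ^ 2 ≤ S * (1 / 8) := by
    have h := sq_integral_mul_le (μ := volume.restrict B) (a := fun x => f x ^ 2)
      (b := fun _ => 1) (by simpa only [← pow_mul] using (hbdd (2 * 2)).integrable)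
      (integrableOn_const hBfin) (by simpa only [mul_one] using (hbdd 2).integrable)
    simp only [← pow_mul, mul_one, one_pow, integral_const, smul_eq_mul] at h
    refine h.trans (mul_le_mul_of_nonneg_left ?_ S0)
    simp only [measureReal_def, Measure.restrict_apply MeasurableSet.univ, univ_inter]
    exact ENNReal.toReal_le_of_le_ofReal (by norm_num) hm
  have hGN : I ^ 2 ≤ (S + 4 * N) ^ 3 := by
    have hgag := slab_gagliardo (g := fun x => f x ^ 4)
      (g' := fun i x => -(4 * f x ^ 3 * ρ' i x)) (H := fun x => f x ^ 4 + 4 * (f x ^ 3 * σ x))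
      (fun x _ => pow_nonneg (hf0 x) 4) (fun i y s hs => by
        have := (hasDerivAt_posPart_pow (3 / 4 - ρ (line i y s))).comp s
          ((hd i y s hs).const_sub (3 / 4))
        refine this.congr_deriv (by ring)) (fun i => ((continuousOn_const.mul (hfc.pow 3)).mul
          (hc i)).neg) ((hfc.pow 4).add (continuousOn_const.mul ((hfc.pow 3).mul hσc)))
      (fun i x _ => by
        have : |ρ' i x| ≤ σ x := Real.abs_le_sqrt
          (Finset.single_le_sum (f := fun i => ρ' i x ^ 2) (fun i _ => sq_nonneg _)
            (Finset.mem_univ i))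
        rw [abs_neg, abs_mul, abs_mul, abs_of_nonneg (pow_nonneg (hf0 x) 3), abs_of_nonneg
          (by norm_num : (0 : ℝ) ≤ 4)]
        nlinarith [pow_nonneg (hf0 x) 3])
    have hon : ∀ w : E3 → ℝ, IntegrableOn w B → (∀ x ∈ slab, x ∉ B → w x = 0) →
        IntegrableOn w slab := fun w hw h => by
      have := hw.integrable_indicator (hmeas _)
      refine (this.integrableOn (s := slab)).congr_fun (fun x hx => ?_) measurableSet_slab
      by_cases hxB : x ∈ B
      · rw [indicator_of_mem hxB]
      · rw [indicator_of_notMem hxB, h x hx hxB]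
    have e1 : ∫⁻ x in slab, ENNReal.ofReal (f x ^ 4) ^ (3 / 2 : ℝ) = ENNReal.ofReal I := by
      have hz : ∀ x ∈ slab, x ∉ B → f x ^ 6 = 0 := fun x hx h => by rw [hfB x hx h]; norm_num
      rw [hI, ← hred _ hz, ofReal_integral_eq_lintegral_ofReal (hon _ (hbdd 6) hz)
        (Filter.Eventually.of_forall fun x => pow_nonneg (hf0 x) 6)]
      refine lintegral_congr fun x => ?_
      rw [ENNReal.ofReal_rpow_of_nonneg (pow_nonneg (hf0 x) 4) (by norm_num),
        ← Real.rpow_natCast, ← Real.rpow_natCast, ← Real.rpow_mul (hf0 x)]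
      norm_num
    have e2 : ∫⁻ x in slab, ENNReal.ofReal (f x ^ 4 + 4 * (f x ^ 3 * σ x)) =
        ENNReal.ofReal (S + 4 * N) := by
      have hz : ∀ x ∈ slab, x ∉ B → f x ^ 4 + 4 * (f x ^ 3 * σ x) = 0 := fun x hx h => by
        rw [hfB x hx h]; norm_num
      have hint : IntegrableOn (fun x => f x ^ 4 + 4 * (f x ^ 3 * σ x)) B :=
        (hbdd 4).add (hfσ.const_mul 4)
      rw [hS, hN, ← integral_const_mul, ← integral_add (hbdd 4) (hfσ.const_mul 4), ← hred _ hz,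
        ofReal_integral_eq_lintegral_ofReal (hon _ hint hz)
        (Filter.Eventually.of_forall fun x => add_nonneg (pow_nonneg (hf0 x) 4)
          (mul_nonneg (by norm_num) (mul_nonneg (pow_nonneg (hf0 x) 3) (Real.sqrt_nonneg _))))]
    have hSN : 0 ≤ S + 4 * N := by positivity
    rw [e1, e2, ENNReal.ofReal_rpow_of_nonneg hSN (by norm_num),
      ENNReal.ofReal_le_ofReal_iff (Real.rpow_nonneg hSN _)] at hgag
    calc I ^ 2 ≤ ((S + 4 * N) ^ (3 / 2 : ℝ)) ^ 2 := pow_le_pow_left₀ I0 hgag 2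
      _ = (S + 4 * N) ^ 3 := by
        rw [← Real.rpow_natCast, ← Real.rpow_mul hSN, ← Real.rpow_natCast]
        norm_num
  -- Where ρ < 1/2, the truncation f exceeds 3/4 - 1/2 = 1/4.
  have hA : (volume (slab ∩ {x | ρ x < 1 / 2})).toReal * (1 / 4) ^ 6 ≤ I := by
    have hsub : slab ∩ {x | ρ x < 1 / 2} ⊆ B := fun x hx => ⟨hx.1, show ρ x < 3 / 4 from lt_trans hx.2 (by norm_num)⟩
    have h1 : ∫ x in slab ∩ {x | ρ x < 1 / 2}, f x ^ 6 ≤ I :=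
      setIntegral_mono_set (hbdd 6) (Filter.Eventually.of_forall fun x => pow_nonneg (hf0 x) 6)
        (LE.le.eventuallyLE hsub)
    refine le_trans ?_ h1
    have h2 := setIntegral_mono_on (f := fun _ => (1 / 4 : ℝ) ^ 6) (g := fun x => f x ^ 6)
      (integrableOn_const (ne_top_of_le_ne_top hBfin (measure_mono hsub)))
      ((hbdd 6).mono_set hsub) (hmeas _) (fun x hx => pow_le_pow_left₀ (by norm_num)
        (le_max_of_le_left (by have : ρ x < 1 / 2 := hx.2
                               linarith)) 6)
    simpa [measureReal_def] using h2
  -- conclusion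
  obtain ⟨J, J0, hJ⟩ : ∃ J : ℝ, 0 ≤ J ∧ J ^ 6 = I :=
    ⟨I ^ ((6 : ℕ) : ℝ)⁻¹, Real.rpow_nonneg I0 _, Real.rpow_inv_natCast_pow I0 (by norm_num)⟩
  set k := Real.sqrt g2 with hk
  have k0 : 0 ≤ k := Real.sqrt_nonneg _
  have hk2 : k ^ 2 = g2 := Real.sq_sqrt g0
  have hSJ : S ≤ J ^ 4 / 2 := by
    rcases S0.eq_or_lt with h | h
    · rw [← h]; positivity
    have h4 : S ^ 4 ≤ I ^ 2 * (S * (1 / 8)) := by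
      calc S ^ 4 = (S ^ 2) ^ 2 := by ring
        _ ≤ (I * Q) ^ 2 := pow_le_pow_left₀ (sq_nonneg _) hS2 2
        _ = I ^ 2 * Q ^ 2 := by ring
        _ ≤ _ := mul_le_mul_of_nonneg_left hQ2 (sq_nonneg _)
    have h3 : S ^ 3 ≤ (J ^ 4 / 2) ^ 3 := by
      have e : (J ^ 4 / 2) ^ 3 = I ^ 2 * (1 / 8) := by rw [← hJ]; ring
      rw [e]
      refine le_of_mul_le_mul_right ?_ h
      calc S ^ 3 * S = S ^ 4 := by ring
        _ ≤ _ := h4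
        _ = _ := by ring
    exact le_of_pow_le_pow_left₀ (by norm_num) (by positivity) h3
  have hNJ : N ≤ J ^ 3 * k := by
    refine le_of_sq_le_sq ?_ (by positivity)
    calc N ^ 2 ≤ I * g2 := hN2
      _ = (J ^ 3 * k) ^ 2 := by rw [← hJ, ← hk2]; ring
  have hJ4 : J ^ 4 ≤ S + 4 * N := by
    refine le_of_pow_le_pow_left₀ (n := 3) (by norm_num) (by positivity) ?_
    calc (J ^ 4) ^ 3 = I ^ 2 := by rw [← hJ]; ring
      _ ≤ _ := hGN
  -- With J the L⁶ norm of f, the bounds combine to J⁴ ≤ J⁴/2 + 4J³k. The final constant is 4⁶·8⁶ =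
  -- 2³⁰.
  have hJk : J ≤ 8 * k := by
    rcases J0.eq_or_lt with h | h
    · rw [← h]; positivity
    have : J ^ 3 * J ≤ J ^ 3 * (8 * k) := by nlinarith
    exact le_of_mul_le_mul_left this (by positivity)
  have hI6 : I ≤ 8 ^ 6 * g2 ^ 3 := by
    calc I = J ^ 6 := hJ.symm
      _ ≤ (8 * k) ^ 6 := pow_le_pow_left₀ J0 hJk 6
      _ = 8 ^ 6 * (k ^ 2) ^ 3 := by ring
      _ = _ := by rw [hk2]
  nlinarith

end NSK
end

/-! ### Functions of the density along a flow, and bounds on the internal energy. -/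

noncomputable section

namespace NSK

variable {T : EReal} {τ : ℝ} {p q r : ℝ≥0∞} {F G : ℝ × E3 → ℝ}

/-! ### Flows in terms of space-time derivatives -/

/-- The strain of a velocity field in space-time. -/
def strn (T : EReal) (U : Fin 3 → ℝ × E3 → ℝ) (i j : Fin 3) (x : ℝ × E3) : ℝ :=
  (dx T j (U i) x + dx T i (U j) x) / 2

/-- The horizontal rotation `e³ × u`. -/
def rot (U : Fin 3 → ℝ × E3 → ℝ) (i : Fin 3) (x : ℝ × E3) : ℝ := ![-U 1 x, U 0 x, 0] i

/-- Smooth solutions on `[0,τ]`, with general coefficients and all derivatives written out. -/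
structure Flow (γ ν a κ β : ℝ) (T : EReal) (τ : ℝ) (R : ℝ × E3 → ℝ)
    (U : Fin 3 → ℝ × E3 → ℝ) : Prop where
  density : Adm T τ 2 (fun x => R x - 1)
  velocity : ∀ i, Adm T τ 2 (U i)
  pos : ∀ x ∈ spaceTime T, 0 < R x
  lower : ∃ c : ℝ, 0 < c ∧ ∀ t ∈ Icc 0 τ, ∀ x ∈ closedSlab, c ≤ R (t, x)
  mass : ∀ x ∈ Ioc 0 τ ×ˢ slab, dt T R x + ∑ j, (dx T j R x * U j x + R x * dx T j (U j) x) = 0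
  momentum : ∀ x ∈ Ioc 0 τ ×ˢ slab, ∀ i,
    R x * dt T (U i) x + ∑ j, R x * U j x * dx T j (U i) x
      + a * (R x * (R x ^ (γ - 2) * dx T i R x)) + β * (R x * rot U i x)
      - ν * ∑ j, (dx T j R x * strn T U i j x
        + R x * ((dx T j (dx T j (U i)) x + dx T j (dx T i (U j)) x) / 2))
      - κ * (R x * ∑ k, dx T i (dx T k (dx T k R)) x) = 0
  boundary : ∀ t ∈ Ioc 0 τ, ∀ x : E3, (x 2 = 0 ∨ x 2 = 1) → U 2 (t, x) = 0 ∧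
    dx T 2 R (t, x) = 0 ∧ dx T 2 (U 0) (t, x) = 0 ∧ dx T 2 (U 1) (t, x) = 0

namespace Flow

variable {γ ν a κ β : ℝ} {R : ℝ × E3 → ℝ} {U : Fin 3 → ℝ × E3 → ℝ}

theorem nonneg (h : Flow γ ν a κ β T τ R U) : 0 ≤ τ := h.density.nonneg

theorem lt (h : Flow γ ν a κ β T τ R U) : (τ : EReal) < T := h.density.lt

theorem hT (h : Flow γ ν a κ β T τ R U) : 0 < T := h.density.pos

theorem admR (h : Flow γ ν a κ β T τ R U) : Adm T τ ⊤ R :=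
  (h.density.top.add (Adm.const h.nonneg h.lt 1) le_top).congr fun x _ => by ring

/-- The density itself is not square integrable, but its derivatives are those of ρ - 1. -/
theorem adm_ddR (h : Flow γ ν a κ β T τ R U) (v : ℝ × E3) : Adm T τ 2 (dd T v R) :=
  (h.density.dd v).congr fun x hx => by
    have h1 := (h.admR.hasDD v hx).sub ((Adm.const h.nonneg h.lt 1).hasDD v hx)
    rw [h1.eq, dd_const, sub_zero]

theorem mem (h : Flow γ ν a κ β T τ R U) {x : ℝ × E3} (hx : x ∈ Ioc 0 τ ×ˢ slab) :
    x ∈ spaceTime T := mem_spaceTime h.lt (Ioc_subset_Icc_self hx.1) (slab_subset hx.2)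

theorem bounds (h : Flow γ ν a κ β T τ R U) : ∃ c M : ℝ, 0 < c ∧ c ≤ 1 ∧ 1 ≤ M ∧
    ∀ t ∈ Icc 0 τ, ∀ x ∈ closedSlab, R (t, x) ∈ Icc c M := by
  obtain ⟨c, hc, hl⟩ := h.lower
  obtain ⟨M, hM⟩ := (h.admR.bdd 0).unifBdd
  refine ⟨min c 1, max M 1, lt_min hc one_pos, min_le_right _ _, le_max_right _ _,
    fun t ht x hx => ⟨(min_le_left _ _).trans (hl t ht x hx), le_trans ?_ (le_max_left _ _)⟩⟩
  exact (le_abs_self _).trans ((hM t ht).1 x hx)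

theorem contDiffOn_comp (h : Flow γ ν a κ β T τ R U) {g : ℝ → ℝ}
    (hg : ContDiffOn ℝ ∞ g (Ioi 0)) : ContDiffOn ℝ ∞ (fun x => g (R x)) (spaceTime T) :=
  hg.comp h.admR.smooth fun x hx => h.pos x hx

theorem hasDD_comp (h : Flow γ ν a κ β T τ R U) {g g' : ℝ → ℝ}
    (hg : ∀ z, 0 < z → HasDerivAt g (g' z) z) (v : ℝ × E3) {x : ℝ × E3} (hx : x ∈ spaceTime T) :
    HasDD T v (fun y => g (R y)) x (g' (R x) * dd T v R x) :=
  HasDD.comp (hg _ (h.pos x hx)) (h.admR.hasDD v hx)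

theorem unifBdd_comp (h : Flow γ ν a κ β T τ R U) {g : ℝ → ℝ} (hg : ContinuousOn g (Ioi 0)) :
    UnifBdd τ ⊤ (fun x => g (R x)) := by
  obtain ⟨c, M, hc, -, -, hb⟩ := h.bounds
  obtain ⟨B, hB⟩ := isCompact_Icc.exists_bound_of_continuousOn
    (hg.mono fun z hz => lt_of_lt_of_le hc hz.1 : ContinuousOn g (Icc c M))
  refine ⟨B.toNNReal, fun t ht => ⟨fun x hx => ?_, ?_⟩⟩
  · exact (hB _ (hb t ht x hx)).trans (Real.le_coe_toNNReal B)
  · rw [eLpNorm_exponent_top, eLpNormEssSup]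
    refine essSup_le_of_ae_le _ ?_
    filter_upwards [ae_restrict_mem measurableSet_slab] with x hx
    rw [← ofReal_norm]
    exact ENNReal.ofReal_le_ofReal (hB _ (hb t ht x (slab_subset hx)))

theorem contDiffOn_rpow (s : ℝ) : ContDiffOn ℝ ∞ (fun z : ℝ => z ^ s) (Ioi 0) := fun _ hz =>
  (Real.contDiffAt_rpow_const_of_ne (ne_of_gt hz)).contDiffWithinAt

/-- The induction on the order treats all exponents at once, because the derivative of ρ^s is
sρ^(s-1)∂ρ. -/
theorem bddDerivs_rpow (h : Flow γ ν a κ β T τ R U) :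
    ∀ (n : ℕ) (s : ℝ), BddDerivs T τ ⊤ n (fun x => R x ^ s)
  | 0, s => h.unifBdd_comp (contDiffOn_rpow s).continuousOn
  | n + 1, s => ⟨h.unifBdd_comp (contDiffOn_rpow s).continuousOn, fun v => by
      have h1 : EqOn (fun x => s * (R x ^ (s - 1) * dd T v R x)) (dd T v (fun x => R x ^ s))
          (spaceTime T) := fun x hx => by
        rw [(h.hasDD_comp (g := fun z => z ^ s) (fun z hz =>
          Real.hasDerivAt_rpow_const (p := s) (Or.inl hz.ne')) v hx).eq]
        ring
      have hs := h.contDiffOn_comp (contDiffOn_rpow (s - 1))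
      have hR := contDiffOn_dd h.hT h.admR.smooth v
      refine BddDerivs.congr h.lt h1 (BddDerivs.mul (p := ⊤) (q := ⊤) le_top h.hT h.lt
        contDiffOn_const (hs.mul hR) (BddDerivs.const s) ?_)
      exact BddDerivs.mul (p := ⊤) (q := ⊤) le_top h.hT h.lt hs hR (h.bddDerivs_rpow n (s - 1))
        ((h.admR.dd v).bdd n)⟩

theorem adm_rpow (h : Flow γ ν a κ β T τ R U) (s : ℝ) : Adm T τ ⊤ (fun x => R x ^ s) :=
  ⟨h.nonneg, h.lt, h.contDiffOn_comp (contDiffOn_rpow s), fun n => h.bddDerivs_rpow n s⟩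

theorem adm_comp_top (h : Flow γ ν a κ β T τ R U) {g g' : ℝ → ℝ}
    (hs : ContDiffOn ℝ ∞ g (Ioi 0)) (hg : ∀ z, 0 < z → HasDerivAt g (g' z) z)
    (hg' : Adm T τ ⊤ (fun x => g' (R x))) : Adm T τ ⊤ (fun x => g (R x)) :=
  Adm.of_dd h.nonneg h.lt (h.contDiffOn_comp hs) (h.unifBdd_comp hs.continuousOn) fun v =>
    (hg'.bdd_mul (h.admR.dd v) le_top).congr fun _ hx => (h.hasDD_comp hg v hx).eq.symm

/-- Since g(1) = 0 and ρ takes values in a compact subinterval of ]0,∞[, the mean value inequality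
bounds g(ρ) by a multiple of ρ - 1, which is in L². -/
theorem adm_comp_two (h : Flow γ ν a κ β T τ R U) {g g' : ℝ → ℝ}
    (hs : ContDiffOn ℝ ∞ g (Ioi 0)) (hg : ∀ z, 0 < z → HasDerivAt g (g' z) z)
    (hc : ContinuousOn g' (Ioi 0)) (hg' : Adm T τ ⊤ (fun x => g' (R x))) (h1 : g 1 = 0) :
    Adm T τ 2 (fun x => g (R x)) := by
  refine Adm.of_dd h.nonneg h.lt (h.contDiffOn_comp hs) ?_ fun v =>
    (hg'.bdd_mul (h.adm_ddR v) (by norm_num)).congr fun _ hx => (h.hasDD_comp hg v hx).eq.symm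
  obtain ⟨c, M, hc0, hc1, hM1, hb⟩ := h.bounds
  obtain ⟨B, hB⟩ := isCompact_Icc.exists_bound_of_continuousOn
    (hc.mono fun z hz => lt_of_lt_of_le hc0 hz.1 : ContinuousOn g' (Icc c M))
  have hle : ∀ z ∈ Icc c M, ‖g z‖ ≤ B.toNNReal * ‖z - 1‖ := by
    intro z hz
    have := (convex_Icc c M).norm_image_sub_le_of_norm_hasDerivWithin_le (f := g) (f' := g')
      (C := B) (fun y hy => (hg y (lt_of_lt_of_le hc0 hy.1)).hasDerivWithinAt) hB
      ⟨hc1, hM1⟩ hz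
    rw [h1, sub_zero] at this
    exact this.trans (mul_le_mul_of_nonneg_right (Real.le_coe_toNNReal B) (norm_nonneg _))
  obtain ⟨K, hK⟩ := (h.density.bdd 0).unifBdd
  refine ⟨B.toNNReal * K, fun t ht => ⟨fun x hx => ?_, ?_⟩⟩
  · exact (hle _ (hb t ht x hx)).trans
      (mul_le_mul_of_nonneg_left ((hK t ht).1 x hx) (NNReal.coe_nonneg _))
  · refine (eLpNorm_le_nnreal_smul_eLpNorm_of_ae_le_mul (c := B.toNNReal)
      (g := fun x => R (t, x) - 1) ?_ 2).trans ?_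
    · filter_upwards [ae_restrict_mem measurableSet_slab] with x hx
      exact hle _ (hb t ht x (slab_subset hx))
    · rw [ENNReal.smul_def, smul_eq_mul]
      push_cast
      exact mul_le_mul' le_rfl (hK t ht).2

theorem hasDerivAt_enthalpy {γ : ℝ} (hγ : 1 < γ) (z : ℝ) (hz : 0 < z) :
    HasDerivAt (fun z => (z ^ (γ - 1) - 1) / (γ - 1)) (z ^ (γ - 2)) z := by
  have a := ((Real.hasDerivAt_rpow_const (p := γ - 1) (Or.inl hz.ne')).sub_const 1).div_const
    (γ - 1)
  refine a.congr_deriv ?_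
  have : γ - 1 ≠ 0 := by linarith
  rw [show γ - 1 - 1 = γ - 2 by ring]
  field_simp

theorem hasDerivAt_internalEnergy {γ : ℝ} (hγ : 1 < γ) (z : ℝ) (hz : 0 < z) :
    HasDerivAt (internalEnergy γ) ((z ^ (γ - 1) - 1) / (γ - 1)) z := by
  have h0 : γ ≠ 0 := by linarith
  have h1 : γ - 1 ≠ 0 := by linarith
  have a := ((((Real.hasDerivAt_rpow_const (p := γ) (Or.inl hz.ne')).sub_const 1).sub
    (((hasDerivAt_id z).sub_const 1).const_mul γ)).div_const (γ * (γ - 1)))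
  refine a.congr_deriv ?_
  field_simp

theorem contDiffOn_internalEnergy (γ : ℝ) : ContDiffOn ℝ ∞ (internalEnergy γ) (Ioi 0) := by
  refine ContDiffOn.div_const ?_ _
  exact ((contDiffOn_rpow γ).sub contDiffOn_const).sub
    (contDiffOn_const.mul (contDiffOn_id.sub contDiffOn_const))

end Flow

/-! ### Elementary bounds for the internal energy -/

/-- Bernoulli's inequality for z^(γ-1), whose exponent lies in [0,1], in fact gives (z-1)²/γ. It
yields both the integrability of h(ρ) and the bound on the initial energy. -/
theorem internalEnergy_le {γ z : ℝ} (hγ : 1 < γ) (hγ2 : γ ≤ 2) (hz : 0 < z) :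
    internalEnergy γ z ≤ (z - 1) ^ 2 := by
  have hb : z ^ (γ - 1) ≤ 1 + (γ - 1) * (z - 1) := by
    have := rpow_one_add_le_one_add_mul_self (s := z - 1) (p := γ - 1) (by linarith)
      (by linarith) (by linarith)
    simpa using this
  have h1 : z ^ γ = z * z ^ (γ - 1) := by
    rw [Real.rpow_sub_one hz.ne']; field_simp
  rw [internalEnergy, div_le_iff₀ (by nlinarith), h1]
  nlinarith [mul_le_mul_of_nonneg_left hb hz.le, mul_nonneg (sub_nonneg.2 hγ.le) (sq_nonneg (z - 1)),
    mul_nonneg (mul_nonneg (sub_nonneg.2 hγ.le) (sub_nonneg.2 hγ.le)) (sq_nonneg (z - 1))]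

theorem internalEnergy_nonneg {γ z : ℝ} (hγ : 1 < γ) (hz : 0 < z) : 0 ≤ internalEnergy γ z := by
  have := one_add_mul_self_le_rpow_one_add (s := z - 1) (p := γ) (by linarith) hγ.le
  rw [add_sub_cancel] at this
  exact div_nonneg (by linarith) (by nlinarith)

/-- The difference h - (z-1)²/2 vanishes at 1 and is nonincreasing on ]0,1], again by Bernoulli.
Densities below 1 suffice, as only low density has to be penalised. -/
theorem le_internalEnergy {γ z : ℝ} (hγ : 1 < γ) (hγ2 : γ ≤ 2) (hz : 0 < z) (hz1 : z ≤ 1) :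
    (z - 1) ^ 2 / 2 ≤ internalEnergy γ z := by
  have hd : ∀ y, 0 < y → HasDerivAt (fun y => internalEnergy γ y - (y - 1) ^ 2 / 2)
      ((y ^ (γ - 1) - 1) / (γ - 1) - (y - 1)) y := fun y hy => by
    have h2 := (((hasDerivAt_id y).sub_const 1).pow 2).div_const 2
    refine ((Flow.hasDerivAt_internalEnergy hγ y hy).sub h2).congr_deriv ?_
    simp
  have hanti : AntitoneOn (fun y => internalEnergy γ y - (y - 1) ^ 2 / 2) (Ioc 0 1) := by
    refine antitoneOn_of_hasDerivWithinAt_nonpos (convex_Ioc 0 1)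
      (f' := fun y => (y ^ (γ - 1) - 1) / (γ - 1) - (y - 1))
      (fun y hy => (hd y hy.1).continuousAt.continuousWithinAt) ?_ ?_
    · intro y hy
      rw [interior_Ioc] at hy
      exact (hd y hy.1).hasDerivWithinAt
    · intro y hy
      rw [interior_Ioc] at hy
      have := rpow_one_add_le_one_add_mul_self (s := y - 1) (p := γ - 1)
        (by linarith [hy.1]) (by linarith) (by linarith)
      rw [add_sub_cancel] at this
      have h3 : (y ^ (γ - 1) - 1) / (γ - 1) ≤ y - 1 := by
        rw [div_le_iff₀ (by linarith)]
        linarith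
      linarith
  have := hanti ⟨hz, hz1⟩ ⟨one_pos, le_rfl⟩ hz1
  simp only [(internalEnergy_spec γ hγ).1] at this
  linarith

namespace Flow

variable {γ ν a κ β : ℝ} {R : ℝ × E3 → ℝ} {U : Fin 3 → ℝ × E3 → ℝ}

theorem adm_enthalpy (h : Flow γ ν a κ β T τ R U) (hγ : 1 < γ) :
    Adm T τ 2 (fun x => (R x ^ (γ - 1) - 1) / (γ - 1)) :=
  h.adm_comp_two (((contDiffOn_rpow (γ - 1)).sub contDiffOn_const).div_const _)
    (hasDerivAt_enthalpy hγ) (contDiffOn_rpow _).continuousOn (h.adm_rpow _) (by simp)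

/-- h vanishes to second order at 1, which places h(ρ) in L¹, and its derivatives h'(ρ)∂ρ are
products of two L² fields. -/
theorem adm_internalEnergy (h : Flow γ ν a κ β T τ R U) (hγ : 1 < γ) (hγ2 : γ ≤ 2) :
    Adm T τ 1 (fun x => internalEnergy γ (R x)) := by
  refine Adm.of_dd h.nonneg h.lt (h.contDiffOn_comp (contDiffOn_internalEnergy γ)) ?_ fun v =>
    ((h.adm_enthalpy hγ).mul_two (h.adm_ddR v)).congr fun _ hx =>
      (h.hasDD_comp (hasDerivAt_internalEnergy hγ) v hx).eq.symm
  obtain ⟨K, hK⟩ := ((h.density.mul_two h.density).bdd 0).unifBdd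
  have hb : ∀ t ∈ Icc 0 τ, ∀ x ∈ closedSlab,
      ‖internalEnergy γ (R (t, x))‖ ≤ ‖(R (t, x) - 1) * (R (t, x) - 1)‖ := fun t ht x hx => by
    have hp := h.pos _ (mem_spaceTime h.lt ht hx)
    rw [Real.norm_of_nonneg (internalEnergy_nonneg hγ hp),
      Real.norm_of_nonneg (mul_self_nonneg _), ← sq]
    exact internalEnergy_le hγ hγ2 hp
  refine ⟨K, fun t ht => ⟨fun x hx => (hb t ht x hx).trans ((hK t ht).1 x hx), ?_⟩⟩
  refine (eLpNorm_mono_ae ?_).trans (hK t ht).2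
  filter_upwards [ae_restrict_mem measurableSet_slab] with x hx
  exact hb t ht x (slab_subset hx)

theorem adm_log (h : Flow γ ν a κ β T τ R U) : Adm T τ ⊤ (fun x => Real.log (R x)) := by
  refine h.adm_comp_top (Real.contDiffOn_log.mono fun z hz => ne_of_gt hz)
    (fun z hz => Real.hasDerivAt_log hz.ne') ((h.adm_rpow (-1)).congr fun x _ => ?_)
  exact Real.rpow_neg_one _

/-- The logarithmic derivative of the density. -/
theorem dd_eq_mul_log (h : Flow γ ν a κ β T τ R U) (v : ℝ × E3) {x : ℝ × E3}
    (hx : x ∈ spaceTime T) : dd T v R x = R x * dd T v (fun x => Real.log (R x)) x := by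
  rw [(h.hasDD_comp (fun z hz => Real.hasDerivAt_log hz.ne') v hx).eq, ← mul_assoc,
    mul_inv_cancel₀ (h.pos x hx).ne', one_mul]

theorem adm_dd_log (h : Flow γ ν a κ β T τ R U) (v : ℝ × E3) :
    Adm T τ 2 (dd T v fun x => Real.log (R x)) := by
  refine ((h.adm_rpow (-1)).bdd_mul (h.adm_ddR v)).congr fun x hx => ?_
  rw [(h.hasDD_comp (fun z hz => Real.hasDerivAt_log hz.ne') v hx).eq]
  simp only [Real.rpow_neg_one]

theorem adm_strn (h : Flow γ ν a κ β T τ R U) (i j : Fin 3) : Adm T τ 2 (strn T U i j) :=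
  ((((h.velocity i).dd _).add ((h.velocity j).dd _)).const_mul (1 / 2)).congr fun x _ => by
    simp only [strn]; ring

end Flow
end NSK
end

/-! ### The energy and BD entropy identities at a point. -/

noncomputable section

namespace NSK

variable {T : EReal} {τ : ℝ} {p q r : ℝ≥0∞} {F G : ℝ × E3 → ℝ}

/-- The energy density. -/
def energyDens (γ a κ : ℝ) (T : EReal) (R : ℝ × E3 → ℝ) (U : Fin 3 → ℝ × E3 → ℝ)
    (x : ℝ × E3) : ℝ :=
  a * internalEnergy γ (R x) + 1 / 2 * (R x * ∑ i, U i x * U i x)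
    + κ / 2 * ∑ i, dx T i R x * dx T i R x

/-- The energy flux (with the opposite sign). -/
def energyFlux (γ ν a κ : ℝ) (T : EReal) (R : ℝ × E3 → ℝ) (U : Fin 3 → ℝ × E3 → ℝ) (j : Fin 3)
    (x : ℝ × E3) : ℝ :=
  κ * (R x * U j x * ∑ k, dx T k (dx T k R) x) + κ * (dt T R x * dx T j R x)
    + ν * ∑ i, U i x * (R x * strn T U i j x)
    - a * (R x * U j x * ((R x ^ (γ - 1) - 1) / (γ - 1)))
    - 1 / 2 * (R x * U j x * ∑ i, U i x * U i x)

/-- The density of the BD entropy, including the mixed term. -/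
def bdDens (ν : ℝ) (T : EReal) (R : ℝ × E3 → ℝ) (U : Fin 3 → ℝ × E3 → ℝ) (x : ℝ × E3) : ℝ :=
  ν / 2 * (R x * ∑ i, dx T i (fun y => Real.log (R y)) x * dx T i (fun y => Real.log (R y)) x)
    + ∑ i, U i x * dx T i R x

/-- The flux of the BD entropy (with the opposite sign). -/
def bdFlux (ν κ : ℝ) (T : EReal) (R : ℝ × E3 → ℝ) (U : Fin 3 → ℝ × E3 → ℝ) (j : Fin 3)
    (x : ℝ × E3) : ℝ :=
  ν * (dx T j R x * (dt T (fun y => Real.log (R y)) x +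
        ∑ k, (U k x * dx T k (fun y => Real.log (R y)) x + dx T k (U k) x)))
    - ν / 2 * (R x * U j x *
        ∑ i, dx T i (fun y => Real.log (R y)) x * dx T i (fun y => Real.log (R y)) x)
    + ν / 2 * ∑ i, dx T i R x * (dx T j (U i) x - dx T i (U j) x)
    + κ * ∑ i, dx T i R x * dx T i (dx T j R) x
    - R x * ∑ i, U i x * dx T i (U j) x
    + U j x * dt T R x + R x * U j x * ∑ k, dx T k (U k) x

namespace Flow

variable {γ ν a κ β : ℝ} {R : ℝ × E3 → ℝ} {U : Fin 3 → ℝ × E3 → ℝ}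

theorem hasDD_strn (h : Flow γ ν a κ β T τ R U) (i j : Fin 3) (v : ℝ × E3) {x : ℝ × E3}
    (hx : x ∈ spaceTime T) : HasDD T v (strn T U i j) x
      (1 / 2 * (dd T v (dx T j (U i)) x + dd T v (dx T i (U j)) x)) :=
  (((((h.velocity i).dd _).hasDD v hx).add (((h.velocity j).dd _).hasDD v hx)).const_mul
    (1 / 2)).congr fun y _ => by simp only [strn]; ring

/-- The momentum equation contracted with u, plus the mass equation times a h'(ρ) + |u|²/2 - κΔρ.
The Coriolis force drops out, being orthogonal to u. -/
theorem energy_identity (h : Flow γ ν a κ β T τ R U) (hγ : 1 < γ) {x : ℝ × E3}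
    (hx : x ∈ Ioc 0 τ ×ˢ slab) :
    dt T (energyDens γ a κ T R U) x + ν * (R x * ∑ i, ∑ j, strn T U i j x ^ 2) =
      ∑ j, dx T j (energyFlux γ ν a κ T R U j) x := by
  have hm := h.mass x hx
  have hmom := h.momentum x hx
  replace hx := h.mem hx
  have hu := uniqueDiffOn_spaceTime h.hT x hx
  have hR := fun v => h.admR.hasDD v hx
  have hU := fun i v => (h.velocity i).hasDD v hx
  have hdR := fun w v => (h.adm_ddR w).hasDD v hx
  have hQ := fun j : Fin 3 => ((((((hR (0, EuclideanSpace.single j 1)).mul (hU j _)).mul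
    (HasDD.sum (s := Finset.univ) hx hu fun k : Fin 3 =>
      ((h.adm_ddR (0, EuclideanSpace.single k 1)).dd (0, EuclideanSpace.single k 1)).hasDD _
        hx)).const_mul κ).add
    (((hdR (1, 0) _).mul (hdR (0, EuclideanSpace.single j 1) _)).const_mul κ)).add
    ((HasDD.sum (s := Finset.univ) hx hu fun i : Fin 3 =>
      (hU i _).mul ((hR _).mul (h.hasDD_strn i j _ hx))).const_mul ν)).sub
    ((((hR _).mul (hU j _)).mul (h.hasDD_comp (hasDerivAt_enthalpy hγ) _ hx)).const_mul a) |>.sub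
    ((((hR _).mul (hU j _)).mul (HasDD.sum (s := Finset.univ) hx hu fun i : Fin 3 =>
      (hU i _).mul (hU i _))).const_mul (1 / 2))
  have hE := (((h.hasDD_comp (hasDerivAt_internalEnergy hγ) (1, 0) hx).const_mul a).add
    (((hR (1, 0)).mul (HasDD.sum (s := Finset.univ) hx hu fun i : Fin 3 =>
      (hU i _).mul (hU i _))).const_mul (1 / 2))).add
    ((HasDD.sum (s := Finset.univ) hx hu fun i : Fin 3 =>
      (hdR (0, EuclideanSpace.single i 1) (1, 0)).mul
        (hdR (0, EuclideanSpace.single i 1) (1, 0))).const_mul (κ / 2))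
  refine Eq.trans ?_ (Finset.sum_congr rfl fun j _ => (hQ j).eq).symm
  rw [show dt T (energyDens γ a κ T R U) x = _ from hE.eq]
  have hc := fun i => h.admR.dd_comm (1, 0) (0, EuclideanSpace.single i 1) hx
  have hm0 := hmom 0
  have hm1 := hmom 1
  have hm2 := hmom 2
  clear hQ hE hmom
  simp only [Fin.sum_univ_three, strn, dx, dt, rot, Matrix.cons_val_zero, Matrix.cons_val_one,
    Matrix.cons_val, hc] at hm hm0 hm1 hm2 ⊢
  -- From here on the identity is polynomial in the values of the fields and their derivatives at x;
  -- the powers of ρ become independent letters.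
  generalize (R x ^ (γ - 1) - 1) / (γ - 1) = e at *
  generalize R x ^ (γ - 2) = s at *
  generalize R x = ρ at *
  linear_combination (a * e + 1 / 2 * (U 0 x * U 0 x + U 1 x * U 1 x + U 2 x * U 2 x)
    - κ * (dx T 0 (dx T 0 R) x + dx T 1 (dx T 1 R) x + dx T 2 (dx T 2 R) x)) * hm +
    U 0 x * hm0 + U 1 x * hm1 + U 2 x * hm2

/-- The momentum equation contracted with ∇log ρ. The first term of the flux carries ∂ₜlog ρ +
u·∇log ρ + div u, which is zero by the mass equation; keeping it there makes its gradient part of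
the divergence, so the mass equation is needed only at the point itself and never has to be
differentiated. -/
theorem bd_identity (h : Flow γ ν a κ β T τ R U) {x : ℝ × E3} (hx : x ∈ Ioc 0 τ ×ˢ slab) :
    dt T (bdDens ν T R U) x + a * (R x ^ (γ - 2) * ∑ i, dx T i R x ^ 2)
      + κ * ∑ i, ∑ j, dx T i (dx T j R) x ^ 2 + β * ∑ i, rot U i x * dx T i R x
      - R x * ∑ i, ∑ j, dx T j (U i) x * dx T i (U j) x =
      ∑ j, dx T j (bdFlux ν κ T R U j) x := by
  have hm := h.mass x hx
  have hmom := h.momentum x hx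
  replace hx := h.mem hx
  have hu := uniqueDiffOn_spaceTime h.hT x hx
  have hR := fun v => h.admR.hasDD v hx
  have hU := fun i v => (h.velocity i).hasDD v hx
  have hdU := fun i w v => ((h.velocity i).dd w).hasDD v hx
  have hdR := fun w v => (h.adm_ddR w).hasDD v hx
  have hdN := fun w v => (h.adm_dd_log w).hasDD v hx
  have hd2R := fun w z v => ((h.adm_ddR w).dd z).hasDD v hx
  have hQ := fun j : Fin 3 => ((((((((hdR (0, EuclideanSpace.single j 1)
    (0, EuclideanSpace.single j 1)).mul ((hdN (1, 0) _).add
      (HasDD.sum (s := Finset.univ) hx hu fun k : Fin 3 =>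
        ((hU k _).mul (hdN (0, EuclideanSpace.single k 1) _)).add
          (hdU k (0, EuclideanSpace.single k 1) _)))).const_mul ν).sub
    ((((hR _).mul (hU j _)).mul (HasDD.sum (s := Finset.univ) hx hu fun i : Fin 3 =>
      (hdN (0, EuclideanSpace.single i 1) _).mul
        (hdN (0, EuclideanSpace.single i 1) _))).const_mul (ν / 2))).add
    ((HasDD.sum (s := Finset.univ) hx hu fun i : Fin 3 =>
      (hdR (0, EuclideanSpace.single i 1) _).mul
      ((hdU i (0, EuclideanSpace.single j 1) _).sub
        (hdU j (0, EuclideanSpace.single i 1) _))).const_mul (ν / 2))).add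
    ((HasDD.sum (s := Finset.univ) hx hu fun i : Fin 3 =>
      (hdR (0, EuclideanSpace.single i 1) _).mul
      (hd2R (0, EuclideanSpace.single j 1) (0, EuclideanSpace.single i 1) _)).const_mul κ)).sub
    ((hR _).mul (HasDD.sum (s := Finset.univ) hx hu fun i : Fin 3 =>
      (hU i _).mul (hdU j (0, EuclideanSpace.single i 1) _)))).add
    ((hU j _).mul (hdR (1, 0) _))).add
    (((hR _).mul (hU j _)).mul (HasDD.sum (s := Finset.univ) hx hu fun k : Fin 3 =>
      hdU k (0, EuclideanSpace.single k 1) _))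
  have hE := (((hR (1, 0)).mul (HasDD.sum (s := Finset.univ) hx hu fun i : Fin 3 =>
      (hdN (0, EuclideanSpace.single i 1) _).mul
        (hdN (0, EuclideanSpace.single i 1) _))).const_mul (ν / 2)).add
    (HasDD.sum (s := Finset.univ) hx hu fun i : Fin 3 =>
      (hU i _).mul (hdR (0, EuclideanSpace.single i 1) _))
  refine Eq.trans ?_ (Finset.sum_congr rfl fun j _ => (hQ j).eq).symm
  rw [show dt T (bdDens ν T R U) x = _ from hE.eq]
  have hc := fun i => h.admR.dd_comm (1, 0) (0, EuclideanSpace.single i 1) hx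
  have hcN := fun i => h.adm_log.dd_comm (1, 0) (0, EuclideanSpace.single i 1) hx
  have hc2 : ∀ {F : ℝ × E3 → ℝ}, Adm T τ ⊤ F →
      (dx T 1 (dx T 0 F) x = dx T 0 (dx T 1 F) x ∧ dx T 2 (dx T 0 F) x = dx T 0 (dx T 2 F) x ∧
        dx T 2 (dx T 1 F) x = dx T 1 (dx T 2 F) x) := fun hF =>
    ⟨hF.dd_comm _ _ hx, hF.dd_comm _ _ hx, hF.dd_comm _ _ hx⟩
  have hc3 := fun j : Fin 3 => hc2 (h.admR.dd (0, EuclideanSpace.single j 1))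
  obtain ⟨b1, b2, b3⟩ := hc3 0
  obtain ⟨c1, c2, c3⟩ := hc3 1
  obtain ⟨d1, d2, d3⟩ := hc3 2
  obtain ⟨r1, r2, r3⟩ := hc2 h.admR
  obtain ⟨n1, n2, n3⟩ := hc2 h.adm_log
  obtain ⟨u1, u2, u3⟩ := hc2 (h.velocity 0).top
  obtain ⟨v1, v2, v3⟩ := hc2 (h.velocity 1).top
  obtain ⟨w1, w2, w3⟩ := hc2 (h.velocity 2).top
  -- Writing first derivatives of ρ as ρ∂log ρ avoids all quotients.
  have hl := fun v => h.dd_eq_mul_log v hx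
  have hm0 := hmom 0
  have hm1 := hmom 1
  have hm2 := hmom 2
  have hR0 := (h.pos x hx).ne'
  clear hQ hE hmom
  simp only [Fin.sum_univ_three, strn, dx, dt, rot, Matrix.cons_val_zero, Matrix.cons_val_one,
    Matrix.cons_val, hc, hcN, hl] at hm hm0 hm1 hm2 ⊢
  -- Mixed derivatives are put in normal form. For third derivatives of ρ the repeated index goes
  -- innermost, as in ∇Δρ; hence the mixed directions of rewriting.
  simp only [r1, r2, r3, n1, n2, n3, u1, u2, v1, v3, w2, w3, ← b1, ← b2, c1, ← c3, d2,
    d3] at hm hm0 hm1 hm2 ⊢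
  generalize R x ^ (γ - 2) = s at *
  generalize R x = ρ at *
  generalize hN : (fun y => Real.log (R y)) = N at *
  have hmN : dd T (1, 0) N x + (dx T 0 N x * U 0 x + dx T 0 (U 0) x + (dx T 1 N x * U 1 x +
      dx T 1 (U 1) x) + (dx T 2 N x * U 2 x + dx T 2 (U 2) x)) = 0 := by
    refine (mul_eq_zero_iff_left hR0).1 ?_
    rw [← hm]
    simp only [dx]
    ring
  -- The multiplier -νΔρ of the mass equation divided by ρ cancels what the product rule leaves from
  -- the first flux term.
  linear_combination (ν / 2 * (dx T 0 N x ^ 2 + dx T 1 N x ^ 2 + dx T 2 N x ^ 2)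
    - (dx T 0 (U 0) x + dx T 1 (U 1) x + dx T 2 (U 2) x)) * hm
    - ν * (dx T 0 (dx T 0 R) x + dx T 1 (dx T 1 R) x + dx T 2 (dx T 2 R) x) * hmN +
    dx T 0 N x * hm0 + dx T 1 N x * hm1 + dx T 2 N x * hm2

end Flow
end NSK
end

/-! ### Integrated balance laws and the bound by the Hessian. -/

noncomputable section

namespace NSK

variable {T : EReal} {τ : ℝ} {p q r : ℝ≥0∞} {F G : ℝ × E3 → ℝ}

theorem UnifBdd.mono {s : ℝ} (hs : s ≤ τ) (hF : UnifBdd τ p F) : UnifBdd s p F := by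
  obtain ⟨M, hM⟩ := hF
  exact ⟨M, fun t ht => hM t ⟨ht.1, ht.2.trans hs⟩⟩

theorem BddDerivs.mono {s : ℝ} (hs : s ≤ τ) : ∀ {n : ℕ} {F : ℝ × E3 → ℝ},
    BddDerivs T τ p n F → BddDerivs T s p n F
  | 0, _, h => UnifBdd.mono hs h
  | _ + 1, _, h => ⟨h.1.mono hs, fun v => (h.2 v).mono hs⟩

theorem Adm.mono {s : ℝ} (h0 : 0 ≤ s) (hs : s ≤ τ) (hF : Adm T τ p F) : Adm T s p F :=
  ⟨h0, lt_of_le_of_lt (EReal.coe_le_coe_iff.2 hs) hF.lt, hF.smooth, fun n => (hF.bdd n).mono hs⟩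

/-- The integrated form of a conservation law with source. -/
theorem integral_balance {e g : ℝ × E3 → ℝ} {Q : Fin 3 → ℝ × E3 → ℝ} (he : Adm T τ 1 e)
    (hQ : ∀ j, Adm T τ 1 (Q j))
    (hb : ∀ t ∈ Ioc 0 τ, ∀ x : E3, (x 2 = 0 ∨ x 2 = 1) → Q 2 (t, x) = 0)
    (hg : Adm T τ 1 g)
    (h : ∀ x ∈ Ioc 0 τ ×ˢ slab, dt T e x + g x = ∑ j, dx T j (Q j) x) :
    (∫ x in slab, e (τ, x)) + ∫ t in Ioc 0 τ, ∫ x in slab, g (t, x) = ∫ x in slab, e (0, x) := by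
  have h1 : ∫ t in Ioc 0 τ, ∫ x in slab, dt T e (t, x) =
      ∫ t in Ioc 0 τ, -∫ x in slab, g (t, x) := by
    refine setIntegral_congr_fun measurableSet_Ioc fun t ht => ?_
    have ht' := Ioc_subset_Icc_self ht
    have h2 : ∫ x in slab, (dt T e (t, x) + g (t, x)) = 0 := by
      rw [← integral_div_eq_zero hQ ht' (hb t ht)]
      exact setIntegral_congr_fun measurableSet_slab fun x hx => h (t, x) ⟨ht, hx⟩
    rw [integral_add ((he.dd _).integrable_slice ht') (hg.integrable_slice ht')] at h2
    exact eq_neg_of_add_eq_zero_left h2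
  rw [he.integral_dt, integral_neg] at h1
  linarith

/-- Meant for v = ∇log ρ and H = ∇²ρ, where the subtracted bracket is the divergence of ρ|v|²∇ρ.
With w = ρ|v|², Young's inequality gives 2w tr H ≤ w²/2 + 6|H|² and 4ρ v·Hv ≤ w²/2 + 8|H|²; hence
14. -/
theorem hessian_bound (ρ : ℝ) (v : Fin 3 → ℝ) (H : Fin 3 → Fin 3 → ℝ) :
    ρ ^ 2 * (∑ i, v i ^ 2) ^ 2 ≤ 14 * (∑ i, ∑ j, H i j ^ 2) -
      2 * (ρ * ((∑ i, H i i) * ∑ i, v i ^ 2) + (∑ i, ∑ j, 2 * (ρ * v i * v j) * H j i) -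
        ρ ^ 2 * (∑ i, v i ^ 2) ^ 2) := by
  simp only [Fin.sum_univ_three]
  nlinarith [sq_nonneg (ρ * (v 0 ^ 2 + v 1 ^ 2 + v 2 ^ 2) - 2 * (H 0 0 + H 1 1 + H 2 2)),
    sq_nonneg (ρ * v 0 * v 0 - 4 * H 0 0), sq_nonneg (ρ * v 0 * v 1 - 4 * H 1 0),
    sq_nonneg (ρ * v 0 * v 2 - 4 * H 2 0), sq_nonneg (ρ * v 1 * v 0 - 4 * H 0 1),
    sq_nonneg (ρ * v 1 * v 1 - 4 * H 1 1), sq_nonneg (ρ * v 1 * v 2 - 4 * H 2 1),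
    sq_nonneg (ρ * v 2 * v 0 - 4 * H 0 2), sq_nonneg (ρ * v 2 * v 1 - 4 * H 1 2),
    sq_nonneg (ρ * v 2 * v 2 - 4 * H 2 2), sq_nonneg (H 0 0 - H 1 1), sq_nonneg (H 0 0 - H 2 2),
    sq_nonneg (H 1 1 - H 2 2), sq_nonneg (H 0 1), sq_nonneg (H 0 2), sq_nonneg (H 1 2),
    sq_nonneg (H 1 0), sq_nonneg (H 2 0), sq_nonneg (H 2 1)]

namespace Flow

variable {γ ν a κ β : ℝ} {R : ℝ × E3 → ℝ} {U : Fin 3 → ℝ × E3 → ℝ}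

theorem mono {s : ℝ} (h0 : 0 ≤ s) (hs : s ≤ τ) (h : Flow γ ν a κ β T τ R U) :
    Flow γ ν a κ β T s R U where
  density := h.density.mono h0 hs
  velocity i := (h.velocity i).mono h0 hs
  pos := h.pos
  lower := by
    obtain ⟨c, hc, hl⟩ := h.lower
    exact ⟨c, hc, fun t ht => hl t ⟨ht.1, ht.2.trans hs⟩⟩
  mass x hx := h.mass x ⟨⟨hx.1.1, hx.1.2.trans hs⟩, hx.2⟩
  momentum x hx := h.momentum x ⟨⟨hx.1.1, hx.1.2.trans hs⟩, hx.2⟩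
  boundary t ht := h.boundary t ⟨ht.1, ht.2.trans hs⟩

theorem adm_sum (h : Flow γ ν a κ β T τ R U) {F : Fin 3 → ℝ × E3 → ℝ}
    (hF : ∀ i, Adm T τ p (F i)) (hp : 1 ≤ p := by norm_num) :
    Adm T τ p (fun x => ∑ i, F i x) :=
  Adm.sum Finset.univ h.nonneg h.lt hF hp

theorem adm_energyDens (h : Flow γ ν a κ β T τ R U) (hγ : 1 < γ) (hγ2 : γ ≤ 2) :
    Adm T τ 1 (energyDens γ a κ T R U) :=
  (((h.adm_internalEnergy hγ hγ2).const_mul a).add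
    ((h.admR.bdd_mul (h.adm_sum fun i => (h.velocity i).mul_two (h.velocity i))).const_mul _)).add
    ((h.adm_sum fun _ => (h.adm_ddR _).mul_two (h.adm_ddR _)).const_mul _)

theorem adm_energyFlux (h : Flow γ ν a κ β T τ R U) (hγ : 1 < γ) (j : Fin 3) :
    Adm T τ 1 (energyFlux γ ν a κ T R U j) := by
  have hRU : Adm T τ 2 (fun x => R x * U j x) := h.admR.bdd_mul (h.velocity j)
  refine Adm.sub (Adm.sub (Adm.add (Adm.add (Adm.const_mul ?_ _) (Adm.const_mul ?_ _))
    (Adm.const_mul ?_ _)) (Adm.const_mul ?_ _)) (Adm.const_mul ?_ _)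
  · exact hRU.mul_two (h.adm_sum fun _ => (h.adm_ddR _).dd _)
  · exact (h.adm_ddR _).mul_two (h.adm_ddR _)
  · exact h.adm_sum fun i => (h.velocity i).mul_two (h.admR.bdd_mul (h.adm_strn i j))
  · exact hRU.mul_two (h.adm_enthalpy hγ)
  · exact hRU.bdd_mul (h.adm_sum fun i => (h.velocity i).mul_two (h.velocity i))

theorem adm_dissipation (h : Flow γ ν a κ β T τ R U) :
    Adm T τ 1 (fun x => R x * ∑ i, ∑ j, strn T U i j x ^ 2) :=
  h.admR.bdd_mul (h.adm_sum fun i => h.adm_sum fun j =>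
    ((h.adm_strn i j).mul_two (h.adm_strn i j)).congr fun _ _ => (sq _).symm)

/-- The conditions u·n = 0 and ∇ρ·n = 0 may be differentiated along the boundary; the cross terms of
the normal fluxes need this. -/
theorem boundary_tangential (h : Flow γ ν a κ β T τ R U) {t : ℝ} (ht : t ∈ Ioc 0 τ) {x : E3}
    (hx : x 2 = 0 ∨ x 2 = 1) : dx T 0 (U 2) (t, x) = 0 ∧ dx T 1 (U 2) (t, x) = 0 ∧
      dx T 0 (dx T 2 R) (t, x) = 0 ∧ dx T 1 (dx T 2 R) (t, x) = 0 := by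
  have hτ : (t : EReal) < T := lt_of_le_of_lt (EReal.coe_le_coe_iff.2 ht.2) h.lt
  have key : ∀ {F : ℝ × E3 → ℝ}, DifferentiableOn ℝ F (spaceTime T) →
      (∀ x : E3, (x 2 = 0 ∨ x 2 = 1) → F (t, x) = 0) → ∀ {i : Fin 3}, i ≠ 2 →
      dx T i F (t, x) = 0 := fun hF hb _ hi => dx_eq_zero_of_boundary hF ht.1.le hτ hb hi hx
  have hu : ∀ x : E3, (x 2 = 0 ∨ x 2 = 1) → U 2 (t, x) = 0 := fun x hx => (h.boundary t ht x hx).1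
  have hr : ∀ x : E3, (x 2 = 0 ∨ x 2 = 1) → dx T 2 R (t, x) = 0 := fun x hx =>
    (h.boundary t ht x hx).2.1
  exact ⟨key (h.velocity 2).differentiableOn hu (by decide),
    key (h.velocity 2).differentiableOn hu (by decide),
    key (h.adm_ddR _).differentiableOn hr (by decide),
    key (h.adm_ddR _).differentiableOn hr (by decide)⟩

theorem energy_balance (h : Flow γ ν a κ β T τ R U) (hγ : 1 < γ) (hγ2 : γ ≤ 2) :
    (∫ x in slab, energyDens γ a κ T R U (τ, x)) +
      ν * ∫ t in Ioc 0 τ, ∫ x in slab, R (t, x) * ∑ i, ∑ j, strn T U i j (t, x) ^ 2 =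
      ∫ x in slab, energyDens γ a κ T R U (0, x) := by
  rw [← integral_balance (h.adm_energyDens hγ hγ2) (h.adm_energyFlux hγ) ?_
    (h.adm_dissipation.const_mul ν) fun x hx => h.energy_identity hγ hx]
  · simp only [integral_const_mul]
  · intro t ht x hx
    obtain ⟨h1, h2, h3, h4⟩ := h.boundary t ht x hx
    obtain ⟨h5, h6, -, -⟩ := h.boundary_tangential ht hx
    -- Each term of the normal flux contains the normal velocity, the normal derivative of ρ, or a
    -- tangential component of (Du)n.
    simp only [energyFlux, strn, Fin.sum_univ_three, h1, h2, h3, h4, h5, h6]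
    ring

theorem adm_bdDens (h : Flow γ ν a κ β T τ R U) : Adm T τ 1 (bdDens ν T R U) :=
  ((h.admR.bdd_mul (h.adm_sum fun _ => (h.adm_dd_log _).mul_two (h.adm_dd_log _))).const_mul _).add
    (h.adm_sum fun i => (h.velocity i).mul_two (h.adm_ddR _))

theorem adm_bdFlux (h : Flow γ ν a κ β T τ R U) (j : Fin 3) :
    Adm T τ 1 (bdFlux ν κ T R U j) := by
  have hRU : Adm T τ 2 (fun x => R x * U j x) := h.admR.bdd_mul (h.velocity j)
  refine Adm.add (Adm.add (Adm.sub (Adm.add (Adm.add (Adm.sub (Adm.const_mul ?_ _)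
    (Adm.const_mul ?_ _)) (Adm.const_mul ?_ _)) (Adm.const_mul ?_ _)) ?_) ?_) ?_
  · exact (h.adm_ddR _).mul_two ((h.adm_dd_log _).add (h.adm_sum fun k =>
      ((h.velocity k).mul_bdd (h.adm_dd_log _)).add ((h.velocity k).dd _)))
  · exact hRU.bdd_mul (h.adm_sum fun _ => (h.adm_dd_log _).mul_two (h.adm_dd_log _))
  · exact h.adm_sum fun i => (h.adm_ddR _).mul_two (((h.velocity i).dd _).sub
      ((h.velocity j).dd _))
  · exact h.adm_sum fun _ => (h.adm_ddR _).mul_two ((h.adm_ddR _).dd _)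
  · exact h.admR.bdd_mul (h.adm_sum fun i => (h.velocity i).mul_two ((h.velocity j).dd _))
  · exact (h.velocity j).mul_two (h.adm_ddR _)
  · exact hRU.mul_two (h.adm_sum fun k => (h.velocity k).dd _)

theorem adm_pressure (h : Flow γ ν a κ β T τ R U) (s : ℝ) :
    Adm T τ 1 (fun x => R x ^ s * ∑ i, dx T i R x ^ 2) :=
  (h.adm_rpow s).bdd_mul (h.adm_sum fun _ =>
    ((h.adm_ddR _).mul_two (h.adm_ddR _)).congr fun _ _ => (sq _).symm)

theorem adm_hess (h : Flow γ ν a κ β T τ R U) :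
    Adm T τ 1 (fun x => ∑ i, ∑ j, dx T i (dx T j R) x ^ 2) :=
  h.adm_sum fun _ => h.adm_sum fun _ =>
    (((h.adm_ddR _).dd _).mul_two ((h.adm_ddR _).dd _)).congr fun _ _ => (sq _).symm

theorem adm_rot (h : Flow γ ν a κ β T τ R U) (i : Fin 3) : Adm T τ 2 (rot U i) := by
  fin_cases i
  · exact ((h.velocity 1).const_mul (-1)).congr fun x _ => by simp [rot]
  · exact (h.velocity 0).congr fun x _ => by simp [rot]
  · exact ((h.velocity 0).const_mul 0).congr fun x _ => by simp [rot]

theorem adm_coriolis (h : Flow γ ν a κ β T τ R U) :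
    Adm T τ 1 (fun x => ∑ i, rot U i x * dx T i R x) :=
  h.adm_sum fun i => (h.adm_rot i).mul_two (h.adm_ddR _)

theorem adm_transport (h : Flow γ ν a κ β T τ R U) :
    Adm T τ 1 (fun x => R x * ∑ i, ∑ j, dx T j (U i) x * dx T i (U j) x) :=
  h.admR.bdd_mul (h.adm_sum fun i => h.adm_sum fun j =>
    ((h.velocity i).dd _).mul_two ((h.velocity j).dd _))

theorem bd_balance (h : Flow γ ν a κ β T τ R U) :
    (∫ x in slab, bdDens ν T R U (τ, x)) +
      ∫ t in Ioc 0 τ, (a * (∫ x in slab, R (t, x) ^ (γ - 2) * ∑ i, dx T i R (t, x) ^ 2)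
        + κ * (∫ x in slab, ∑ i, ∑ j, dx T i (dx T j R) (t, x) ^ 2)
        + β * (∫ x in slab, ∑ i, rot U i (t, x) * dx T i R (t, x))
        - ∫ x in slab, R (t, x) * ∑ i, ∑ j, dx T j (U i) (t, x) * dx T i (U j) (t, x)) =
      ∫ x in slab, bdDens ν T R U (0, x) := by
  rw [← integral_balance h.adm_bdDens h.adm_bdFlux ?_
    (((((h.adm_pressure (γ - 2)).const_mul a).add (h.adm_hess.const_mul κ)).add
      (h.adm_coriolis.const_mul β)).sub h.adm_transport) fun x hx => ?_]
  · congr 1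
    refine setIntegral_congr_fun measurableSet_Ioc fun t ht => ?_
    have ht' := Ioc_subset_Icc_self ht
    have i1 := ((h.adm_pressure (γ - 2)).const_mul a).integrable_slice ht'
    have i2 := (h.adm_hess.const_mul κ).integrable_slice ht'
    have i3 := (h.adm_coriolis.const_mul β).integrable_slice ht'
    have i4 := h.adm_transport.integrable_slice ht'
    have i12 : IntegrableOn (fun x => a * (R (t, x) ^ (γ - 2) * ∑ i, dx T i R (t, x) ^ 2) +
      κ * ∑ i, ∑ j, dx T i (dx T j R) (t, x) ^ 2) slab := i1.add i2
    have i123 : IntegrableOn (fun x => a * (R (t, x) ^ (γ - 2) * ∑ i, dx T i R (t, x) ^ 2) +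
      κ * (∑ i, ∑ j, dx T i (dx T j R) (t, x) ^ 2) +
      β * ∑ i, rot U i (t, x) * dx T i R (t, x)) slab := i12.add i3
    rw [integral_sub i123 i4, integral_add i12 i3, integral_add i1 i2]
    simp only [integral_const_mul]
  · intro t ht x hx
    obtain ⟨h1, h2, h3, h4⟩ := h.boundary t ht x hx
    obtain ⟨h5, h6, h7, h8⟩ := h.boundary_tangential ht hx
    simp only [bdFlux, Fin.sum_univ_three, h1, h2, h3, h4, h5, h6, h7, h8]
    ring
  · rw [← h.bd_identity hx]
    ring

/-- The integral of `|∇ρ|⁴ / ρ²` is controlled by the Hessian. -/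
theorem integral_log_pow_four_le (h : Flow γ ν a κ β T τ R U) {t : ℝ} (ht : t ∈ Ioc 0 τ) :
    ∫ x in slab, R (t, x) ^ 2 * (∑ i, dx T i (fun y => Real.log (R y)) (t, x) ^ 2) ^ 2 ≤
      14 * ∫ x in slab, ∑ i, ∑ j, dx T i (dx T j R) (t, x) ^ 2 := by
  have ht' := Ioc_subset_Icc_self ht
  have hv2 : Adm T τ 1 (fun x => ∑ i, dx T i (fun y => Real.log (R y)) x ^ 2) :=
    h.adm_sum fun _ => ((h.adm_dd_log _).mul_two (h.adm_dd_log _)).congr fun _ _ => (sq _).symm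
  have hW : Adm T τ 1 (fun x => R x ^ 2 * (∑ i, dx T i (fun y => Real.log (R y)) x ^ 2) ^ 2) :=
    ((h.admR.mul_bdd h.admR le_top).bdd_mul (hv2.mul_bdd hv2)).congr fun x _ => by ring
  have hG : ∀ j, Adm T τ 1 (fun x => dx T j R x *
      (R x * ∑ i, dx T i (fun y => Real.log (R y)) x ^ 2)) := fun j =>
    (h.adm_ddR _).bdd_mul (h.admR.bdd_mul hv2)
  have hdiv := integral_div_eq_zero hG ht' fun x hx => by
    rw [(h.boundary t ht x hx).2.1, zero_mul]
  have hpt : ∀ x ∈ slab, R (t, x) ^ 2 *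
      (∑ i, dx T i (fun y => Real.log (R y)) (t, x) ^ 2) ^ 2 ≤
      14 * (∑ i, ∑ j, dx T i (dx T j R) (t, x) ^ 2) - 2 * ∑ j, dx T j (fun x => dx T j R x *
      (R x * ∑ i, dx T i (fun y => Real.log (R y)) x ^ 2)) (t, x) := by
    intro x hx
    have hm := mem_spaceTime h.lt ht' (slab_subset hx)
    generalize (t, x) = z at hm ⊢
    have hu := uniqueDiffOn_spaceTime h.hT z hm
    have hQ := fun j : Fin 3 => (((h.adm_ddR (0, EuclideanSpace.single j 1)).hasDD
      (0, EuclideanSpace.single j 1) hm).mul ((h.admR.hasDD _ hm).mul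
        (HasDD.sum (s := Finset.univ) hm hu fun i : Fin 3 =>
          ((h.adm_dd_log (0, EuclideanSpace.single i 1)).hasDD _ hm).mul
            ((h.adm_dd_log (0, EuclideanSpace.single i 1)).hasDD _ hm)))).congr
        (G := fun x => dx T j R x * (R x * ∑ i, dx T i (fun y => Real.log (R y)) x ^ 2))
        fun y _ => by simp only [sq]
    have hl := fun v => h.dd_eq_mul_log v hm
    have hl2 : ∀ v w, dd T v (dd T w R) z = dd T v R z * dd T w (fun y => Real.log (R y)) z +
        R z * dd T v (dd T w fun y => Real.log (R y)) z := fun v w => by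
      rw [dd_congr (fun y hy => h.dd_eq_mul_log w hy) v hm,
        ((h.admR.hasDD v hm).mul ((h.adm_dd_log w).hasDD v hm)).eq]
    have hsum := Finset.sum_congr rfl (s₁ := Finset.univ) fun j _ => (hQ j).eq
    have key : ∑ j, dx T j (fun x => dx T j R x *
        (R x * ∑ i, dx T i (fun y => Real.log (R y)) x ^ 2)) z =
        R z * ((∑ i, dx T i (dx T i R) z) * ∑ i, dx T i (fun y => Real.log (R y)) z ^ 2) +
        (∑ i, ∑ j, 2 * (R z * dx T i (fun y => Real.log (R y)) z *
          dx T j (fun y => Real.log (R y)) z) * dx T j (dx T i R) z) -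
        R z ^ 2 * (∑ i, dx T i (fun y => Real.log (R y)) z ^ 2) ^ 2 := by
      refine hsum.trans ?_
      clear hsum hQ
      simp only [Fin.sum_univ_three, dx, hl2, hl]
      ring
    rw [key]
    exact hessian_bound (R z) (fun i => dx T i (fun y => Real.log (R y)) z)
      fun i j => dx T i (dx T j R) z
  calc _ ≤ ∫ x in slab, (14 * (∑ i, ∑ j, dx T i (dx T j R) (t, x) ^ 2) - 2 * ∑ j, dx T j
      (fun x => dx T j R x * (R x * ∑ i, dx T i (fun y => Real.log (R y)) x ^ 2)) (t, x)) :=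
        setIntegral_mono_on (hW.integrable_slice ht')
          ((h.adm_hess.integrable_slice ht').const_mul 14 |>.sub
            (((h.adm_sum fun j => (hG j).dd _).integrable_slice ht').const_mul 2))
          measurableSet_slab hpt
    _ = _ := by
      rw [integral_sub ((h.adm_hess.integrable_slice ht').const_mul 14)
        (((h.adm_sum fun j => (hG j).dd _).integrable_slice ht').const_mul 2),
        integral_const_mul, integral_const_mul, hdiv]
      ring

end Flow
end NSK
end

/-! ### The Coriolis term. -/

noncomputable section

namespace NSK

variable {T : EReal} {τ : ℝ} {p q r : ℝ≥0∞} {F G : ℝ × E3 → ℝ}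

/-- The trace of V² is the squared norm of the symmetric part minus that of the antisymmetric part.
It lets the viscous dissipation control the transport term. -/
theorem sum_mul_swap_le_sum_sq (V : Fin 3 → Fin 3 → ℝ) :
    ∑ i, ∑ j, V i j * V j i ≤ ∑ i, ∑ j, ((V i j + V j i) / 2) ^ 2 := by
  have h1 : ∑ i, ∑ j, V i j * V j i + ∑ i, ∑ j, ((V i j - V j i) / 2) ^ 2 =
      ∑ i, ∑ j, ((V i j + V j i) / 2) ^ 2 := by
    simp only [← Finset.sum_add_distrib]
    exact Finset.sum_congr rfl fun i _ => Finset.sum_congr rfl fun j _ => by ring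
  have h2 : 0 ≤ ∑ i, ∑ j, ((V i j - V j i) / 2) ^ 2 :=
    Finset.sum_nonneg fun i _ => Finset.sum_nonneg fun j _ => sq_nonneg _
  linarith

theorem half_le_rpow {z s : ℝ} (hz : 1 / 2 ≤ z) (hs : 0 ≤ s) (hs1 : s ≤ 1) : 1 / 2 ≤ z ^ s :=
  calc (1 / 2 : ℝ) = (1 / 2) ^ (1 : ℝ) := by simp
    _ ≤ (1 / 2) ^ s := Real.rpow_le_rpow_of_exponent_ge (by norm_num) (by norm_num) hs1
    _ ≤ z ^ s := Real.rpow_le_rpow (by norm_num) hz hs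

namespace Flow

variable {γ ν a κ β : ℝ} {R : ℝ × E3 → ℝ} {U : Fin 3 → ℝ × E3 → ℝ}

/-- The squared modulus of the logarithmic gradient of the density. -/
def logSq (T : EReal) (R : ℝ × E3 → ℝ) (x : ℝ × E3) : ℝ :=
  ∑ i, dx T i (fun y => Real.log (R y)) x ^ 2

/-- Twice the density of kinetic energy. -/
def kin (R : ℝ × E3 → ℝ) (U : Fin 3 → ℝ × E3 → ℝ) (x : ℝ × E3) : ℝ := R x * ∑ i, U i x ^ 2

theorem adm_kin (h : Flow γ ν a κ β T τ R U) : Adm T τ 1 (kin R U) :=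
  h.admR.bdd_mul (h.adm_sum fun i =>
    ((h.velocity i).mul_two (h.velocity i)).congr fun _ _ => (sq _).symm)

theorem adm_logSq (h : Flow γ ν a κ β T τ R U) : Adm T τ 1 (logSq T R) :=
  h.adm_sum fun _ => ((h.adm_dd_log _).mul_two (h.adm_dd_log _)).congr fun _ _ => (sq _).symm

theorem adm_gradSq (h : Flow γ ν a κ β T τ R U) : Adm T τ 1 (fun x => ∑ i, dx T i R x ^ 2) :=
  h.adm_sum fun _ => ((h.adm_ddR _).mul_two (h.adm_ddR _)).congr fun _ _ => (sq _).symm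

theorem logSq_nonneg (x : ℝ × E3) : 0 ≤ logSq T R x := Finset.sum_nonneg fun _ _ => sq_nonneg _

theorem kin_nonneg {x : ℝ × E3} (hx : 0 ≤ R x) : 0 ≤ kin R U x :=
  mul_nonneg hx (Finset.sum_nonneg fun _ _ => sq_nonneg _)

theorem gradSq_eq (h : Flow γ ν a κ β T τ R U) {x : ℝ × E3} (hx : x ∈ spaceTime T) :
    ∑ i, dx T i R x ^ 2 = R x ^ 2 * logSq T R x := by
  rw [logSq, Finset.mul_sum]
  exact Finset.sum_congr rfl fun i _ => by rw [dx, h.dd_eq_mul_log _ hx]; ring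

theorem sum_sq_le (b c : Fin 3 → ℝ) : (∑ i, b i * c i) ^ 2 ≤ (∑ i, b i ^ 2) * ∑ i, c i ^ 2 :=
  Finset.sum_mul_sq_le_sq_mul_sq _ _ _

/-- Pointwise bound of products of velocity and density gradient. -/
theorem abs_sum_mul_grad_le (h : Flow γ ν a κ β T τ R U) {x : ℝ × E3} (hx : x ∈ spaceTime T)
    {b : Fin 3 → ℝ} (hb : ∑ i, b i ^ 2 ≤ ∑ i, U i x ^ 2) :
    |∑ i, b i * dx T i R x| ≤ Real.sqrt (kin R U x) * Real.sqrt (R x * logSq T R x) := by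
  have hR := (h.pos x hx).le
  rw [← Real.sqrt_mul (kin_nonneg hR)]
  refine Real.abs_le_sqrt ((sum_sq_le _ _).trans ?_)
  rw [h.gradSq_eq hx, kin]
  have := mul_le_mul_of_nonneg_right hb
    (mul_nonneg (sq_nonneg (R x)) (logSq_nonneg (T := T) (R := R) x))
  nlinarith

theorem sum_rot_sq_le (x : ℝ × E3) : ∑ i, rot U i x ^ 2 ≤ ∑ i, U i x ^ 2 := by
  simp only [rot, Fin.sum_univ_three, Matrix.cons_val_zero, Matrix.cons_val_one, Matrix.cons_val]
  nlinarith [sq_nonneg (U 2 x)]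

theorem continuousOn_slab (h : Flow γ ν a κ β T τ R U) {F : ℝ × E3 → ℝ}
    (hF : Adm T τ p F) {t : ℝ} (ht : t ∈ Icc 0 τ) : ContinuousOn (fun x => F (t, x)) slab :=
  (continuousOn_slice h.lt hF.continuousOn ht).mono slab_subset

theorem energyDens_parts (h : Flow γ ν a κ β T τ R U) (hγ : 1 < γ) (ha : 0 ≤ a)
    (hκ : 0 ≤ κ) {x : ℝ × E3} (hx : x ∈ spaceTime T) :
    a * internalEnergy γ (R x) + 1 / 2 * kin R U x ≤ energyDens γ a κ T R U x ∧
      0 ≤ a * internalEnergy γ (R x) := by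
  have h1 : 0 ≤ κ / 2 * ∑ i, dx T i R x * dx T i R x :=
    mul_nonneg (by positivity) (Finset.sum_nonneg fun _ _ => mul_self_nonneg _)
  simp only [energyDens, kin, sq] at *
  exact ⟨by linarith, mul_nonneg ha (internalEnergy_nonneg hγ (h.pos x hx))⟩

theorem integral_kin_le (h : Flow γ ν a κ β T τ R U) (hγ : 1 < γ) (hγ2 : γ ≤ 2) (ha : 0 ≤ a)
    (hκ : 0 ≤ κ) {t : ℝ} (ht : t ∈ Icc 0 τ) :
    ∫ x in slab, kin R U (t, x) ≤ 2 * ∫ x in slab, energyDens γ a κ T R U (t, x) := by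
  rw [← integral_const_mul]
  refine setIntegral_mono_on (h.adm_kin.integrable_slice ht)
    (((h.adm_energyDens hγ hγ2).integrable_slice ht).const_mul 2) measurableSet_slab
    fun x hx => ?_
  have := h.energyDens_parts hγ ha hκ (mem_spaceTime h.lt ht (slab_subset hx))
  linarith [this.1, this.2]

theorem volume_low_density_le (h : Flow γ ν a κ β T τ R U) (hγ : 1 < γ) (hγ2 : γ ≤ 2)
    {K : ℝ} (ha : 0 < a) (haK : 256 * K ≤ a) (hκ : 0 ≤ κ) {t : ℝ}
    (ht : t ∈ Icc 0 τ) (hE : ∫ x in slab, energyDens γ a κ T R U (t, x) ≤ K) :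
    volume (slab ∩ {x | R (t, x) < 3 / 4}) ≤ ENNReal.ofReal (1 / 8) := by
  have hi := (h.adm_internalEnergy hγ hγ2).integrable_slice ht
  have hp : ∀ x ∈ slab, 0 < R (t, x) := fun x hx =>
    h.pos _ (mem_spaceTime h.lt ht (slab_subset hx))
  have hE' : ∫ x in slab, internalEnergy γ (R (t, x)) ≤ K / a := by
    rw [le_div_iff₀ ha, mul_comm, ← integral_const_mul]
    refine le_trans (setIntegral_mono_on (hi.const_mul a)
      ((h.adm_energyDens hγ hγ2).integrable_slice ht) measurableSet_slab fun x hx => ?_) hE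
    have := h.energyDens_parts hγ ha.le hκ (mem_spaceTime h.lt ht (slab_subset hx))
    have h2 := kin_nonneg (U := U) (hp x hx).le
    linarith [this.1]
  -- Chebyshev at level 1/32, which h exceeds for densities below 3/4. As ∫h(ρ) ≤ K/a ≤ 1/256, the
  -- measure is at most 32/256 = 1/8.
  have hm := mul_meas_ge_le_integral_of_nonneg (μ := volume.restrict slab)
    (f := fun x => internalEnergy γ (R (t, x))) (by
      filter_upwards [ae_restrict_mem measurableSet_slab] with x hx
      exact internalEnergy_nonneg hγ (hp x hx)) hi (1 / 32)
  have hfin := Integrable.measure_ge_lt_top hi (ε := 1 / 32) (by norm_num)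
  have hsub : volume (slab ∩ {x | R (t, x) < 3 / 4}) ≤
      (volume.restrict slab) {x | 1 / 32 ≤ internalEnergy γ (R (t, x))} := by
    rw [Measure.restrict_apply' measurableSet_slab]
    refine measure_mono fun x hx => ⟨?_, hx.1⟩
    have h34 : R (t, x) < 3 / 4 := hx.2
    have := le_internalEnergy hγ hγ2 (hp x hx.1) (by linarith)
    change 1 / 32 ≤ internalEnergy γ (R (t, x))
    nlinarith
  refine hsub.trans ?_
  rw [← ENNReal.ofReal_toReal hfin.ne]
  refine ENNReal.ofReal_le_ofReal ?_
  have h3 : K / a ≤ 1 / 256 := by rw [div_le_iff₀ ha]; linarith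
  simp only [measureReal_def] at hm
  linarith

/-- The Coriolis term is controlled by the dissipation. -/
theorem coriolis_le (h : Flow γ ν a κ β T τ R U) (hγ : 1 < γ) (hγ2 : γ ≤ 2) {K : ℝ} (hK : 0 ≤ K)
    (haK : 2 ^ 44 * (1 + K) ^ 2 ≤ a) (hκ : 1 ≤ κ) (hβ : 0 ≤ β) (hβa : β ^ 2 = a) {t : ℝ}
    (ht : t ∈ Ioc 0 τ) (hE : ∫ x in slab, energyDens γ a κ T R U (t, x) ≤ K) :
    β * |∫ x in slab, ∑ i, rot U i (t, x) * dx T i R (t, x)| ≤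
      a / 2 * (∫ x in slab, R (t, x) ^ (γ - 2) * ∑ i, dx T i R (t, x) ^ 2) +
      κ / 4 * (∫ x in slab, ∑ i, ∑ j, dx T i (dx T j R) (t, x) ^ 2) + 4 * K := by
  have ht' := Ioc_subset_Icc_self ht
  have ha0 : 0 < a := lt_of_lt_of_le (by positivity) haK
  have hst : ∀ x ∈ slab, (t, x) ∈ spaceTime T := fun x hx =>
    mem_spaceTime h.lt ht' (slab_subset hx)
  have hp : ∀ x ∈ slab, 0 < R (t, x) := fun x hx => h.pos _ (hst x hx)
  set P : E3 → ℝ := fun x => kin R U (t, x) with hP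
  set L : E3 → ℝ := fun x => R (t, x) * logSq T R (t, x) with hL
  set g : E3 → ℝ := fun x => R (t, x) ^ (γ - 2) * ∑ i, dx T i R (t, x) ^ 2 with hg
  set c : E3 → ℝ := fun x => ∑ i, rot U i (t, x) * dx T i R (t, x) with hc
  set A : Set E3 := slab ∩ {x | R (t, x) < 1 / 2} with hA
  have hRc : ContinuousOn (fun x => R (t, x)) slab := h.continuousOn_slab h.admR ht'
  have hmeas : ∀ d : ℝ, MeasurableSet (slab ∩ {x | R (t, x) < d}) := fun d =>
    (hRc.isOpen_inter_preimage isOpen_slab isOpen_Iio).measurableSet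
  have hAs : A ⊆ slab := inter_subset_left
  have hadmL : Adm T τ 1 (fun x => R x * logSq T R x) := h.admR.bdd_mul h.adm_logSq
  have iP : IntegrableOn P slab := h.adm_kin.integrable_slice ht'
  have iL : IntegrableOn L slab := hadmL.integrable_slice ht'
  have ig : IntegrableOn g slab := (h.adm_pressure (γ - 2)).integrable_slice ht'
  have ic : IntegrableOn c slab := h.adm_coriolis.integrable_slice ht'
  have iL2 : IntegrableOn (fun x => L x ^ 2) slab :=
    ((hadmL.mul_bdd hadmL).congr fun _ _ => (sq _).symm : Adm T τ 1
      (fun x => (R x * logSq T R x) ^ 2)).integrable_slice ht'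
  have hP0 : ∀ x ∈ slab, 0 ≤ P x := fun x hx => kin_nonneg (hp x hx).le
  have hL0 : ∀ x ∈ slab, 0 ≤ L x := fun x hx => mul_nonneg (hp x hx).le (logSq_nonneg _)
  have hg0 : ∀ x ∈ slab, 0 ≤ g x := fun x hx =>
    mul_nonneg (Real.rpow_nonneg (hp x hx).le _) (Finset.sum_nonneg fun _ _ => sq_nonneg _)
  have hcb : ∀ x ∈ slab, |c x| ≤ √(P x) * √(L x) := fun x hx =>
    h.abs_sum_mul_grad_le (hst x hx) (sum_rot_sq_le _)
  have hPK : ∫ x in slab, P x ≤ 2 * K := (h.integral_kin_le hγ hγ2 ha0.le (by linarith) ht').trans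
    (by linarith)
  -- the region of high density
  have hhigh : ∀ x ∈ slab \ A, β * |c x| ≤ a / 4 * g x + 2 * P x := by
    intro x hx
    have hR : 1 / 2 ≤ R (t, x) := by
      by_contra hlt
      exact hx.2 ⟨hx.1, not_le.1 hlt⟩
    have h1 : L x / 2 ≤ g x := by
      simp only [hg, hL]
      rw [h.gradSq_eq (hst x hx.1)]
      have e : R (t, x) ^ (γ - 2) * (R (t, x) ^ 2 * logSq T R (t, x)) =
          R (t, x) ^ (γ - 1) * (R (t, x) * logSq T R (t, x)) := by
        rw [show γ - 1 = γ - 2 + 1 by ring, Real.rpow_add_one (hp x hx.1).ne']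
        ring
      rw [e]
      nlinarith [mul_le_mul_of_nonneg_right (half_le_rpow hR (by linarith : 0 ≤ γ - 1)
        (by linarith)) (hL0 x hx.1)]
    have h2 := mul_le_mul_of_nonneg_left (hcb x hx.1) hβ
    have h3 := Real.sq_sqrt (hP0 x hx.1)
    have h4 := Real.sq_sqrt (hL0 x hx.1)
    -- Young's inequality balanced so that β²/8 = a/8; as L is at most twice g here, only a quarter
    -- of the pressure dissipation is spent.
    have h5 : β * (√(P x) * √(L x)) ≤ 2 * √(P x) ^ 2 + β ^ 2 / 8 * √(L x) ^ 2 := by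
      nlinarith [sq_nonneg (4 * √(P x) - β * √(L x))]
    rw [h3, h4, hβa] at h5
    nlinarith [mul_le_mul_of_nonneg_left h1 ha0.le]
  have hhigh' : β * ∫ x in slab \ A, |c x| ≤ a / 4 * (∫ x in slab, g x) + 4 * K := by
    have hsub : slab \ A ⊆ slab := sdiff_subset
    calc β * ∫ x in slab \ A, |c x| = ∫ x in slab \ A, β * |c x| := (integral_const_mul _ _).symm
      _ ≤ ∫ x in slab \ A, (a / 4 * g x + 2 * P x) :=
        setIntegral_mono_on ((ic.mono_set hsub).abs.const_mul β)
          (((ig.mono_set hsub).const_mul _).add ((iP.mono_set hsub).const_mul _))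
          (measurableSet_slab.diff (hmeas _)) hhigh
      _ ≤ ∫ x in slab, (a / 4 * g x + 2 * P x) := by
        refine setIntegral_mono_set ((ig.const_mul _).add (iP.const_mul _)) ?_
          (LE.le.eventuallyLE hsub)
        filter_upwards [ae_restrict_mem measurableSet_slab] with x hx
        exact add_nonneg (mul_nonneg (by positivity) (hg0 x hx))
          (mul_nonneg (by norm_num) (hP0 x hx))
      _ = a / 4 * (∫ x in slab, g x) + 2 * ∫ x in slab, P x := by
        rw [integral_add (ig.const_mul _) (iP.const_mul _), integral_const_mul,
          integral_const_mul]
      _ ≤ _ := by linarith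
  -- the region of low density
  set X := ∫ x in slab, g x with hX
  set Y := ∫ x in slab, ∑ i, ∑ j, dx T i (dx T j R) (t, x) ^ 2 with hY
  have X0 : 0 ≤ X := setIntegral_nonneg measurableSet_slab hg0
  have Y0 : 0 ≤ Y := integral_nonneg fun x =>
    Finset.sum_nonneg fun _ _ => Finset.sum_nonneg fun _ _ => sq_nonneg _
  have hvol := h.volume_low_density_le hγ hγ2 ha0 (by nlinarith [sq_nonneg K])
    (by linarith) ht' hE
  have hAfin : volume A ≠ ⊤ := ne_top_of_le_ne_top ENNReal.ofReal_ne_top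
    ((measure_mono (inter_subset_inter_right _ fun x (hx : R (t, x) < 1 / 2) =>
      show R (t, x) < 3 / 4 from lt_trans hx (by norm_num))).trans hvol)
  -- The Sobolev bound involves the gradient only where ρ < 1, and there ρ^(γ-2) ≥ 1 because γ ≤ 2;
  -- the dissipation X therefore dominates it.
  have hAvol : (volume A).toReal ≤ 2 ^ 30 * X ^ 3 := by
    have h1 := measure_low_density_le (ρ := fun x => R (t, x)) (ρ' := fun i x => dx T i R (t, x))
      (fun x hx => (hp x hx).le) hRc (fun i => h.continuousOn_slab (h.adm_ddR _) ht')
      (fun i y s hs => hasDerivAt_comp_line h.admR.differentiableOn ht'.1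
        (hst _ hs).2.1 hs) (h.adm_gradSq.integrable_slice ht') hvol
    refine h1.trans (mul_le_mul_of_nonneg_left (pow_le_pow_left₀ (integral_nonneg fun x =>
      Finset.sum_nonneg fun _ _ => sq_nonneg _) ?_ 3) (by norm_num))
    calc ∫ x in slab ∩ {x | R (t, x) < 1}, ∑ i, dx T i R (t, x) ^ 2
        ≤ ∫ x in slab ∩ {x | R (t, x) < 1}, g x :=
          setIntegral_mono_on ((h.adm_gradSq.integrable_slice ht').mono_set inter_subset_left)
            (ig.mono_set inter_subset_left) (hmeas _) fun x hx =>
            le_mul_of_one_le_left (Finset.sum_nonneg fun _ _ => sq_nonneg _)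
              (Real.one_le_rpow_of_pos_of_le_one_of_nonpos (hp x hx.1) (le_of_lt hx.2)
                (by linarith))
      _ ≤ X := setIntegral_mono_set ig (by
          filter_upwards [ae_restrict_mem measurableSet_slab] with x hx
          exact hg0 x hx) (LE.le.eventuallyLE inter_subset_left)
  have hW : ∫ x in A, L x ^ 2 ≤ 14 * Y := by
    refine le_trans (setIntegral_mono_set iL2 (Filter.Eventually.of_forall fun x => sq_nonneg _)
      (LE.le.eventuallyLE hAs)) (le_trans (le_of_eq ?_) (h.integral_log_pow_four_le ht))
    exact integral_congr_ae (Filter.Eventually.of_forall fun x => by simp only [hL, logSq]; ring)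
  set B := ∫ x in A, L x with hB
  set Z := ∫ x in A, √(P x) * √(L x) with hZ
  have B0 : 0 ≤ B := setIntegral_nonneg (hmeas _) fun x hx => hL0 x hx.1
  have Z0 : 0 ≤ Z := integral_nonneg fun x => mul_nonneg (Real.sqrt_nonneg _) (Real.sqrt_nonneg _)
  have hB2 : B ^ 2 ≤ 14 * Y * (2 ^ 30 * X ^ 3) := by
    have h1 := sq_integral_mul_le (μ := volume.restrict A) (a := L) (b := fun _ => 1)
      (iL2.mono_set hAs) (integrableOn_const (by simpa using hAfin))
      (by simpa only [mul_one] using (iL.mono_set hAs).integrable)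
    simp only [mul_one, one_pow, integral_const, smul_eq_mul, measureReal_def,
      Measure.restrict_apply MeasurableSet.univ, univ_inter] at h1
    exact h1.trans (mul_le_mul hW hAvol ENNReal.toReal_nonneg (by positivity))
  have isq : ∀ {f : E3 → ℝ}, IntegrableOn f slab → (∀ x ∈ slab, 0 ≤ f x) →
      IntegrableOn (fun x => √(f x) ^ 2) A := fun hf h0 =>
    (hf.mono_set hAs).congr_fun (fun x hx => (Real.sq_sqrt (h0 x hx.1)).symm) (hmeas _)
  have iPL : IntegrableOn (fun x => √(P x) * √(L x)) A := by
    refine Integrable.mono' ((isq iP hP0).add (isq iL hL0)) ?_ ?_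
    · exact ((((h.continuousOn_slab h.adm_kin ht').sqrt).mul
        ((h.continuousOn_slab hadmL ht').sqrt)).mono hAs).aestronglyMeasurable (hmeas _)
    · filter_upwards with x
      rw [Real.norm_of_nonneg (mul_nonneg (Real.sqrt_nonneg _) (Real.sqrt_nonneg _))]
      simp only [Pi.add_apply]
      nlinarith [sq_nonneg (√(P x) - √(L x)), sq_nonneg (√(P x)), sq_nonneg (√(L x))]
  have hZ2 : Z ^ 2 ≤ 2 * K * B := by
    have h1 := sq_integral_mul_le (isq iP hP0) (isq iL hL0) iPL
    refine h1.trans (mul_le_mul ?_ (le_of_eq ?_) (integral_nonneg fun x => sq_nonneg _)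
      (by positivity))
    · rw [setIntegral_congr_fun (hmeas _) fun x hx => Real.sq_sqrt (hP0 x hx.1)]
      exact (setIntegral_mono_set iP (by
        filter_upwards [ae_restrict_mem measurableSet_slab] with x hx
        exact hP0 x hx) (LE.le.eventuallyLE hAs)).trans hPK
    · exact setIntegral_congr_fun (hmeas _) fun x hx => Real.sq_sqrt (hL0 x hx.1)
  have hlow : β * ∫ x in A, |c x| ≤ a / 4 * X + κ / 4 * Y := by
    have h1 : β * ∫ x in A, |c x| ≤ β * Z := mul_le_mul_of_nonneg_left
      (setIntegral_mono_on (ic.mono_set hAs).abs iPL (hmeas _) fun x hx => hcb x hx.1) hβ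
    refine h1.trans (le_trans ?_ (by nlinarith : a / 4 * X + 1 / 4 * Y ≤ _))
    -- Z⁴ is at most 4K²B², and B² at most a constant times X³Y. Since β⁴ = a² while (aX)³Y contains
    -- a³, one factor a is left over to pay for K².
    refine le_of_pow_le_pow_left₀ (n := 4) (by norm_num) (by positivity) ?_
    have hx0 : 0 ≤ a * X := by positivity
    have h4 : (a * X) ^ 3 * Y ≤ (a * X + Y) ^ 4 := by
      calc (a * X) ^ 3 * Y ≤ (a * X + Y) ^ 3 * (a * X + Y) :=
            mul_le_mul (pow_le_pow_left₀ hx0 (by linarith) 3) (by linarith) Y0 (by positivity)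
        _ = _ := by ring
    -- Here the size 2⁴⁴ of the threshold is decided: 56 ≤ 2⁶. The extra 2⁸ is the fourth power of
    -- the 1/4 in front of aX + Y.
    have hKa : 56 * 2 ^ 38 * K ^ 2 ≤ a := by nlinarith [sq_nonneg K]
    calc (β * Z) ^ 4 = a ^ 2 * (Z ^ 2) ^ 2 := by rw [← hβa]; ring
      _ ≤ a ^ 2 * (2 * K * B) ^ 2 := by gcongr
      _ = a ^ 2 * (4 * K ^ 2) * B ^ 2 := by ring
      _ ≤ a ^ 2 * (4 * K ^ 2) * (14 * Y * (2 ^ 30 * X ^ 3)) := by gcongr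
      _ = (56 * 2 ^ 38 * K ^ 2) * (a ^ 2 * X ^ 3 * Y) * (1 / 2 ^ 8) := by ring
      _ ≤ a * (a ^ 2 * X ^ 3 * Y) * (1 / 2 ^ 8) := by gcongr
      _ = (a * X) ^ 3 * Y * (1 / 2 ^ 8) := by ring
      _ ≤ (a * X + Y) ^ 4 * (1 / 2 ^ 8) := by gcongr
      _ = _ := by ring
  have hsplit : ∫ x in slab, |c x| = (∫ x in A, |c x|) + ∫ x in slab \ A, |c x| :=
    by
    rw [setIntegral_sdiff (hmeas _) ic.abs hAs]; ring
  calc β * |∫ x in slab, c x| ≤ β * ∫ x in slab, |c x| :=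
        mul_le_mul_of_nonneg_left abs_integral_le_integral_abs hβ
    _ ≤ _ := by rw [hsplit]; linarith

end Flow
end NSK
end

/-! ### The BD entropy estimate for flows. -/

noncomputable section

namespace NSK

variable {T : EReal} {τ : ℝ} {p q r : ℝ≥0∞} {F G : ℝ × E3 → ℝ}

theorem setIntegral_combination {f g w : ℝ → ℝ} (h0 : 0 ≤ τ) (hf : IntegrableOn f (Ioc 0 τ))
    (hg : IntegrableOn g (Ioc 0 τ)) (hw : IntegrableOn w (Ioc 0 τ)) (c d k : ℝ) :
    ∫ t in Ioc 0 τ, (c * f t + d * g t - k - w t) =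
      c * (∫ t in Ioc 0 τ, f t) + d * (∫ t in Ioc 0 τ, g t) - k * τ - ∫ t in Ioc 0 τ, w t := by
  have i1 : IntegrableOn (fun t => c * f t + d * g t) (Ioc 0 τ) :=
    (hf.const_mul c).add (hg.const_mul d)
  have i2 : IntegrableOn (fun _ : ℝ => k) (Ioc 0 τ) := integrableOn_const (by simp)
  have i3 : IntegrableOn (fun t => c * f t + d * g t - k) (Ioc 0 τ) := i1.sub i2
  rw [integral_sub i3 hw, integral_sub i1 i2, integral_add (hf.const_mul c) (hg.const_mul d),
    integral_const_mul, integral_const_mul]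
  simp [h0]
  ring

namespace Flow

variable {γ ν a κ β : ℝ} {R : ℝ × E3 → ℝ} {U : Fin 3 → ℝ × E3 → ℝ}

theorem energy_nonneg (h : Flow γ ν a κ β T τ R U) (hγ : 1 < γ) (ha : 0 ≤ a)
    (hκ : 0 ≤ κ) {t : ℝ} (ht : t ∈ Icc 0 τ) :
    0 ≤ ∫ x in slab, energyDens γ a κ T R U (t, x) := by
  refine setIntegral_nonneg measurableSet_slab fun x hx => ?_
  have hm := mem_spaceTime h.lt ht (slab_subset hx)
  have := h.energyDens_parts hγ ha hκ hm
  have h2 := kin_nonneg (U := U) (h.pos _ hm).le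
  linarith [this.1, this.2]

theorem dissipation_nonneg (h : Flow γ ν a κ β T τ R U) :
    0 ≤ ∫ t in Ioc 0 τ, ∫ x in slab, R (t, x) * ∑ i, ∑ j, strn T U i j (t, x) ^ 2 :=
  setIntegral_nonneg measurableSet_Ioc fun _ ht => setIntegral_nonneg measurableSet_slab
    fun _ hx => mul_nonneg (h.pos _ (mem_spaceTime h.lt (Ioc_subset_Icc_self ht)
      (slab_subset hx))).le (Finset.sum_nonneg fun _ _ => Finset.sum_nonneg fun _ _ => sq_nonneg _)

/-- The balance law is applied to the flow restricted to [0,t], and the dissipation is dropped. -/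
theorem energy_le (h : Flow γ ν a κ β T τ R U) (hν : 0 < ν) (hγ : 1 < γ) (hγ2 : γ ≤ 2) {t : ℝ}
    (ht : t ∈ Icc 0 τ) : ∫ x in slab, energyDens γ a κ T R U (t, x) ≤
      ∫ x in slab, energyDens γ a κ T R U (0, x) := by
  have h' := h.mono ht.1 ht.2
  rw [← h'.energy_balance hγ hγ2]
  have := mul_nonneg hν.le h'.dissipation_nonneg
  linarith

/-- The mixed term in the BD entropy is controlled by the energy and the entropy. -/
theorem bdDens_bounds (h : Flow γ ν a κ β T τ R U) (hν : 0 < ν) {x : ℝ × E3}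
    (hx : x ∈ spaceTime T) :
    ν ^ 2 / 4 * (R x * logSq T R x) - kin R U x ≤ ν * bdDens ν T R U x ∧
      ν * bdDens ν T R U x ≤ 3 / 4 * ν ^ 2 * (R x * logSq T R x) + kin R U x := by
  have hR := (h.pos x hx).le
  have h1 := h.abs_sum_mul_grad_le hx (le_refl (∑ i, U i x ^ 2))
  have h2 := Real.sq_sqrt (kin_nonneg (U := U) hR)
  have h3 := Real.sq_sqrt (mul_nonneg hR (logSq_nonneg (T := T) (R := R) x))
  have h4 : ν * |∑ i, U i x * dx T i R x| ≤ ν ^ 2 / 4 * (R x * logSq T R x) + kin R U x := by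
    refine (mul_le_mul_of_nonneg_left h1 hν.le).trans ?_
    nlinarith [sq_nonneg (√(kin R U x) - ν / 2 * √(R x * logSq T R x))]
  have e : ν * bdDens ν T R U x = ν ^ 2 / 2 * (R x * logSq T R x) +
      ν * ∑ i, U i x * dx T i R x := by
    simp only [bdDens, logSq, sq]
    ring
  obtain ⟨h5, h6⟩ := abs_le.1 (le_refl |∑ i, U i x * dx T i R x|)
  rw [e]
  constructor <;> nlinarith

theorem integral_transport_le (h : Flow γ ν a κ β T τ R U) :
    ∫ t in Ioc 0 τ, ∫ x in slab, R (t, x) * ∑ i, ∑ j, dx T j (U i) (t, x) * dx T i (U j) (t, x) ≤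
      ∫ t in Ioc 0 τ, ∫ x in slab, R (t, x) * ∑ i, ∑ j, strn T U i j (t, x) ^ 2 := by
  refine setIntegral_mono_on h.adm_transport.integrable_time h.adm_dissipation.integrable_time
    measurableSet_Ioc fun t ht => ?_
  have ht' := Ioc_subset_Icc_self ht
  refine setIntegral_mono_on (h.adm_transport.integrable_slice ht')
    (h.adm_dissipation.integrable_slice ht') measurableSet_slab fun x hx => ?_
  refine mul_le_mul_of_nonneg_left ?_ (h.pos _ (mem_spaceTime h.lt ht' (slab_subset hx))).le
  exact sum_mul_swap_le_sum_sq fun i j => dx T j (U i) (t, x)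

/-- The BD entropy estimate. -/
theorem bd_estimate (h : Flow γ ν a κ β T τ R U) (hν : 0 < ν) (hγ : 1 < γ) (hγ2 : γ ≤ 2) {K : ℝ}
    (haK : 2 ^ 44 * (1 + K) ^ 2 ≤ a) (hκ : 1 ≤ κ) (hβ : 0 ≤ β) (hβa : β ^ 2 = a)
    (hE : (∫ x in slab, energyDens γ a κ T R U (0, x)) +
      ν ^ 2 / 2 * (∫ x in slab, R (0, x) * logSq T R (0, x)) ≤ K) :
    ν ^ 2 / 2 * (∫ x in slab, R (τ, x) * logSq T R (τ, x)) +
      ν * (a * ∫ t in Ioc 0 τ, ∫ x in slab, R (t, x) ^ (γ - 2) * ∑ i, dx T i R (t, x) ^ 2) +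
      ν * (κ * ∫ t in Ioc 0 τ, ∫ x in slab, ∑ i, ∑ j, dx T i (dx T j R) (t, x) ^ 2) ≤
      13 * K + 8 * ν * K * τ := by
  have h0 := h.nonneg
  have ha : 0 ≤ a := hβa ▸ sq_nonneg β
  have hm0 : (0 : ℝ) ∈ Icc 0 τ := left_mem_Icc.2 h0
  have hmτ : τ ∈ Icc 0 τ := right_mem_Icc.2 h0
  have hadmL : Adm T τ 1 (fun x => R x * logSq T R x) := h.admR.bdd_mul h.adm_logSq
  have hLnn : ∀ t ∈ Icc 0 τ, 0 ≤ ∫ x in slab, R (t, x) * logSq T R (t, x) := fun t ht =>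
    setIntegral_nonneg measurableSet_slab fun x hx => mul_nonneg
      (h.pos _ (mem_spaceTime h.lt ht (slab_subset hx))).le (logSq_nonneg _)
  have hL0 := mul_nonneg (by positivity : 0 ≤ ν ^ 2 / 2) (hLnn 0 hm0)
  have hE0 := h.energy_nonneg hγ ha (by linarith) hm0
  have hK : 0 ≤ K := by linarith
  have hEt : ∀ t ∈ Icc 0 τ, ∫ x in slab, energyDens γ a κ T R U (t, x) ≤ K := fun t ht =>
    (h.energy_le hν hγ hγ2 ht).trans (by linarith)
  have hkin : ∀ t ∈ Icc 0 τ, ∫ x in slab, kin R U (t, x) ≤ 2 * K := fun t ht =>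
    (h.integral_kin_le hγ hγ2 ha (by linarith) ht).trans (by linarith [hEt t ht])
  have hdiss : ν * ∫ t in Ioc 0 τ, ∫ x in slab, R (t, x) * ∑ i, ∑ j, strn T U i j (t, x) ^ 2 ≤
      K := by
    have := h.energy_balance hγ hγ2
    have := h.energy_nonneg hγ ha (by linarith) hmτ
    have := hEt 0 hm0
    linarith
  have hlower : ν ^ 2 / 4 * (∫ x in slab, R (τ, x) * logSq T R (τ, x)) -
      ∫ x in slab, kin R U (τ, x) ≤ ν * ∫ x in slab, bdDens ν T R U (τ, x) := by
    have i1 := (hadmL.integrable_slice hmτ).const_mul (ν ^ 2 / 4)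
    have i2 := h.adm_kin.integrable_slice hmτ
    rw [← integral_const_mul, ← integral_const_mul, ← integral_sub i1 i2]
    exact setIntegral_mono_on (i1.sub i2) ((h.adm_bdDens.integrable_slice hmτ).const_mul ν)
      measurableSet_slab fun x hx =>
        (h.bdDens_bounds hν (mem_spaceTime h.lt hmτ (slab_subset hx))).1
  have hupper : ν * ∫ x in slab, bdDens ν T R U (0, x) ≤
      3 / 4 * ν ^ 2 * (∫ x in slab, R (0, x) * logSq T R (0, x)) +
      ∫ x in slab, kin R U (0, x) := by
    have i1 := (hadmL.integrable_slice hm0).const_mul (3 / 4 * ν ^ 2)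
    have i2 := h.adm_kin.integrable_slice hm0
    rw [← integral_const_mul, ← integral_const_mul, ← integral_add i1 i2]
    exact setIntegral_mono_on ((h.adm_bdDens.integrable_slice hm0).const_mul ν) (i1.add i2)
      measurableSet_slab fun x hx =>
        (h.bdDens_bounds hν (mem_spaceTime h.lt hm0 (slab_subset hx))).2
  have iX := (h.adm_pressure (γ - 2)).integrable_time
  have iY := h.adm_hess.integrable_time
  have iC := h.adm_coriolis.integrable_time
  have iV := h.adm_transport.integrable_time
  have hbd := h.bd_balance
  have iconst : IntegrableOn (fun _ : ℝ => 4 * K) (Ioc 0 τ) := integrableOn_const (by simp)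
  -- The Coriolis term consumes half of aX and a quarter of κY, and costs 4K per unit of time.
  have hint : ∫ t in Ioc 0 τ,
      (a / 2 * (∫ x in slab, R (t, x) ^ (γ - 2) * ∑ i, dx T i R (t, x) ^ 2)
        + 3 / 4 * κ * (∫ x in slab, ∑ i, ∑ j, dx T i (dx T j R) (t, x) ^ 2) - 4 * K
        - ∫ x in slab, R (t, x) * ∑ i, ∑ j, dx T j (U i) (t, x) * dx T i (U j) (t, x)) ≤
      ∫ t in Ioc 0 τ, (a * (∫ x in slab, R (t, x) ^ (γ - 2) * ∑ i, dx T i R (t, x) ^ 2)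
        + κ * (∫ x in slab, ∑ i, ∑ j, dx T i (dx T j R) (t, x) ^ 2)
        + β * (∫ x in slab, ∑ i, rot U i (t, x) * dx T i R (t, x))
        - ∫ x in slab, R (t, x) * ∑ i, ∑ j, dx T j (U i) (t, x) * dx T i (U j) (t, x)) := by
    refine setIntegral_mono_on ((((iX.const_mul _).add (iY.const_mul _)).sub iconst).sub iV)
      ((((iX.const_mul _).add (iY.const_mul _)).add (iC.const_mul _)).sub iV) measurableSet_Ioc
      fun t ht => ?_
    have h1 := h.coriolis_le hγ hγ2 hK haK hκ hβ hβa ht (hEt t (Ioc_subset_Icc_self ht))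
    have h2 := mul_le_mul_of_nonneg_left
      (neg_abs_le (∫ x in slab, ∑ i, rot U i (t, x) * dx T i R (t, x))) hβ
    linarith
  have hcomp : ∫ t in Ioc 0 τ,
      (a / 2 * (∫ x in slab, R (t, x) ^ (γ - 2) * ∑ i, dx T i R (t, x) ^ 2)
        + 3 / 4 * κ * (∫ x in slab, ∑ i, ∑ j, dx T i (dx T j R) (t, x) ^ 2) - 4 * K
        - ∫ x in slab, R (t, x) * ∑ i, ∑ j, dx T j (U i) (t, x) * dx T i (U j) (t, x)) =
      a / 2 * (∫ t in Ioc 0 τ, ∫ x in slab, R (t, x) ^ (γ - 2) * ∑ i, dx T i R (t, x) ^ 2)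
        + 3 / 4 * κ * (∫ t in Ioc 0 τ, ∫ x in slab, ∑ i, ∑ j, dx T i (dx T j R) (t, x) ^ 2)
        - 4 * K * τ
        - ∫ t in Ioc 0 τ, ∫ x in slab, R (t, x) *
            ∑ i, ∑ j, dx T j (U i) (t, x) * dx T i (U j) (t, x) :=
    setIntegral_combination h0 iX iY iV _ _ _
  have htr := h.integral_transport_le
  have hXnn : 0 ≤ ∫ t in Ioc 0 τ, ∫ x in slab, ∑ i, ∑ j, dx T i (dx T j R) (t, x) ^ 2 :=
    integral_nonneg fun _ => integral_nonneg fun _ => Finset.sum_nonneg fun _ _ =>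
      Finset.sum_nonneg fun _ _ => sq_nonneg _
  rw [hcomp] at hint
  have hk0 := hkin 0 hm0
  have hkτ := hkin τ hmτ
  have hν2 := mul_le_mul_of_nonneg_left htr hν.le
  have hνbd := congrArg (ν * ·) hbd
  have hνint := mul_le_mul_of_nonneg_left hint hν.le
  simp only [mul_add, mul_sub] at hνbd hνint
  have hpos : 0 ≤ ν * (κ * ∫ t in Ioc 0 τ, ∫ x in slab,
      ∑ i, ∑ j, dx T i (dx T j R) (t, x) ^ 2) := by positivity
  -- Apart from 4νKτ the right side collects 2K (kinetic energy at τ), K (transport), 3K/2 (initial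
  -- entropy) and 2K (initial kinetic energy). Doubling 13K/2 + 4νKτ restores the coefficients ν²/2
  -- and νa on the left.
  linarith

end Flow
end NSK
end

/-! ### From the system of the statement to flows. -/

noncomputable section

namespace NSK

variable {T : EReal} {τ : ℝ} {p q r : ℝ≥0∞} {F G : ℝ × E3 → ℝ}

theorem crossProduct_e3 (w : Fin 3 → ℝ) (i : Fin 3) :
    crossProduct ![0, 0, 1] w i = ![-w 1, w 0, 0] i := by
  fin_cases i <;> simp [cross_apply]

/-- The density as a function on space-time. -/
abbrev stDensity (ρ : ℝ → E3 → ℝ) : ℝ × E3 → ℝ := fun x => ρ x.1 x.2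

/-- The velocity components as functions on space-time. -/
abbrev stVelocity (u : ℝ → E3 → E3) : Fin 3 → ℝ × E3 → ℝ := fun i x => u x.1 x.2 i

theorem hasDerivAt_pressure {γ : ℝ} (hγ : 1 < γ) (z : ℝ) (hz : 0 < z) :
    HasDerivAt (pressure γ) (z * z ^ (γ - 2)) z := by
  have a := (Real.hasDerivAt_rpow_const (p := γ) (Or.inl hz.ne')).div_const γ
  refine a.congr_deriv ?_
  have : γ ≠ 0 := by linarith
  rw [show γ - 1 = γ - 2 + 1 by ring, Real.rpow_add_one hz.ne']
  field_simp

section Slices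

variable {R : ℝ × E3 → ℝ} {U : Fin 3 → ℝ × E3 → ℝ} {t : ℝ}

theorem gradSq_slice (hF : DifferentiableOn ℝ F (spaceTime T)) (h0 : 0 ≤ t)
    (hτ : (t : EReal) < T) {x : E3} (hx : x ∈ closedSlab) :
    gradSq (fun x => F (t, x)) x = ∑ i, dx T i F (t, x) ^ 2 :=
  Finset.sum_congr rfl fun i _ => by rw [pd_slice hF h0 hτ i hx]

theorem pd_pd_slice (hF : Adm T τ p F) (h0 : 0 ≤ t) (hτ : (t : EReal) < T) (i j : Fin 3) :
    EqOn (pd i (pd j (fun x => F (t, x)))) (fun x => dx T i (dx T j F) (t, x)) closedSlab :=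
  fun x hx => by
    rw [pd_congr (pd_slice hF.differentiableOn h0 hτ j) i hx]
    exact pd_slice (hF.dd _).differentiableOn h0 hτ i hx

theorem strain_slice {u : E3 → E3} (hU : ∀ i, DifferentiableOn ℝ (U i) (spaceTime T))
    (hu : ∀ i, (fun y => u y i) = fun y => U i (t, y)) (h0 : 0 ≤ t) (hτ : (t : EReal) < T)
    (i j : Fin 3) : EqOn (fun x => strain u x i j) (fun x => strn T U i j (t, x)) closedSlab :=
  fun x hx => by
    simp only [strain, strn, Matrix.of_apply]
    rw [hu, hu, pd_slice (hU i) h0 hτ j hx, pd_slice (hU j) h0 hτ i hx]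

end Slices

/-- Smooth solutions are flows. -/
theorem IsSmoothSolution.flow {α γ ν ε : ℝ} {ρ : ℝ → E3 → ℝ} {u : ℝ → E3 → E3}
    (h : IsSmoothSolution α γ ν ε T ρ u) (hγ : 1 < γ) (h0 : 0 ≤ τ) (hτ : (τ : EReal) < T) :
    Flow γ ν (1 / ε ^ 2) (1 / ε ^ (2 * (1 - α))) (1 / ε) T τ (stDensity ρ) (stVelocity u) := by
  have hT : 0 < T := lt_of_le_of_lt (by exact_mod_cast h0) hτ
  have hden : Adm T τ 2 (fun x => stDensity ρ x - 1) := h.smooth_density.adm h0 hτ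
  have hvel : ∀ i, Adm T τ 2 (stVelocity u i) := fun i =>
    (isSmoothField_clm hT h.smooth_velocity (EuclideanSpace.proj i : E3 →L[ℝ] ℝ)).adm h0 hτ
  have hR : Adm T τ ⊤ (stDensity ρ) :=
    (hden.top.add (Adm.const h0 hτ 1) le_top).congr fun x _ => by ring
  have hpos : ∀ x ∈ spaceTime T, 0 < stDensity ρ x := fun x hx => by
    obtain ⟨c, hc, hl⟩ := h.density_pos x.1 hx.2.1
    exact hc.trans_le (hl x.1 ⟨hx.1, le_rfl⟩ x.2 hx.2.2)
  have hlt : ∀ {t : ℝ}, t ≤ τ → (t : EReal) < T := fun ht =>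
    lt_of_le_of_lt (EReal.coe_le_coe_iff.2 ht) hτ
  have hmass : ∀ x ∈ Ioc 0 τ ×ˢ slab, dt T (stDensity ρ) x + ∑ j, (dx T j (stDensity ρ) x *
      stVelocity u j x + stDensity ρ x * dx T j (stVelocity u j) x) = 0 := by
    rintro ⟨t, x⟩ ⟨ht, hx⟩
    have hxc := slab_subset hx
    have hm : (t, x) ∈ spaceTime T := ⟨ht.1.le, hlt ht.2, hxc⟩
    rw [← h.mass t ht.1 (hlt ht.2) x hx,
      (hasDerivAt_time hR.differentiableOn ht.1 (hlt ht.2) hxc).deriv]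
    congr 1
    refine Finset.sum_congr rfl fun j _ => ?_
    rw [← ((hR.hasDD (0, EuclideanSpace.single j 1) hm).mul ((hvel j).hasDD _ hm)).eq]
    exact (pd_slice (hR.mul_bdd (hvel j) le_top).differentiableOn ht.1.le (hlt ht.2) j hxc).symm
  refine ⟨hden, hvel, hpos, h.density_pos τ hτ, hmass, ?_, ?_⟩
  · rintro ⟨t, x⟩ ⟨ht, hx⟩ i
    have hxc := slab_subset hx
    have ht0 := ht.1.le
    have htT := hlt ht.2
    have hm : (t, x) ∈ spaceTime T := ⟨ht0, htT, hxc⟩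
    have hu := uniqueDiffOn_spaceTime hT _ hm
    have hRU : Adm T τ ⊤ (fun x => stDensity ρ x * stVelocity u i x) :=
      hR.mul_bdd (hvel i) le_top
    have e1 : deriv (fun s => ρ s x * u s x i) t = dt T (stDensity ρ) (t, x) *
        stVelocity u i (t, x) + stDensity ρ (t, x) * dt T (stVelocity u i) (t, x) := by
      rw [← ((hR.hasDD (1, 0) hm).mul ((hvel i).hasDD _ hm)).eq]
      exact (hasDerivAt_time hRU.differentiableOn ht.1 htT hxc).deriv
    have e2 : ∀ j, pd j (fun y => ρ t y * u t y i * u t y j) x =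
        (dx T j (stDensity ρ) (t, x) * stVelocity u i (t, x) + stDensity ρ (t, x) *
          dx T j (stVelocity u i) (t, x)) * stVelocity u j (t, x) + stDensity ρ (t, x) *
          stVelocity u i (t, x) * dx T j (stVelocity u j) (t, x) := fun j => by
      rw [← (((hR.hasDD (0, EuclideanSpace.single j 1) hm).mul ((hvel i).hasDD _ hm)).mul
        ((hvel j).hasDD _ hm)).eq]
      exact pd_slice (hRU.mul_bdd (hvel j) le_top).differentiableOn ht0 htT j hxc
    have e3 : pd i (fun y => pressure γ (ρ t y)) x = stDensity ρ (t, x) *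
        stDensity ρ (t, x) ^ (γ - 2) * dx T i (stDensity ρ) (t, x) := by
      rw [← (HasDD.comp (hasDerivAt_pressure hγ _ (hpos _ hm)) (hR.hasDD _ hm)).eq]
      refine pd_slice (F := fun x => pressure γ (stDensity ρ x)) (fun y hy => ?_) ht0 htT i hxc
      exact (hasDerivAt_pressure hγ _ (hpos _ hy)).differentiableAt.comp_differentiableWithinAt y
        (hR.differentiableOn y hy)
    have hs : ∀ j, Adm T τ 2 (strn T (stVelocity u) i j) := fun j =>
      ((((hvel i).dd _).add ((hvel j).dd _)).const_mul (1 / 2)).congr fun x _ => by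
        simp only [strn]; ring
    have e4 : ∀ j, pd j (fun y => ρ t y * strain (u t) y i j) x =
        dx T j (stDensity ρ) (t, x) * strn T (stVelocity u) i j (t, x) + stDensity ρ (t, x) *
          ((dx T j (dx T j (stVelocity u i)) (t, x) + dx T j (dx T i (stVelocity u j)) (t, x)) / 2)
        := fun j => by
      have hstr : HasDD T (0, EuclideanSpace.single j 1) (strn T (stVelocity u) i j) (t, x)
          (1 / 2 * (dx T j (dx T j (stVelocity u i)) (t, x) +
            dx T j (dx T i (stVelocity u j)) (t, x))) :=
        (((((hvel i).dd _).hasDD _ hm).add (((hvel j).dd _).hasDD _ hm)).const_mul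
          (1 / 2)).congr fun y _ => by simp only [strn]; ring
      have := ((hR.hasDD (0, EuclideanSpace.single j 1) hm).mul hstr).eq
      rw [one_div, ← div_eq_inv_mul] at this
      rw [← this, pd_congr (g := fun y => (fun x => stDensity ρ x * strn T (stVelocity u) i j x)
        (t, y)) (fun y hy => ?_) j hxc]
      · exact pd_slice (hR.mul_bdd (hs j) le_top).differentiableOn ht0 htT j hxc
      · have := strain_slice (U := stVelocity u) (u := u t) (t := t)
          (fun i => (hvel i).differentiableOn) (fun i => rfl) ht0 htT i j hy
        simp only at this ⊢
        rw [this]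
    have hlap : Adm T τ ⊤ (fun x => ∑ k, dx T k (dx T k (stDensity ρ)) x) :=
      Adm.sum Finset.univ h0 hτ (fun k => (hR.dd _).dd _) le_top
    have e5 : pd i (lap (ρ t)) x = ∑ k, dx T i (dx T k (dx T k (stDensity ρ))) (t, x) := by
      rw [← (HasDD.sum (s := Finset.univ) hm hu fun k : Fin 3 =>
        ((hR.dd (0, EuclideanSpace.single k 1)).dd (0, EuclideanSpace.single k 1)).hasDD
          (0, EuclideanSpace.single i 1) hm).eq,
        pd_congr (g := fun y => ∑ k, dx T k (dx T k (stDensity ρ)) (t, y)) (fun y hy => ?_) i hxc]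
      · exact pd_slice hlap.differentiableOn ht0 htT i hxc
      · exact Finset.sum_congr rfl fun k _ => pd_pd_slice hR ht0 htT k k hy
    have hmom := h.momentum t ht.1 htT x hx i
    have hma := hmass (t, x) ⟨ht, hx⟩
    have e6 : crossProduct ![0, 0, 1] (fun k => ρ t x * u t x k) i =
        stDensity ρ (t, x) * rot (stVelocity u) i (t, x) := by
      rw [crossProduct_e3]
      fin_cases i <;> simp [rot]
    rw [e1, e3, e5, e6] at hmom
    simp only [e2, e4] at hmom
    simp only [Fin.sum_univ_three] at hmom hma ⊢
    -- Subtracting uᵢ times the mass equation passes from the conservative to the convective form.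
    linear_combination hmom - stVelocity u i (t, x) * hma
  · intro t ht x hx
    have hxc : x ∈ closedSlab := by rcases hx with h | h <;> simp [closedSlab, h]
    have ht0 := ht.1.le
    have htT := hlt ht.2
    obtain ⟨b1, b2, b3⟩ := h.boundary t ht.1 htT x hx _ rfl
    have hn : 2 * x 2 - 1 ≠ 0 := by rcases hx with h | h <;> rw [h] <;> norm_num
    simp only [Fin.sum_univ_three, Matrix.cons_val_zero, Matrix.cons_val_one, Matrix.cons_val,
      mul_zero, zero_add, mul_eq_zero, hn, or_false] at b1 b2
    have hu0 : ∀ y : E3, (y 2 = 0 ∨ y 2 = 1) → stVelocity u 2 (t, y) = 0 := fun y hy => by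
      have hn : 2 * y 2 - 1 ≠ 0 := by rcases hy with h | h <;> rw [h] <;> norm_num
      have := (h.boundary t ht.1 htT y hy _ rfl).1
      simpa only [Fin.sum_univ_three, Matrix.cons_val_zero, Matrix.cons_val_one, Matrix.cons_val,
        mul_zero, zero_add, mul_eq_zero, hn, or_false] using this
    -- The horizontal derivatives of the normal velocity vanish on the boundary, so a vanishing
    -- tangential component of (Du)n means a vanishing normal derivative of a horizontal velocity
    -- component.
    have hstr : ∀ i, strain (u t) x i 2 = 0 → i ≠ 2 → dx T 2 (stVelocity u i) (t, x) = 0 := by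
      intro i hi hi2
      have := strain_slice (U := stVelocity u) (u := u t) (t := t)
          (fun i => (hvel i).differentiableOn) (fun i => rfl) ht0 htT i 2 hxc
      simp only [hi, strn] at this
      rw [dx_eq_zero_of_boundary (hvel 2).differentiableOn ht0 htT hu0 hi2 hx] at this
      linarith
    have c0 := congrFun b3 0
    have c1 := congrFun b3 1
    simp only [cross_apply, Matrix.mulVec, dotProduct, Fin.sum_univ_three, Matrix.cons_val_zero,
      Matrix.cons_val_one, Matrix.cons_val, mul_zero, zero_add, sub_zero, zero_sub, Pi.zero_apply,
      mul_eq_zero, neg_eq_zero, hn, or_false] at c0 c1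
    -- With n parallel to e³, component 0 of the cross product isolates row 1 of the strain and
    -- component 1 isolates row 0; hence the exchange of `c0` and `c1`.
    refine ⟨b1, ?_, hstr 0 ?_ (by decide), hstr 1 ?_ (by decide)⟩
    · exact (pd_slice hR.differentiableOn ht0 htT 2 hxc).symm.trans b2
    · exact c1
    · exact c0

end NSK
end

/-! ### The functionals of the statement as Bochner integrals. -/

noncomputable section

namespace NSK

variable {T : EReal} {τ : ℝ} {p q r : ℝ≥0∞} {F G : ℝ × E3 → ℝ}

theorem Adm.lintegral_slice (hF : Adm T τ 1 F) {t : ℝ} (ht : t ∈ Icc 0 τ) {f : E3 → ℝ}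
    (hf : ∀ x ∈ slab, f x = F (t, x)) (h0 : ∀ x ∈ slab, 0 ≤ F (t, x)) :
    ∫⁻ x in slab, ENNReal.ofReal (f x) = ENNReal.ofReal (∫ x in slab, F (t, x)) := by
  rw [ofReal_integral_eq_lintegral_ofReal (hF.integrable_slice ht)
    (by filter_upwards [ae_restrict_mem measurableSet_slab] with x hx using h0 x hx)]
  exact setLIntegral_congr_fun measurableSet_slab fun x hx => by simp only [hf x hx]

theorem Adm.lintegral_time (hF : Adm T τ 1 F) {f : ℝ → E3 → ℝ}
    (hf : ∀ t ∈ Ioc 0 τ, ∀ x ∈ slab, f t x = F (t, x))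
    (h0 : ∀ t ∈ Ioc 0 τ, ∀ x ∈ slab, 0 ≤ F (t, x)) :
    ∫⁻ t in Ioc 0 τ, ∫⁻ x in slab, ENNReal.ofReal (f t x) =
      ENNReal.ofReal (∫ t in Ioc 0 τ, ∫ x in slab, F (t, x)) := by
  rw [ofReal_integral_eq_lintegral_ofReal hF.integrable_time
    (by
      filter_upwards [ae_restrict_mem measurableSet_Ioc] with t ht
      exact setIntegral_nonneg measurableSet_slab (h0 t ht))]
  exact setLIntegral_congr_fun measurableSet_Ioc fun t ht =>
    hF.lintegral_slice (Ioc_subset_Icc_self ht) (hf t ht) (h0 t ht)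

section Functionals

variable {α γ ν ε : ℝ} {ρ : ℝ → E3 → ℝ} {u : ℝ → E3 → E3} {t : ℝ}

theorem IsSmoothSolution.energyE_eq (h : IsSmoothSolution α γ ν ε T ρ u) (hε : 0 < ε) (hγ : 1 < γ)
    (hγ2 : γ ≤ 2) (ht : t ∈ Icc 0 τ) (hτ : (τ : EReal) < T) :
    energyE α γ ε (ρ t) (u t) = ENNReal.ofReal (∫ x in slab, energyDens γ (1 / ε ^ 2)
      (1 / ε ^ (2 * (1 - α))) T (stDensity ρ) (stVelocity u) (t, x)) := by
  have hf := h.flow hγ (ht.1.trans ht.2) hτ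
  have hm : ∀ x ∈ slab, (t, x) ∈ spaceTime T := fun x hx => mem_spaceTime hτ ht (slab_subset hx)
  refine (hf.adm_energyDens hγ hγ2).lintegral_slice ht (fun x hx => ?_) (fun x hx => ?_)
  · have : gradSq (ρ t) x = ∑ i, dx T i (stDensity ρ) (t, x) ^ 2 :=
      gradSq_slice hf.admR.differentiableOn ht.1 (hm x hx).2.1 (slab_subset hx)
    rw [energyDens, this, EuclideanSpace.norm_sq_eq]
    simp only [Real.norm_eq_abs, sq_abs, ← sq]
    field_simp
  · have h1 := internalEnergy_nonneg hγ (hf.pos _ (hm x hx))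
    have h2 : 0 ≤ ∑ i, stVelocity u i (t, x) * stVelocity u i (t, x) :=
      Finset.sum_nonneg fun _ _ => mul_self_nonneg _
    have h3 : 0 ≤ ∑ i, dx T i (stDensity ρ) (t, x) * dx T i (stDensity ρ) (t, x) :=
      Finset.sum_nonneg fun _ _ => mul_self_nonneg _
    have h4 := hf.pos _ (hm x hx)
    rw [energyDens]
    positivity

theorem IsSmoothSolution.gradSq_log_eq (h : IsSmoothSolution α γ ν ε T ρ u) (hγ : 1 < γ)
    (h0 : 0 ≤ t) (hτ : (t : EReal) < T) {x : E3} (hx : x ∈ closedSlab) :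
    gradSq (fun y => Real.log (ρ t y)) x = Flow.logSq T (stDensity ρ) (t, x) :=
  gradSq_slice (h.flow hγ h0 hτ).adm_log.differentiableOn h0 hτ hx

theorem IsSmoothSolution.entropyF_eq (h : IsSmoothSolution α γ ν ε T ρ u) (hγ : 1 < γ)
    (ht : t ∈ Icc 0 τ) (hτ : (τ : EReal) < T) :
    entropyF ν (ρ t) = ENNReal.ofReal (ν ^ 2 / 2 *
      ∫ x in slab, stDensity ρ (t, x) * Flow.logSq T (stDensity ρ) (t, x)) := by
  have hf := h.flow hγ (ht.1.trans ht.2) hτ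
  have hm : ∀ x ∈ slab, (t, x) ∈ spaceTime T := fun x hx => mem_spaceTime hτ ht (slab_subset hx)
  rw [← integral_const_mul]
  refine ((hf.admR.bdd_mul hf.adm_logSq).const_mul _).lintegral_slice ht (fun x hx => ?_)
    (fun x hx => ?_)
  · rw [h.gradSq_log_eq hγ ht.1 (hm x hx).2.1 (slab_subset hx)]
  · have := (hf.pos _ (hm x hx)).le
    have := Flow.logSq_nonneg (T := T) (R := stDensity ρ) (t, x)
    positivity

/-- Since |∇√ρ|² = |∇ρ|²/(4ρ) and P'(ρ) = ρ·ρ^(γ-2), this term is a quarter of the pressure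
dissipation in the BD balance. -/
theorem IsSmoothSolution.pressure_term_eq (h : IsSmoothSolution α γ ν ε T ρ u) (hγ : 1 < γ)
    (h0 : 0 ≤ τ) (hτ : (τ : EReal) < T) :
    ∫⁻ t in Ioc 0 τ, ∫⁻ x in slab, ENNReal.ofReal
      (deriv (pressure γ) (ρ t x) * gradSq (fun y => Real.sqrt (ρ t y)) x) =
    ENNReal.ofReal (1 / 4 * ∫ t in Ioc 0 τ, ∫ x in slab,
      stDensity ρ (t, x) ^ (γ - 2) * ∑ i, dx T i (stDensity ρ) (t, x) ^ 2) := by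
  have hf := h.flow hγ h0 hτ
  simp only [← integral_const_mul]
  refine ((hf.adm_pressure (γ - 2)).const_mul (1 / 4)).lintegral_time (fun t ht x hx => ?_)
    (fun t ht x hx => ?_)
  · have hm : (t, x) ∈ spaceTime T := hf.mem ⟨ht, hx⟩
    have hp : 0 < ρ t x := hf.pos _ hm
    rw [(hasDerivAt_pressure hγ _ hp).deriv]
    have hg := gradSq_slice (F := fun x => Real.sqrt (stDensity ρ x)) (fun y hy =>
      (Real.hasDerivAt_sqrt (hf.pos y hy).ne').differentiableAt.comp_differentiableWithinAt y
        (hf.admR.differentiableOn y hy)) hm.1 hm.2.1 hm.2.2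
    simp only at hg
    rw [hg]
    have hi : ∀ i, dx T i (fun x => Real.sqrt (stDensity ρ x)) (t, x) =
        1 / (2 * Real.sqrt (ρ t x)) * dx T i (stDensity ρ) (t, x) := fun i =>
      (HasDD.comp (Real.hasDerivAt_sqrt hp.ne') (hf.admR.hasDD _ hm)).eq
    simp only [hi, mul_pow, div_pow, one_pow, Real.sq_sqrt hp.le, ← Finset.mul_sum]
    field_simp
    norm_num
    ring
  · have := Real.rpow_nonneg (hf.pos (t, x) (hf.mem ⟨ht, hx⟩)).le (γ - 2)
    have : 0 ≤ ∑ i, dx T i (stDensity ρ) (t, x) ^ 2 := Finset.sum_nonneg fun _ _ => sq_nonneg _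
    positivity

theorem IsSmoothSolution.hessian_term_eq (h : IsSmoothSolution α γ ν ε T ρ u) (hγ : 1 < γ)
    (h0 : 0 ≤ τ) (hτ : (τ : EReal) < T) :
    ∫⁻ t in Ioc 0 τ, ∫⁻ x in slab, ENNReal.ofReal (hessSq (ρ t) x) =
    ENNReal.ofReal (∫ t in Ioc 0 τ, ∫ x in slab,
      ∑ i, ∑ j, dx T i (dx T j (stDensity ρ)) (t, x) ^ 2) := by
  have hf := h.flow hγ h0 hτ
  refine hf.adm_hess.lintegral_time (fun t ht x hx => ?_) fun t ht x hx =>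
    Finset.sum_nonneg fun _ _ => Finset.sum_nonneg fun _ _ => sq_nonneg _
  have hm : (t, x) ∈ spaceTime T := hf.mem ⟨ht, hx⟩
  exact Finset.sum_congr rfl fun i _ => Finset.sum_congr rfl fun j _ => congrArg (· ^ 2)
    (pd_pd_slice hf.admR hm.1 hm.2.1 i j hm.2.2)

/-- The BD entropy estimate for smooth solutions of the system. -/
theorem IsSmoothSolution.entropy_estimate (h : IsSmoothSolution α γ ν ε T ρ u) (hν : 0 < ν)
    (hα : α ≤ 1) (hγ : 1 < γ) (hγ2 : γ ≤ 2) {K : ℝ} (hK : 0 < K) (hε : 0 < ε) (hε1 : ε ≤ 1)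
    (hεK : ε ≤ 1 / (2 ^ 22 * (1 + K)))
    (hE : energyE α γ ε (ρ 0) (u 0) + entropyF ν (ρ 0) ≤ ENNReal.ofReal K) (h0 : 0 ≤ τ)
    (hτ : (τ : EReal) < T) :
    entropyF ν (ρ τ)
      + ENNReal.ofReal (ν / ε ^ 2) * (∫⁻ t in Ioc 0 τ, ∫⁻ x in slab, ENNReal.ofReal
          (deriv (pressure γ) (ρ t x) * gradSq (fun y => Real.sqrt (ρ t y)) x))
      + ENNReal.ofReal (ν / ε ^ (2 * (1 - α))) *
          (∫⁻ t in Ioc 0 τ, ∫⁻ x in slab, ENNReal.ofReal (hessSq (ρ t) x))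
      ≤ ENNReal.ofReal ((13 * K + 8 * ν * K) * (1 + τ)) := by
  have hf := h.flow hγ h0 hτ
  have hz : (0 : ℝ) ∈ Icc 0 τ := left_mem_Icc.2 h0
  have hεr : 0 < ε ^ (2 * (1 - α)) := Real.rpow_pos_of_pos hε _
  have hlog : ∀ t ∈ Icc 0 τ, 0 ≤ ν ^ 2 / 2 * ∫ x in slab, stDensity ρ (t, x) *
      Flow.logSq T (stDensity ρ) (t, x) := fun t ht =>
    mul_nonneg (by positivity) (setIntegral_nonneg measurableSet_slab fun x hx =>
      mul_nonneg (hf.pos _ (mem_spaceTime hτ ht (slab_subset hx))).le (Flow.logSq_nonneg _))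
  rw [h.energyE_eq hε hγ hγ2 hz hτ, h.entropyF_eq hγ hz hτ,
    ← ENNReal.ofReal_add (hf.energy_nonneg hγ (by positivity) (by positivity) hz) (hlog 0 hz),
    ENNReal.ofReal_le_ofReal_iff hK.le] at hE
  -- The threshold on ε is exactly the square root of the largeness condition on a in `bd_estimate`.
  have ha : 2 ^ 44 * (1 + K) ^ 2 ≤ 1 / ε ^ 2 := by
    rw [le_div_iff₀ (by positivity)] at hεK ⊢
    calc 2 ^ 44 * (1 + K) ^ 2 * ε ^ 2 = (ε * (2 ^ 22 * (1 + K))) ^ 2 := by ring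
      _ ≤ 1 := pow_le_one₀ (by positivity) hεK
  have hκ : 1 ≤ 1 / ε ^ (2 * (1 - α)) := by
    rw [le_div_iff₀ hεr, one_mul]
    exact Real.rpow_le_one hε.le hε1 (by linarith)
  have main := hf.bd_estimate hν hγ hγ2 ha hκ (by positivity) (by rw [div_pow, one_pow]) hE
  rw [h.entropyF_eq hγ (right_mem_Icc.2 h0) hτ, h.pressure_term_eq hγ h0 hτ,
    h.hessian_term_eq hγ h0 hτ]
  set X := ∫ t in Ioc 0 τ, ∫ x in slab,
    stDensity ρ (t, x) ^ (γ - 2) * ∑ i, dx T i (stDensity ρ) (t, x) ^ 2 with hX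
  set Y := ∫ t in Ioc 0 τ, ∫ x in slab, ∑ i, ∑ j, dx T i (dx T j (stDensity ρ)) (t, x) ^ 2 with hY
  have hX0 : 0 ≤ X := setIntegral_nonneg measurableSet_Ioc fun t ht =>
    setIntegral_nonneg measurableSet_slab fun x hx =>
      mul_nonneg (Real.rpow_nonneg (hf.pos _ (hf.mem ⟨ht, hx⟩)).le _)
        (Finset.sum_nonneg fun _ _ => sq_nonneg _)
  have hY0 : 0 ≤ Y := setIntegral_nonneg measurableSet_Ioc fun t ht =>
    setIntegral_nonneg measurableSet_slab fun x hx =>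
      Finset.sum_nonneg fun _ _ => Finset.sum_nonneg fun _ _ => sq_nonneg _
  rw [← ENNReal.ofReal_mul (by positivity), ← ENNReal.ofReal_mul (by positivity),
    ← ENNReal.ofReal_add (hlog τ (right_mem_Icc.2 h0)) (by positivity),
    ← ENNReal.ofReal_add (add_nonneg (hlog τ (right_mem_Icc.2 h0)) (by positivity))
      (by positivity)]
  refine ENNReal.ofReal_le_ofReal ?_
  have e1 : ν / ε ^ 2 * (1 / 4 * X) ≤ ν * (1 / ε ^ 2 * X) := by
    have : 0 ≤ ν / ε ^ 2 * X := by positivity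
    rw [← mul_assoc ν, mul_one_div]
    linarith
  have e2 : ν / ε ^ (2 * (1 - α)) * Y = ν * (1 / ε ^ (2 * (1 - α)) * Y) := by
    rw [← mul_assoc ν, mul_one_div]
  have e3 : 0 ≤ K * τ := by positivity
  have e4 : 0 ≤ ν * K := by positivity
  rw [e2]
  linarith

end Functionals

end NSK
end

/-! ### Bounds on the initial data, and the theorem. -/

noncomputable section

namespace NSK

theorem aemeasurable_norm_sq {V : Type} [NormedAddCommGroup V] {f : E3 → V}
    (hf : ContinuousOn f closedSlab) :
    AEMeasurable (fun x => ENNReal.ofReal (‖f x‖ ^ 2)) (volume.restrict slab) :=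
  ((show ContinuousOn (fun x => ‖f x‖ ^ 2) slab from
    ((hf.mono slab_subset).norm.pow 2)).aemeasurable measurableSet_slab).ennreal_ofReal

theorem continuousOn_pd {f : E3 → ℝ} (hf : ContDiffOn ℝ ∞ f closedSlab) (i : Fin 3) :
    ContinuousOn (pd i f) closedSlab :=
  (hf.continuousOn_fderivWithin uniqueDiffOn_closedSlab (by simp)).clm_apply continuousOn_const

theorem lintegral_norm_sq_le {V : Type} [NormedAddCommGroup V] {f : E3 → V} {M : ℝ≥0}
    (hf : eLpNorm f 2 (volume.restrict slab) ≤ M) :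
    ∫⁻ x in slab, ENNReal.ofReal (‖f x‖ ^ 2) ≤ ENNReal.ofReal ((M : ℝ) ^ 2) := by
  have h := eLpNorm_nnreal_pow_eq_lintegral (f := f) (μ := volume.restrict slab) (p := 2)
    (by norm_num)
  simp only [NNReal.coe_ofNat, ENNReal.rpow_ofNat, ENNReal.coe_ofNat] at h
  simp only [ENNReal.ofReal_pow (norm_nonneg _), ofReal_norm]
  rw [← h, ENNReal.ofReal_pow M.coe_nonneg, ENNReal.ofReal_coe_nnreal]
  exact pow_le_pow_left' hf 2

theorem pd_one_add_mul {f : E3 → ℝ} (hf : DifferentiableOn ℝ f closedSlab) (c : ℝ) (i : Fin 3)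
    {x : E3} (hx : x ∈ closedSlab) : pd i (fun x => 1 + c * f x) x = c * pd i f x := by
  simp only [pd]
  rw [fderivWithin_const_add, fderivWithin_const_mul (uniqueDiffOn_closedSlab x hx) (hf x hx)]
  rfl

/-- The energy and the BD entropy of bounded families of initial data are bounded. -/
theorem IsSmoothSolution.initial_bound {α γ ν ε : ℝ} {T : EReal} {ρ : ℝ → E3 → ℝ}
    {u : ℝ → E3 → E3} {r₀ : E3 → ℝ} {u₀ : E3 → E3} {M : ℝ≥0}
    (h : IsSmoothSolution α γ ν ε T ρ u) (hT : 0 < T) (hα : 0 ≤ α) (hγ : 1 < γ) (hγ2 : γ ≤ 2)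
    (hε : 0 < ε) (hε1 : ε ≤ 1) (hεM : ε * M ≤ 1 / 2)
    (hi : ∀ x ∈ closedSlab, ρ 0 x = 1 + ε * r₀ x ∧ u 0 x = u₀ x)
    (hr : ContDiffOn ℝ ∞ r₀ closedSlab) (hu : ContDiffOn ℝ ∞ u₀ closedSlab)
    (hr2 : eLpNorm r₀ 2 (volume.restrict slab) ≤ M)
    (hdr : ∀ i, eLpNorm (pd i r₀) 2 (volume.restrict slab) ≤ M)
    (hrt : eLpNorm r₀ ⊤ (volume.restrict slab) ≤ M)
    (hu2 : eLpNorm u₀ 2 (volume.restrict slab) ≤ M) :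
    energyE α γ ε (ρ 0) (u 0) + entropyF ν (ρ 0) ≤
      ENNReal.ofReal ((2 + 3 * (1 + ν ^ 2)) * (M : ℝ) ^ 2) := by
  have h0 : ((0 : ℝ) : EReal) < T := by exact_mod_cast hT
  have hf := h.flow hγ le_rfl h0
  have hsup : ∀ᵐ x ∂volume.restrict slab, |r₀ x| ≤ M := by
    rw [eLpNorm_exponent_top] at hrt
    filter_upwards [ae_le_eLpNormEssSup (f := r₀) (μ := volume.restrict slab)] with x hx
    have := hx.trans hrt
    rw [← ofReal_norm, ← ENNReal.ofReal_coe_nnreal] at this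
    exact (ENNReal.ofReal_le_ofReal_iff M.coe_nonneg).1 this
  have hgrad : ∀ x ∈ closedSlab, gradSq (ρ 0) x = ε ^ 2 * gradSq r₀ x := fun x hx => by
    rw [gradSq, gradSq, Finset.mul_sum]
    refine Finset.sum_congr rfl fun i _ => ?_
    rw [pd_congr (g := fun x => 1 + ε * r₀ x) (fun y hy => (hi y hy).1) i hx,
      pd_one_add_mul (hr.differentiableOn (by simp)) ε i hx, mul_pow]
  have hG : ∀ x, 0 ≤ gradSq r₀ x := fun x => Finset.sum_nonneg fun _ _ => sq_nonneg _
  have hεr : 0 < ε ^ (2 * (1 - α)) := Real.rpow_pos_of_pos hε _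
  -- The factor ε² from ∇ρ₀ = ε∇r₀ compensates the capillary weight, because α ≥ 0.
  have hε2 : ε ^ 2 ≤ ε ^ (2 * (1 - α)) := by
    rw [← Real.rpow_two]
    exact Real.rpow_le_rpow_of_exponent_ge hε hε1 (by linarith)
  have hE : energyE α γ ε (ρ 0) (u 0) ≤ ∫⁻ x in slab, (ENNReal.ofReal (‖r₀ x‖ ^ 2) +
      ENNReal.ofReal (‖u₀ x‖ ^ 2) + ENNReal.ofReal (gradSq r₀ x)) := by
    refine lintegral_mono_ae ?_
    filter_upwards [hsup, ae_restrict_mem measurableSet_slab] with x hx hxs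
    have hxc := slab_subset hxs
    rw [← ENNReal.ofReal_add (by positivity) (by positivity),
      ← ENNReal.ofReal_add (by positivity) (hG x)]
    refine ENNReal.ofReal_le_ofReal ?_
    have hp : 0 < ρ 0 x := hf.pos (0, x) ⟨le_rfl, h0, hxc⟩
    obtain ⟨e1, e2⟩ := hi x hxc
    have i1 : internalEnergy γ (ρ 0 x) / ε ^ 2 ≤ ‖r₀ x‖ ^ 2 := by
      rw [div_le_iff₀ (by positivity), Real.norm_eq_abs, sq_abs]
      refine (internalEnergy_le hγ hγ2 hp).trans_eq ?_
      rw [e1]; ring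
    have i2 : ρ 0 x ≤ 2 := by
      have := mul_le_mul_of_nonneg_left ((le_abs_self _).trans hx) hε.le
      rw [e1]; linarith
    have i3 : ρ 0 x * ‖u 0 x‖ ^ 2 / 2 ≤ ‖u₀ x‖ ^ 2 := by
      rw [e2]
      have := mul_le_mul_of_nonneg_right i2 (sq_nonneg ‖u₀ x‖)
      linarith
    have i4 : gradSq (ρ 0) x / (2 * ε ^ (2 * (1 - α))) ≤ gradSq r₀ x := by
      rw [hgrad x hxc, div_le_iff₀ (by positivity), mul_comm]
      exact mul_le_mul_of_nonneg_left (by linarith) (hG x)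
    linarith
  have hF : entropyF ν (ρ 0) ≤ ∫⁻ x in slab, ENNReal.ofReal (ν ^ 2) *
      ENNReal.ofReal (gradSq r₀ x) := by
    refine lintegral_mono_ae ?_
    filter_upwards [hsup, ae_restrict_mem measurableSet_slab] with x hx hxs
    have hxc := slab_subset hxs
    have hm : ((0 : ℝ), x) ∈ spaceTime T := ⟨le_rfl, h0, hxc⟩
    rw [← ENNReal.ofReal_mul (by positivity)]
    refine ENNReal.ofReal_le_ofReal ?_
    have hl := hf.gradSq_eq hm
    have hs : gradSq (ρ 0) x = _ := gradSq_slice hf.admR.differentiableOn le_rfl h0 hxc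
    rw [← hs, hgrad x hxc] at hl
    rw [h.gradSq_log_eq hγ le_rfl h0 hxc]
    have hL := Flow.logSq_nonneg (T := T) (R := stDensity ρ) (0, x)
    set L := Flow.logSq T (stDensity ρ) (0, x)
    change _ = ρ 0 x ^ 2 * L at hl
    -- Away from vacuum, ρ|∇log ρ|² = |∇ρ|²/ρ is at most 2|∇ρ|².
    have i2 : 1 / 2 ≤ ρ 0 x := by
      have := mul_le_mul_of_nonneg_left ((neg_le_abs _).trans hx) hε.le
      rw [(hi x hxc).1]; linarith
    have i3 : ρ 0 x * L ≤ 2 * gradSq r₀ x := by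
      have j1 : ε ^ 2 * gradSq r₀ x ≤ gradSq r₀ x :=
        mul_le_of_le_one_left (hG x) (pow_le_one₀ hε.le hε1)
      have j2 : 1 / 2 * (ρ 0 x * L) ≤ ρ 0 x * (ρ 0 x * L) :=
        mul_le_mul_of_nonneg_right i2 (mul_nonneg (by linarith) hL)
      nlinarith
    have := mul_le_mul_of_nonneg_left i3 (sq_nonneg ν)
    linarith
  have hgi : ∫⁻ x in slab, ENNReal.ofReal (gradSq r₀ x) ≤ ENNReal.ofReal (3 * (M : ℝ) ^ 2) := by
    have : ∀ x, ENNReal.ofReal (gradSq r₀ x) = ∑ i, ENNReal.ofReal (‖pd i r₀ x‖ ^ 2) := fun x => by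
      rw [gradSq, ENNReal.ofReal_sum_of_nonneg fun _ _ => sq_nonneg _]
      simp only [Real.norm_eq_abs, sq_abs]
    simp only [this]
    rw [lintegral_finsetSum' _ fun i _ => aemeasurable_norm_sq (continuousOn_pd hr i)]
    refine (Finset.sum_le_sum fun i _ => lintegral_norm_sq_le (hdr i)).trans ?_
    rw [Fin.sum_univ_three, ← ENNReal.ofReal_add (by positivity) (by positivity),
      ← ENNReal.ofReal_add (by positivity) (by positivity)]
    exact ENNReal.ofReal_le_ofReal (by linarith)
  have hmr := aemeasurable_norm_sq hr.continuousOn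
  have hmu := aemeasurable_norm_sq hu.continuousOn
  rw [lintegral_add_left' (hmr.fun_add hmu), lintegral_add_left' hmr] at hE
  rw [lintegral_const_mul' _ _ ENNReal.ofReal_ne_top] at hF
  calc energyE α γ ε (ρ 0) (u 0) + entropyF ν (ρ 0)
      ≤ (ENNReal.ofReal ((M : ℝ) ^ 2) + ENNReal.ofReal ((M : ℝ) ^ 2) +
          ENNReal.ofReal (3 * (M : ℝ) ^ 2)) +
          ENNReal.ofReal (ν ^ 2) * ENNReal.ofReal (3 * (M : ℝ) ^ 2) :=
        add_le_add (hE.trans (add_le_add (add_le_add (lintegral_norm_sq_le hr2)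
          (lintegral_norm_sq_le hu2)) hgi)) (hF.trans (mul_le_mul_right hgi _))
    _ = _ := by
        rw [← ENNReal.ofReal_mul (by positivity), ← ENNReal.ofReal_add (by positivity)
          (by positivity), ← ENNReal.ofReal_add (by positivity) (by positivity),
          ← ENNReal.ofReal_add (by positivity) (by positivity)]
        congr 1
        ring

end NSK
end

theorem propositionp (ν : ℝ) (hν : 0 < ν) :
    ∃ ε₀ C : ℝ → ℝ, (∀ K₀ : ℝ, 0 < K₀ → 0 < ε₀ K₀ ∧ 0 < C K₀) ∧
      ∀ (α γ : ℝ), 0 ≤ α → α ≤ 1 → 1 < γ → γ ≤ 2 → (0 < α → γ = 2) →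
      ∀ (r₀ : ℝ → NSK.E3 → ℝ) (u₀ : ℝ → NSK.E3 → NSK.E3)
        (T : ℝ → EReal) (ρ : ℝ → ℝ → NSK.E3 → ℝ) (u : ℝ → ℝ → NSK.E3 → NSK.E3),
        NSK.IsBoundedData r₀ u₀ →
        (∀ ε ∈ Set.Ioc (0 : ℝ) 1, 0 < T ε ∧
          NSK.IsSmoothSolution α γ ν ε (T ε) (ρ ε) (u ε) ∧
          ∀ x ∈ NSK.closedSlab, ρ ε 0 x = 1 + ε * r₀ ε x ∧ u ε 0 x = u₀ ε x) →
        -- the initial energies are bounded uniformly for small `ε`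
        (∃ K₀ ε₁ : ℝ, 0 < K₀ ∧ 0 < ε₁ ∧ ε₁ ≤ 1 ∧ ∀ ε ∈ Set.Ioc 0 ε₁,
          NSK.energyE α γ ε (ρ ε 0) (u ε 0) + NSK.entropyF ν (ρ ε 0) ≤ ENNReal.ofReal K₀) ∧
        -- any such bound `K₀` gives the BD entropy estimate
        (∀ K₀ ε₁ : ℝ, 0 < K₀ → 0 < ε₁ → ε₁ ≤ 1 →
          (∀ ε ∈ Set.Ioc 0 ε₁,
            NSK.energyE α γ ε (ρ ε 0) (u ε 0) + NSK.entropyF ν (ρ ε 0) ≤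
              ENNReal.ofReal K₀) →
          ∀ ε : ℝ, 0 < ε → ε ≤ ε₀ K₀ → ε ≤ ε₁ → ∀ t : ℝ, 0 ≤ t → (t : EReal) < T ε →
            NSK.entropyF ν (ρ ε t)
              + ENNReal.ofReal (ν / ε ^ 2) *
                (∫⁻ τ in Set.Ioc 0 t, ∫⁻ x in NSK.slab, ENNReal.ofReal
                  (deriv (NSK.pressure γ) (ρ ε τ x) *
                    NSK.gradSq (fun y => Real.sqrt (ρ ε τ y)) x))
              + ENNReal.ofReal (ν / ε ^ (2 * (1 - α))) *
                (∫⁻ τ in Set.Ioc 0 t, ∫⁻ x in NSK.slab, ENNReal.ofReal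
                  (NSK.hessSq (ρ ε τ) x))
              ≤ ENNReal.ofReal (C K₀ * (1 + t))) := by
  -- Both witnesses come from `entropy_estimate`; C dominates 13K + 8νKt after multiplication by 1 +
  -- t.
  refine ⟨fun K => 1 / (2 ^ 22 * (1 + K)), fun K => 13 * K + 8 * ν * K, fun K hK =>
    ⟨by positivity, by positivity⟩, ?_⟩
  intro α γ hα hα1 hγ hγ2 _ r₀ u₀ T ρ u hdata hsol
  constructor
  · obtain ⟨M, hM⟩ := hdata.bounded
    have hM1 : (0 : ℝ) < 2 * (M + 1) := by positivity
    -- The added ones keep K₀ and the denominator positive when M = 0; the second entry of the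
    -- minimum forces εM ≤ 1/2.
    refine ⟨(2 + 3 * (1 + ν ^ 2)) * (M : ℝ) ^ 2 + 1, min 1 (1 / (2 * (M + 1))), by positivity,
      lt_min one_pos (by positivity), min_le_left _ _, fun ε hε => ?_⟩
    have hε1 : ε ≤ 1 := hε.2.trans (min_le_left _ _)
    have hεM : ε * (2 * (M + 1)) ≤ 1 := (le_div_iff₀ hM1).1 (hε.2.trans (min_le_right _ _))
    obtain ⟨hT, hs, hi⟩ := hsol ε ⟨hε.1, hε1⟩
    obtain ⟨h1, h2, h3, h4⟩ := hM ε ⟨hε.1, hε1⟩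
    obtain ⟨hr, hu⟩ := hdata.smooth ε ⟨hε.1, hε1⟩
    refine (hs.initial_bound hT hα hγ hγ2 hε.1 hε1 ?_ hi hr hu h1 h2 h3 h4).trans
      (ENNReal.ofReal_le_ofReal (by linarith))
    have := hε.1
    linarith
  · intro K₀ ε₁ hK _ hε₁ hE ε hε hεK hεε₁ t ht0 htT
    obtain ⟨-, hs, -⟩ := hsol ε ⟨hε, hεε₁.trans hε₁⟩
    exact hs.entropy_estimate hν hα1 hγ hγ2 hK hε (hεε₁.trans hε₁) hεK (hE ε ⟨hε, hεε₁⟩) ht0 htT
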